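/- All vector spaces are over $\mathbb{C}$. Let $(\mathfrak g,\cdot)$ be a (left) pre-Lie algebra, i.e. $(x\cdot y)\cdot z-x\cdot(y\cdot z)$ is symmetric in $x,y$, and let $(V;\mathcal L,\mathcal R)$ be a representation of it: $\mathcal L,\mathcal R:\mathfrak g\to \mathfrak{gl}(V)$ are linear with $$\mathcal L_x\mathcal L_y-\mathcal L_{x\cdot y}=\mathcal L_y\mathcal L_x-\mathcal L_{y\cdot x},\qquad \mathcal L_x\mathcal R_y-\mathcal R_y\mathcal L_x=\mathcal R_{x\cdot y}-\mathcal R_y\mathcal R_x .$$ Let $H:\mathfrak g\otimes\mathfrak g\to V$ be a $2$-cocycle: for all $x,y,z\in\mathfrak g$, $$\mathcal L_xH(y,z)-\mathcal L_yH(x,z)+\mathcal R_zH(y,x)-\mathcal R_zH(x,y)-H(y,x\cdot z)+H(x,y\cdot z)-H(x\cdot y-y\cdot x,z)=0 .$$ A linear map $K:V\to\mathfrak g$ is a *relative cocycle weighted Reynolds operator* (with weight $H$) if $Ku\cdot Kv=K(\mathcal L_{Ku}v+\mathcal R_{Kv}u+H(Ku,Kv))$ for all $u,v\in V$. *Conventions.*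 $S_{(i_1,\dots,i_k)}$ denotes the set of permutations $\sigma$ of $\{1,\dots,i_1+\dots+i_k\}$ that are increasing on each of the consecutive blocks of sizes $i_1,\dots,i_k$; it is empty if some $i_j<0$. $\chi(\sigma)$ is the Koszul sign for $x\wedge y=-(-1)^{|x||y|}y\wedge x$ (the signature times the usual Koszul sign). An *$L_\infty$-algebra* is a $\mathbb Z$-graded vector space $E$ with graded skew-symmetric multilinear maps $l_k:E^k\to E$ of degree $2-k$, $k\ge1$, such that for all $n\ge1$ and all homogeneous $x_1,\dots,x_n$ $$\sum_{i+j=n+1}(-1)^i\sum_{\sigma\in S_{(i,n-i)}}\chi(\sigma)\,l_j(l_i(x_{\sigma(1)},\dots,x_{\sigma(i)}),x_{\sigma(i+1)},\dots,x_{\sigma(n)})=0 .$$ A *Maurer–Cartan element* is an $\alpha$ of degree $1$ such that $l_k(\alpha,\dots,\alpha)$ vanishes for all sufficiently large $k$ and $\sum_{k\ge1}\frac1{k!}l_k(\alpha,\dots,\alpha)=0$. For a vector space $W$ and $P\in\mathrm{Hom}(\wedge^{p}W\otimes W,W)$, $Q\in\mathrm{Hom}(\wedge^{q}W\otimes W,W)$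 the *Matsushima–Nijenhuis bracket* is $[P,Q]^{MN}=P\diamond Q-(-1)^{pq}Q\diamond P$, where $$\begin{aligned}(P\diamond Q)(x_1,\dots,x_{p+q+1})={}&\sum_{\sigma\in S_{(q,1,p-1)}}\mathrm{sgn}(\sigma)\,P(Q(x_{\sigma(1)},\dots,x_{\sigma(q+1)}),x_{\sigma(q+2)},\dots,x_{\sigma(p+q)},x_{p+q+1})\\&+(-1)^{pq}\sum_{\sigma\in S_{(p,q)}}\mathrm{sgn}(\sigma)\,P(x_{\sigma(1)},\dots,x_{\sigma(p)},Q(x_{\sigma(p+1)},\dots,x_{\sigma(p+q)},x_{p+q+1})).\end{aligned}$$ Maps $\wedge^{n-1}V\otimes V\to\mathfrak g$ are regarded as maps $\wedge^{n-1}(\mathfrak g\oplus V)\otimes(\mathfrak g\oplus V)\to\mathfrak g\oplus V$ by the projection to $V$ and the inclusion of $\mathfrak g$. Let $\mu+\mathcal L+\mathcal R$ be the product $((x,u),(y,v))\mapsto(x\cdot y,\mathcal L_xv+\mathcal R_yu)$ on $\mathfrak g\oplus V$. **Theorem.** The graded vector space $\bigoplus_{n\ge0}\mathrm{Hom}(\wedge^{n-1}V\otimes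 V,\mathfrak g)$ (with $\mathrm{Hom}(\wedge^{n-1}V\otimes V,\mathfrak g)$ in degree $n$, the summand for $n=0$ being zero) is an $L_\infty$-algebra with $l_1=0$, $l_k=0$ for $k\ge4$, and, for $P,Q,R$ of degrees $p,q,r\geq 1$, with $$l_2(P,Q)=\llbracket P,Q\rrbracket:=(-1)^{p-1}[[\mu+\mathcal L+\mathcal R,P]^{MN},Q]^{MN}$$ and $$\begin{aligned}l_3(P,Q,R)=\llbracket P,Q,R\rrbracket:={}&(-1)^{rq+p-1}A(P;Q,R)+(-1)^{p}A(P;R,Q)\\ &+(-1)^{(r+1)(p+q+1)+pq+p+1}B(P;Q,R)+(-1)^{pq+pr+q+r+1}B(P;R,Q)\\ &+(-1)^{pq+q+1}A(Q;R,P)+(-1)^{rp+pq+q}A(Q;P,R)\\ &+(-1)^{qr+p+r}B(Q;R,P)+(-1)^{(r-1)(p+q-1)+q}B(Q;P,R)\\ &+(-1)^{(r-1)(p+q-1)+p+q-1}A(R;Q,P)+(-1)^{p(q-1)+(r-1)(p+q-1)+q}A(R;P,Q)\\ &+(-1)^{p+q+1}B(R;Q,P)+(-1)^{pq+p+q}B(R;P,Q),\end{aligned}$$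 where, for $P,Q,R$ of any degrees $p,q,r\ge1$ and $u_1,\dots,u_{p+q+r-1}\in V$, $$\begin{aligned}A(P;Q,R)(u_1,\dots,u_{p+q+r-1})=\sum_{\sigma\in S_{(q-1,1,r-1,1,p-2)}}\mathrm{sgn}(\sigma)\,P\big(&H(Q(u_{\sigma(1)},\dots,u_{\sigma(q)}),R(u_{\sigma(q+1)},\dots,u_{\sigma(q+r)})),\\&u_{\sigma(q+r+1)},\dots,u_{\sigma(p+q+r-2)},u_{p+q+r-1}\big),\\ B(P;Q,R)(u_1,\dots,u_{p+q+r-1})=\sum_{\sigma\in S_{(p-1,q-1,1,r-1)}}\mathrm{sgn}(\sigma)\,P\big(&u_{\sigma(1)},\dots,u_{\sigma(p-1)},H(Q(u_{\sigma(p)},\dots,u_{\sigma(p+q-1)}),\\&R(u_{\sigma(p+q)},\dots,u_{\sigma(p+q+r-2)},u_{p+q+r-1}))\big).\end{aligned}$$ Moreover, a linear map $K:V\to\mathfrak g$ is a relative cocycle weighted Reynolds operator if and only if $K$, as an element of degree $1$, is a Maurer–Cartan element of this $L_\infty$-algebra. -/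

import Mathlib

open scoped DirectSum

/-! ### Unshuffles and Koszul signs -/

/-- `σ` is an unshuffle with consecutive blocks of sizes `b = [i₁, …, i_k]`, where
`i₁ + ⋯ + i_k = n`: it is increasing on each block.  Two positions `s < t` lie in the same block iff
no partial sum `c = i₁ + ⋯ + i_l` satisfies `s < c ≤ t`. -/
def IsUnshuffle (b : List ℕ) {n : ℕ} (σ : Equiv.Perm (Fin n)) : Prop :=
  ∀ s t : Fin n, s < t →
    (∀ c ∈ b.scanl (· + ·) 0, ¬ ((s : ℕ) < c ∧ c ≤ (t : ℕ))) → σ s < σ t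

instance (b : List ℕ) {n : ℕ} (σ : Equiv.Perm (Fin n)) : Decidable (IsUnshuffle b σ) := by
  unfold IsUnshuffle
  infer_instance

/-- The set `S(i₁, …, i_k)` of the unshuffles of `n = i₁ + ⋯ + i_k` elements. -/
def unshuffles (b : List ℕ) (n : ℕ) : Finset (Equiv.Perm (Fin n)) :=
  Finset.univ.filter (IsUnshuffle b)

/-- The block `x_k, …, x_{k + m - 1}` of a finite sequence `x_0, …, x_{n - 1}`. -/
def block {W : Type*} {n : ℕ} (x : Fin n → W) (k m : ℕ) (h : k + m ≤ n) : Fin m → W :=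
  fun i => x ⟨k + i, by omega⟩

/-- The graded-skew Koszul sign `χ(σ)` of a permutation `σ` acting on homogeneous elements of
degrees `d`: the signature times the usual Koszul sign, so that
`x_{σ(1)} ∧ ⋯ ∧ x_{σ(n)} = χ(σ) x_1 ∧ ⋯ ∧ x_n` where `x ∧ y = -(-1)^{|x||y|} y ∧ x`. -/
def koszulSign {n : ℕ} (d : Fin n → ℤ) (σ : Equiv.Perm (Fin n)) : ℤˣ :=
  Equiv.Perm.sign σ *
    ∏ s : Fin n, ∏ t : Fin n,
      if s < t ∧ σ t < σ s then Int.negOnePow (d (σ s) * d (σ t)) else 1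

/-! ### L-infinity algebras and Maurer-Cartan elements -/

/-- An L-infinity algebra structure on a complex vector space `E` graded by the subspaces `𝒜 n`.
The operations `l k` are relevant for `k ≥ 1` only. -/
structure LInftyStructure {E : Type*} [AddCommGroup E] [Module ℂ E]
    (𝒜 : ℤ → Submodule ℂ E) where
  isInternal : DirectSum.IsInternal 𝒜
  l : (k : ℕ) → MultilinearMap ℂ (fun _ : Fin k => E) E
  /-- `l k` has degree `2 - k`. -/
  degree : ∀ k : ℕ, 1 ≤ k → ∀ (d : Fin k → ℤ) (x : Fin k → E), (∀ i, x i ∈ 𝒜 (d i)) →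
    l k x ∈ 𝒜 ((∑ i, d i) + (2 - (k : ℤ)))
  /-- `l k` is graded skew-symmetric. -/
  skew : ∀ k : ℕ, 1 ≤ k → ∀ (d : Fin k → ℤ) (x : Fin k → E), (∀ i, x i ∈ 𝒜 (d i)) →
    ∀ σ : Equiv.Perm (Fin k), l k (x ∘ σ) = koszulSign d σ • l k x
  /-- The higher Jacobi identities
  `∑_{i + j = n + 1} (-1)^i ∑_σ χ(σ) l_j (l_i (x_{σ(1)}, …, x_{σ(i)}), x_{σ(i+1)}, …, x_{σ(n)}) = 0`,
  the inner sum being over the `(i, n - i)`-unshuffles. -/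
  jacobi : ∀ n : ℕ, 1 ≤ n → ∀ (d : Fin n → ℤ) (x : Fin n → E), (∀ i, x i ∈ 𝒜 (d i)) →
    ∑ i : Fin (n + 1), (if (i : ℕ) = 0 then 0 else
      ((-1 : ℤ) ^ (i : ℕ)) • ∑ σ ∈ unshuffles [(i : ℕ), n - i] n, koszulSign d σ •
        l (n - i + 1) (Fin.cons (l i (block (x ∘ σ) 0 i (by omega)))
          (block (x ∘ σ) i (n - i) (by omega)))) = 0

/-- `α` is a Maurer-Cartan element: it has degree `1`, only finitely many of the terms
`l_k(α, …, α)` are nonzero, and `∑_{k ≥ 1} (1 / k!) l_k(α, …, α) = 0`. -/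
def LInftyStructure.IsMaurerCartan {E : Type*} [AddCommGroup E] [Module ℂ E]
    {𝒜 : ℤ → Submodule ℂ E} (A : LInftyStructure 𝒜) (α : E) : Prop :=
  α ∈ 𝒜 1 ∧ ∃ N : ℕ, (∀ k : ℕ, N < k → A.l k (fun _ => α) = 0) ∧
    ∑ k ∈ Finset.Icc 1 N, ((Nat.factorial k : ℂ)⁻¹) • A.l k (fun _ => α) = 0

/-! ### The Matsushima-Nijenhuis bracket -/

/-- An operation of arity `p + 1` on `W`, that is of degree `p`, with its last argument kept
apart.  The elements of `Hom (∧^p W ⊗ W, W)` are such operations. -/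
abbrev Operation (W : Type*) (p : ℕ) : Type _ := (Fin p → W) → W → W

/-- The first sum in `P ⋄ Q`, where `Q` is inserted in one of the skew arguments of `P`:
`∑_{σ ∈ S(q, 1, p-1)} sgn(σ) P(Q(x_{σ(1)}, …, x_{σ(q+1)}), x_{σ(q+2)}, …, x_{σ(p+q)}, y)`,
which is empty for `p = 0`. -/
def diamondSkew {W : Type*} [AddCommGroup W] : {p q : ℕ} → Operation W p → Operation W q →
    Operation W (p + q)
  | 0, _, _, _ => fun _ _ => 0
  | p + 1, q, P, Q => fun x y => ∑ σ ∈ unshuffles [q, 1, p] (p + 1 + q), Equiv.Perm.sign σ •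
      P (Fin.cons (Q (block (x ∘ σ) 0 q (by omega)) (x (σ ⟨q, by omega⟩)))
        (block (x ∘ σ) (q + 1) p (by omega))) y

/-- The second sum in `P ⋄ Q`, without the global sign, where `Q` is inserted in the last argument:
`∑_{σ ∈ S(p, q)} sgn(σ) P(x_{σ(1)}, …, x_{σ(p)}, Q(x_{σ(p+1)}, …, x_{σ(p+q)}, y))`. -/
def diamondLast {W : Type*} [AddCommGroup W] {p q : ℕ} (P : Operation W p) (Q : Operation W q) :
    Operation W (p + q) :=
  fun x y => ∑ σ ∈ unshuffles [p, q] (p + q), Equiv.Perm.sign σ •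
    P (block (x ∘ σ) 0 p (by omega)) (Q (block (x ∘ σ) p q (by omega)) y)

/-- The product `P ⋄ Q`. -/
def diamond {W : Type*} [AddCommGroup W] {p q : ℕ} (P : Operation W p) (Q : Operation W q) :
    Operation W (p + q) :=
  fun x y => diamondSkew P Q x y + ((-1 : ℤ) ^ (p * q)) • diamondLast P Q x y

/-- The Matsushima-Nijenhuis bracket `[P, Q] = P ⋄ Q - (-1)^{pq} Q ⋄ P`. -/
def mnBracket {W : Type*} [AddCommGroup W] {p q : ℕ} (P : Operation W p) (Q : Operation W q) :
    Operation W (p + q) :=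
  fun x y => diamond P Q x y
    - ((-1 : ℤ) ^ (p * q)) • diamond Q P (x ∘ Fin.cast (Nat.add_comm q p)) y

/-! ### Representations, 2-cocycles and relative cocycle weighted Reynolds operators -/

section PreLie

variable (g V : Type*) [LeftPreLieRing g] [LeftPreLieAlgebra ℂ g] [AddCommGroup V] [Module ℂ V]

/-- A representation `(V; L, R)` of a pre-Lie algebra `g`. -/
structure PreLieRep where
  L : g →ₗ[ℂ] Module.End ℂ V
  R : g →ₗ[ℂ] Module.End ℂ V
  left_left : ∀ (x y : g) (u : V), L x (L y u) - L (x * y) u = L y (L x u) - L (y * x) u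
  left_right : ∀ (x y : g) (u : V), L x (R y u) - R y (L x u) = R (x * y) u - R y (R x u)

variable {g V}

/-- `H : g ⊗ g → V` is a 2-cocycle of `g` with coefficients in the representation `ρ`. -/
def PreLieRep.IsTwoCocycle (ρ : PreLieRep g V) (H : g →ₗ[ℂ] g →ₗ[ℂ] V) : Prop :=
  ∀ x y z : g, ρ.L x (H y z) - ρ.L y (H x z) + ρ.R z (H y x) - ρ.R z (H x y)
    - H y (x * z) + H x (y * z) - H (x * y - y * x) z = 0

/-- `K` is a relative cocycle weighted Reynolds operator with weight `H`. -/
def PreLieRep.IsReynolds (ρ : PreLieRep g V) (H : g →ₗ[ℂ] g →ₗ[ℂ] V) (K : V →ₗ[ℂ] g) : Prop :=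
  ∀ u v : V, K u * K v = K (ρ.L (K u) v + ρ.R (K v) u + H (K u) (K v))

/-- The operation `μ + L + R` on `g ⊕ V`, with `μ` the product of `g`: the product
`((x, u), (y, v)) ↦ (x * y, L_x v + R_y u)`. -/
def PreLieRep.semidirect (ρ : PreLieRep g V) : Operation (g × V) 1 :=
  fun a b => ((a 0).1 * b.1, ρ.L (a 0).1 b.2 + ρ.R b.1 (a 0).2)

/-! ### The graded space of cochains -/

variable (g V) in
/-- `Hom (∧^m V ⊗ V, g)`, presented as the alternating `m`-linear maps with values in
`Hom (V, g)`. -/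
abbrev Cochain (m : ℕ) : Type _ := V [⋀^Fin m]→ₗ[ℂ] (V →ₗ[ℂ] g)

variable (g V) in
/-- The total space `⨁ₙ Hom (∧^{n-1} V ⊗ V, g)`; the summand `m` is the one with `n = m + 1`, the
space for `n = 0` being zero. -/
abbrev CochainSpace : Type _ := ⨁ m : ℕ, Cochain g V m

variable (g V) in
/-- The grading of the total space: `Hom (∧^{n-1} V ⊗ V, g)` has degree `n` for `n ≥ 1`, and the
part of degree `n ≤ 0` is zero. -/
def cochainGrading (n : ℤ) : Submodule ℂ (CochainSpace g V) where
  carrier := {x | ∀ m : ℕ, (m : ℤ) + 1 ≠ n → x m = 0}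
  zero_mem' := fun _ _ => rfl
  add_mem' := fun hx hy m hm => by rw [DirectSum.add_apply, hx m hm, hy m hm, add_zero]
  smul_mem' := fun c x hx m hm => by rw [DirectSum.smul_apply, hx m hm, smul_zero]

/-- A cochain as a homogeneous element of the total space. -/
noncomputable def Cochain.toSpace {m : ℕ} (P : Cochain g V m) : CochainSpace g V :=
  DirectSum.lof ℂ ℕ (Cochain g V) m P

/-- A linear map `V → g` as an element of degree `1` of the total space. -/
noncomputable def linearCochain (K : V →ₗ[ℂ] g) : CochainSpace g V :=
  Cochain.toSpace (AlternatingMap.constOfIsEmpty ℂ V (Fin 0) K)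

/-- A cochain `P : ∧^m V ⊗ V → g` as an operation on `g ⊕ V`, extended by zero. -/
def Cochain.lift {m : ℕ} (P : Cochain g V m) : Operation (g × V) m :=
  fun x y => (P (fun i => (x i).2) y.2, 0)

/-- The part of the ternary bracket in which `H(Q, R)` is inserted in a skew argument of `P`, for
`P, Q, R` of arities `p = a + 1`, `q = b + 1`, `r = c + 1`; it is empty for `p = 1`:
`∑_{σ ∈ S(q-1, 1, r-1, 1, p-2)} sgn(σ) P(H(Q(u_{σ(1)}, …, u_{σ(q-1)}, u_{σ(q)}),
R(u_{σ(q+1)}, …, u_{σ(q+r-1)}, u_{σ(q+r)})), u_{σ(q+r+1)}, …, u_{σ(p+q+r-2)}, v)`. -/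
def insertSkew (H : g →ₗ[ℂ] g →ₗ[ℂ] V) : {a b c : ℕ} →
    Cochain g V a → Cochain g V b → Cochain g V c → (Fin (a + b + c + 1) → V) → V → g
  | 0, _, _, _, _, _ => fun _ _ => 0
  | a + 1, b, c, P, Q, R => fun u v =>
      ∑ σ ∈ unshuffles [b, 1, c, 1, a] (a + 1 + b + c + 1), Equiv.Perm.sign σ •
        P (Fin.cons
          (H (Q (block (u ∘ σ) 0 b (by omega)) (u (σ ⟨b, by omega⟩)))
            (R (block (u ∘ σ) (b + 1) c (by omega)) (u (σ ⟨b + 1 + c, by omega⟩))))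
          (block (u ∘ σ) (b + 1 + c + 1) a (by omega))) v

/-- The part of the ternary bracket in which `H(Q, R)` is inserted in the last argument of `P`,
for `P, Q, R` of arities `p = a + 1`, `q = b + 1`, `r = c + 1`:
`∑_{σ ∈ S(p-1, q-1, 1, r-1)} sgn(σ) P(u_{σ(1)}, …, u_{σ(p-1)},
H(Q(u_{σ(p)}, …, u_{σ(p+q-2)}, u_{σ(p+q-1)}), R(u_{σ(p+q)}, …, u_{σ(p+q+r-2)}, v)))`. -/
def insertLast (H : g →ₗ[ℂ] g →ₗ[ℂ] V) {a b c : ℕ}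
    (P : Cochain g V a) (Q : Cochain g V b) (R : Cochain g V c)
    (u : Fin (a + b + c + 1) → V) (v : V) : g :=
  ∑ σ ∈ unshuffles [a, b, 1, c] (a + b + c + 1), Equiv.Perm.sign σ •
    P (block (u ∘ σ) 0 a (by omega))
      (H (Q (block (u ∘ σ) a b (by omega)) (u (σ ⟨a + b, by omega⟩)))
        (R (block (u ∘ σ) (a + b + 1) c (by omega)) v))

/-- The explicit ternary bracket of `P, Q, R`, of arities `p = a + 1`, `q = b + 1`, `r = c + 1`,
evaluated at `u_1, …, u_{p+q+r-2}, v`.  Exponents of `-1` are written without subtraction. -/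
def ternaryBracket (H : g →ₗ[ℂ] g →ₗ[ℂ] V) {a b c : ℕ}
    (P : Cochain g V a) (Q : Cochain g V b) (R : Cochain g V c)
    (u : Fin (a + b + c + 1) → V) (v : V) : g :=
  let p := a + 1
  let q := b + 1
  let r := c + 1
  ((-1 : ℤ) ^ (r * q + p + 1)) • insertSkew H P Q R u v
  + ((-1 : ℤ) ^ p) • insertSkew H P R Q (u ∘ Fin.cast (by omega)) v
  + ((-1 : ℤ) ^ ((r + 1) * (p + q + 1) + p * q + p + 1)) • insertLast H P Q R u v
  + ((-1 : ℤ) ^ (p * q + p * r + q + r + 1)) • insertLast H P R Q (u ∘ Fin.cast (by omega)) v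
  + ((-1 : ℤ) ^ (p * q + q + 1)) • insertSkew H Q R P (u ∘ Fin.cast (by omega)) v
  + ((-1 : ℤ) ^ (r * p + p * q + q)) • insertSkew H Q P R (u ∘ Fin.cast (by omega)) v
  + ((-1 : ℤ) ^ (q * r + p + r)) • insertLast H Q R P (u ∘ Fin.cast (by omega)) v
  + ((-1 : ℤ) ^ ((r + 1) * (p + q + 1) + q)) • insertLast H Q P R (u ∘ Fin.cast (by omega)) v
  + ((-1 : ℤ) ^ ((r + 1) * (p + q + 1) + p + q + 1)) •
      insertSkew H R Q P (u ∘ Fin.cast (by omega)) v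
  + ((-1 : ℤ) ^ (p * (q + 1) + (r + 1) * (p + q + 1) + q)) •
      insertSkew H R P Q (u ∘ Fin.cast (by omega)) v
  + ((-1 : ℤ) ^ (p + q + 1)) • insertLast H R Q P (u ∘ Fin.cast (by omega)) v
  + ((-1 : ℤ) ^ (p * q + p + q)) • insertLast H R P Q (u ∘ Fin.cast (by omega)) v

end PreLie

/-!
The operations on `g ⊕ V` form a graded Lie algebra under the Matsushima-Nijenhuis bracket, and the
cochains, extended by zero, form an abelian subalgebra of it. The axioms of a pre-Lie algebra, of a
representation and of a 2-cocycle say together that `μ + L + R + H` is a Maurer-Cartan element of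
that graded Lie algebra. A weight count shows that an iterated bracket of `k` cochains with
`μ + L + R` is a cochain for `k = 2` and vanishes for `k > 2`, and that one with `H` is a cochain
for `k = 3` and vanishes for `k > 3`. The higher derived brackets of Voronov, in which each of the
two elements is bracketed with the number of cochains for which it yields a cochain, are therefore
an L-infinity structure on the cochains. The formula for the ternary bracket comes out of expanding
the iterated bracket with `H`, since a product `P ⋄ Q` of two cochains vanishes.
-/

/-! ### Signed sums over the splittings of a list -/

section Split

variable {α M N : Type*} [AddCommGroup M] [AddCommGroup N] (c : α → α → ℤˣ)

/-- The sign for moving `x` from the front of a list past the entries of `A`, where exchanging two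
neighbours `x, y` costs the sign `c x y`. -/
def passSign (x : α) (A : List α) : ℤˣ := (A.map (c x)).prod

/-- The sign for moving the entries of `A` past those of `B`. -/
def crossSign (A B : List α) : ℤˣ := (A.map fun x => passSign c x B).prod

/-- The sum of `± Φ A B` over all the ways to split a list into two subsequences `A` and `B`, with
the sign of the reordering `A ++ B` for the commutation factor `c`. -/
def split : (List α → List α → M) → List α → M
  | Φ, [] => Φ [] []
  | Φ, x :: l =>
      split (fun A B => Φ (x :: A) B) l + split (fun A B => passSign c x A • Φ A (x :: B)) l

theorem split_congr {l : List α} {Φ Ψ : List α → List α → M}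
    (h : ∀ A B, (A ++ B).Perm l → Φ A B = Ψ A B) : split c Φ l = split c Ψ l := by
  induction l generalizing Φ Ψ with
  | nil => exact h _ _ .nil
  | cons x l ih =>
    exact congrArg₂ (· + ·) (ih fun A B hl => h _ _ (hl.cons x))
      (ih fun A B hl => congrArg _ (h _ _ (List.perm_middle.trans (hl.cons x))))

theorem map_split {F : Type*} [FunLike F M N] [AddMonoidHomClass F M N] (f : F)
    (Φ : List α → List α → M) (l : List α) :
    f (split c Φ l) = split c (fun A B => f (Φ A B)) l := by
  induction l generalizing Φ with
  | nil => rfl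
  | cons x l ih => simp only [split, map_add, ih, Units.smul_def, map_zsmul]

theorem split_mem {S : Type*} [SetLike S M] [AddSubgroupClass S M] {N : S} {l : List α}
    {Φ : List α → List α → M} (h : ∀ A B, (A ++ B).Perm l → Φ A B ∈ N) : split c Φ l ∈ N := by
  induction l generalizing Φ with
  | nil => exact h _ _ .nil
  | cons x l ih =>
    refine add_mem (ih fun A B hl => h _ _ (hl.cons x)) (ih fun A B hl => ?_)
    rw [Units.smul_def]
    exact zsmul_mem (h _ _ (List.perm_middle.trans (hl.cons x))) _

theorem split_map {β : Type*} (f : β → α) (Φ : List α → List α → M) (l : List β) :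
    split c Φ (l.map f) =
      split (fun x y => c (f x) (f y)) (fun A B => Φ (A.map f) (B.map f)) l := by
  induction l generalizing Φ with
  | nil => rfl
  | cons x l ih => simp only [List.map_cons, split, ih, passSign, List.map_map, Function.comp_def]

theorem split_zero (l : List α) : split c (fun _ _ => (0 : M)) l = 0 :=
  (map_split c (0 : M →+ M) (fun _ _ => 0) l).symm

theorem split_eq_zero {l : List α} {Φ : List α → List α → M}
    (h : ∀ A B, (A ++ B).Perm l → Φ A B = 0) : split c Φ l = 0 := by
  rw [split_congr c h, split_zero]

theorem split_eq_apply_nil {Φ : List α → List α → M} (h : ∀ A B, B ≠ [] → Φ A B = 0)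
    (l : List α) : split c Φ l = Φ l [] := by
  induction l generalizing Φ with
  | nil => rfl
  | cons x l ih =>
    rw [split, ih fun A B hB => h (x :: A) B hB, split_eq_zero c fun A B _ => by
      rw [h A (x :: B) (List.cons_ne_nil x B), smul_zero], add_zero]

theorem split_add (Φ Ψ : List α → List α → M) (l : List α) :
    split c (fun A B => Φ A B + Ψ A B) l = split c Φ l + split c Ψ l := by
  induction l generalizing Φ Ψ with
  | nil => rfl
  | cons x l ih => simp only [split, smul_add, ih]; abel

theorem split_smul {G : Type*} [Monoid G] [DistribMulAction G M] (k : G)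
    (Φ : List α → List α → M) (l : List α) :
    split c (fun A B => k • Φ A B) l = k • split c Φ l :=
  (map_split c (DistribSMul.toAddMonoidHom M k) Φ l).symm

theorem split_neg (Φ : List α → List α → M) (l : List α) :
    split c (fun A B => -Φ A B) l = -split c Φ l :=
  (map_split c (negAddMonoidHom (α := M)) Φ l).symm

theorem split_sum {κ : Type*} (t : Finset κ) (Φ : κ → List α → List α → M) (l : List α) :
    split c (fun A B => ∑ i ∈ t, Φ i A B) l = ∑ i ∈ t, split c (Φ i) l := by
  induction l generalizing Φ with
  | nil => rfl
  | cons x l ih => simp only [split, Finset.smul_sum, ih, Finset.sum_add_distrib]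

theorem passSign_append (x : α) (A B : List α) :
    passSign c x (A ++ B) = passSign c x A * passSign c x B := by
  simp [passSign]

theorem passSign_perm (x : α) {A B : List α} (h : A.Perm B) : passSign c x A = passSign c x B :=
  (h.map _).prod_eq

theorem split_assoc (Φ : List α → List α → List α → M) (l : List α) :
    split c (fun A B => split c (fun C D => Φ A C D) B) l =
      split c (fun A B => split c (fun C D => Φ C D B) A) l := by
  induction l generalizing Φ with
  | nil => rfl
  | cons x l ih =>
    simp only [split, smul_add, split_add, ← split_smul]
    rw [ih, ih (fun A C D => passSign c x A • Φ A (x :: C) D),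
      ih (fun A C D => passSign c x A • passSign c x C • Φ A C (x :: D)), add_assoc]
    congr 2
    refine split_congr c fun A B _ => split_congr c fun C D h => ?_
    rw [← passSign_perm c x h, passSign_append, mul_smul]

theorem crossSign_cons_right (A B : List α) (x : α) :
    crossSign c A (x :: B) = (A.map fun a => c a x).prod * crossSign c A B := by
  simp [crossSign, passSign, List.prod_map_mul]

theorem split_comm (hc : ∀ x y, c x y * c y x = 1) (Φ : List α → List α → M) (l : List α) :
    split c Φ l = split c (fun A B => crossSign c A B • Φ B A) l := by
  have pass_mul (x : α) (A : List α) : passSign c x A * (A.map fun a => c a x).prod = 1 := by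
    rw [passSign, ← List.prod_map_mul]
    simp [hc]
  induction l generalizing Φ with
  | nil => simp [split, crossSign]
  | cons x l ih =>
    rw [split, split, ih, add_comm, ih]
    congr 1 <;> refine split_congr c fun A B _ => ?_
    · rw [smul_smul, mul_comm]
      rfl
    · rw [crossSign_cons_right, smul_smul, ← mul_assoc, pass_mul, one_mul]

end Split

/-! ### Skew-symmetric multilinear functions of a list -/

section SkewSign

variable {α M : Type*} [AddCommGroup M]

/-- The commutation factor `-1` of entries that anticommute. -/
def skewSign : α → α → ℤˣ := fun _ _ => -1

theorem passSign_skewSign (x : α) (A : List α) :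
    passSign skewSign x A = (A.length : ℤ).negOnePow := by
  change (A.map fun _ => (-1 : ℤˣ)).prod = _
  simp [Int.negOnePow_def]

theorem crossSign_skewSign (A B : List α) :
    crossSign skewSign A B = (A.length * B.length : ℤ).negOnePow := by
  simp [crossSign, passSign_skewSign, Int.negOnePow_def, ← zpow_natCast, ← zpow_mul,
    mul_comm]

theorem skewSign_mul_skewSign (x y : α) : skewSign x y * skewSign y x = 1 := by
  simp [skewSign]

theorem split_skewSign_cons (Φ : List α → List α → M) (x : α) (l : List α) :
    split skewSign Φ (x :: l) = split skewSign (fun A B => Φ (x :: A) B) l +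
      split skewSign (fun A B => (A.length : ℤ).negOnePow • Φ A (x :: B)) l := by
  simp only [split, passSign_skewSign]

end SkewSign

section SkewMultilinear

variable {R W M N : Type*} [CommRing R] [AddCommGroup W] [Module R W] [AddCommGroup M] [Module R M]
  [AddCommGroup N] [Module R N]

variable (R) in
/-- The restrictions of `f` to the lists of each length are multilinear and change their sign when
two neighbouring entries are exchanged. -/
structure IsSkewMultilinear (f : List W → M) : Prop where
  swap : ∀ l x y l', f (l ++ x :: y :: l') = -f (l ++ y :: x :: l')
  linear : ∀ l, IsLinearMap R fun x => f (x :: l)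

namespace IsSkewMultilinear

variable {f f' : List W → M}

theorem swap_head (hf : IsSkewMultilinear R f) (x y : W) (l : List W) :
    f (x :: y :: l) = -f (y :: x :: l) :=
  hf.swap [] x y l

theorem cons (hf : IsSkewMultilinear R f) (x : W) : IsSkewMultilinear R fun l => f (x :: l) where
  swap l := hf.swap (x :: l)
  linear l :=
    { map_add y z := by
        simp only [hf.swap_head x, (hf.linear _).map_add, neg_add]
      map_smul k y := by
        simp only [hf.swap_head x, (hf.linear _).map_smul, smul_neg] }

theorem linear_append (hf : IsSkewMultilinear R f) (l l' : List W) :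
    IsLinearMap R fun x => f (l ++ x :: l') := by
  induction l generalizing f with
  | nil => exact hf.linear l'
  | cons y _ ih => exact ih (hf.cons y)

theorem cons_zero (hf : IsSkewMultilinear R f) (l : List W) : f (0 :: l) = 0 :=
  (hf.linear l).map_zero

theorem map (hf : IsSkewMultilinear R f) (φ : M →ₗ[R] N) :
    IsSkewMultilinear R fun l => φ (f l) where
  swap l x y l' := by rw [hf.swap, map_neg]
  linear l := (φ ∘ₗ (hf.linear l).mk').isLinear

theorem zero : IsSkewMultilinear R (0 : List W → M) :=
  ⟨by simp, fun _ => (0 : W →ₗ[R] M).isLinear⟩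

theorem add (hf : IsSkewMultilinear R f) (hf' : IsSkewMultilinear R f') :
    IsSkewMultilinear R (f + f') where
  swap l x y l' := by simp only [Pi.add_apply, hf.swap l x, hf'.swap l x, neg_add]
  linear l := ((hf.linear l).mk' + (hf'.linear l).mk').isLinear

theorem smul (hf : IsSkewMultilinear R f) (k : R) : IsSkewMultilinear R (k • f) :=
  hf.map (LinearMap.lsmul R M k)

theorem units_smul (hf : IsSkewMultilinear R f) (ε : List W → ℤˣ)
    (hε : ∀ l l', l.length = l'.length → ε l = ε l') : IsSkewMultilinear R fun l => ε l • f l where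
  swap l x y l' := by
    rw [hf.swap, smul_neg, hε (l ++ x :: y :: l') (l ++ y :: x :: l') (by simp)]
  linear l :=
    { map_add x y := by
        rw [(hf.linear l).map_add, smul_add, hε (x :: l) ((x + y) :: l) rfl,
          hε (y :: l) ((x + y) :: l) rfl]
      map_smul k x := by
        rw [(hf.linear l).map_smul, smul_comm, hε (k • x :: l) (x :: l) rfl] }

theorem split {Φ : List W → List W → M} (hl : ∀ B, IsSkewMultilinear R fun A => Φ A B)
    (hr : ∀ A, IsSkewMultilinear R fun B => Φ A B) :
    IsSkewMultilinear R (split skewSign Φ) where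
  swap l x y l' := by
    induction l generalizing Φ with
    | nil =>
      simp only [List.nil_append, split_skewSign_cons, ← split_add, ← split_neg]
      refine split_congr _ fun A B _ => ?_
      rw [(hl B).swap_head, (hr A).swap_head]
      simp only [List.length_cons, Nat.cast_add, Nat.cast_one, Int.negOnePow_succ, smul_neg,
        Units.smul_def, Units.val_neg, neg_smul]
      abel
    | cons z l ih =>
      simp only [List.cons_append, split_skewSign_cons]
      rw [ih (fun B => (hl B).cons z) (fun A => hr (z :: A)), neg_add,
        ih (Φ := fun A B => (A.length : ℤ).negOnePow • Φ A (z :: B))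
          (fun B => (hl _).units_smul _ fun _ _ h => by rw [h])
          (fun A => ((hr A).cons z).units_smul _ fun _ _ _ => rfl)]
  linear l :=
    { map_add x y := by
        simp only [split_skewSign_cons, ← split_add]
        refine split_congr _ fun A B _ => ?_
        rw [((hl B).linear A).map_add, ((hr A).linear B).map_add, smul_add]
        abel
      map_smul k x := by
        simp only [split_skewSign_cons, ((hl _).linear _).map_smul, ((hr _).linear _).map_smul,
          smul_comm _ k, split_smul, smul_add] }

end IsSkewMultilinear

/-- The entry of a list with one element, extended by zero to the other lists. -/
def listOne : List W → W
  | [x] => x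
  | _ => 0

theorem isSkewMultilinear_listOne : IsSkewMultilinear R (listOne : List W → W) where
  swap l x y l' := by
    have (x y : W) : listOne (l ++ x :: y :: l') = 0 := by
      rcases l with _ | ⟨a, _ | ⟨b, l⟩⟩ <;> rfl
    simp [this]
  linear
    | [] => LinearMap.id.isLinear
    | _ :: _ => (0 : W →ₗ[R] W).isLinear

theorem listOne_of_length_ne_one {l : List W} (h : l.length ≠ 1) : listOne l = 0 := by
  rcases l with _ | ⟨x, _ | ⟨y, l⟩⟩
  · rfl
  · exact absurd rfl h
  · rfl

theorem split_listOne_cons (φ : List W → W →ₗ[R] M) (z : W) (l : List W) :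
    split skewSign (fun A B => φ A (listOne (z :: B))) l = φ l z := by
  induction l generalizing φ with
  | nil => rfl
  | cons x l ih =>
    rw [split_skewSign_cons, ih fun A => φ (x :: A)]
    simp [listOne, split_zero]

end SkewMultilinear

/-! ### The Matsushima-Nijenhuis graded Lie algebra -/

section AltOp

variable (R W : Type*) [CommRing R] [AddCommGroup W] [Module R W]

/-- The space `⨁ₚ Hom (∧^p W ⊗ W, W)`. An element is encoded as a single function of the list of the
skew arguments, with values in `End W` to account for the last argument; only finitely many lengths
of the list contribute. -/
def altOps : Submodule R (List W → Module.End R W) where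
  carrier := {f | IsSkewMultilinear R f ∧ ∃ n, ∀ l, n ≤ l.length → f l = 0}
  zero_mem' := ⟨.zero, 0, fun _ _ => rfl⟩
  add_mem' := by
    rintro f f' ⟨hf, m, hm⟩ ⟨hf', n, hn⟩
    exact ⟨hf.add hf', max m n, fun l h => by
      rw [Pi.add_apply, hm l (le_of_max_le_left h), hn l (le_of_max_le_right h), add_zero]⟩
  smul_mem' := by
    rintro k f ⟨hf, n, hn⟩
    exact ⟨hf.smul k, n, fun l h => by rw [Pi.smul_apply, hn l h, smul_zero]⟩

/-- The operations in `⨁ₚ Hom (∧^p W ⊗ W, W)`; see `altOps` for the encoding. -/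
abbrev AltOp : Type _ := altOps R W

variable {R W}

namespace AltOp

instance : CoeFun (AltOp R W) fun _ => List W → Module.End R W := ⟨Subtype.val⟩

theorem isSkewMultilinear (P : AltOp R W) : IsSkewMultilinear R P := P.2.1

theorem linear_head (P : AltOp R W) (l : List W) : IsLinearMap R fun x => P (x :: l) :=
  P.isSkewMultilinear.linear l

theorem ext {P Q : AltOp R W} (h : ∀ l, P l = Q l) : P = Q := Subtype.ext (funext h)

theorem add_apply (P Q : AltOp R W) (l : List W) : (P + Q) l = P l + Q l := rfl

theorem sub_apply (P Q : AltOp R W) (l : List W) : (P - Q) l = P l - Q l := rfl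

theorem smul_apply (k : R) (P : AltOp R W) (l : List W) : (k • P) l = k • P l := rfl

theorem units_smul_apply (ε : ℤˣ) (P : AltOp R W) (l : List W) : (ε • P) l = ε • P l := rfl

/-- The alternating sum of `Q` over the choices of the last argument, so that all the arguments of
`Q` enter in a skew way. -/
def totalSkew (Q : AltOp R W) : List W → W := split skewSign fun A B => Q A (listOne B)

theorem isSkewMultilinear_totalSkew (Q : AltOp R W) : IsSkewMultilinear R Q.totalSkew :=
  .split (fun B => Q.isSkewMultilinear.map (LinearMap.applyₗ (listOne B)))
    fun A => isSkewMultilinear_listOne.map (Q A)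

theorem totalSkew_eq_zero {Q : AltOp R W} {l : List W}
    (h : ∀ A, A.length + 1 = l.length → Q A = 0) : Q.totalSkew l = 0 := by
  refine split_eq_zero _ fun A B hl => ?_
  by_cases hB : B.length = 1
  · rw [h A (by simp [← hl.length_eq, hB]), LinearMap.zero_apply]
  · rw [listOne_of_length_ne_one hB, map_zero]

theorem totalSkew_add (P Q : AltOp R W) (l : List W) :
    (P + Q).totalSkew l = P.totalSkew l + Q.totalSkew l :=
  split_add _ _ _ l

theorem totalSkew_smul (k : R) (Q : AltOp R W) (l : List W) :
    (k • Q).totalSkew l = k • Q.totalSkew l :=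
  split_smul _ k _ l

theorem totalSkew_cons (Q : AltOp R W) (z : W) (l : List W) :
    Q.totalSkew (z :: l) = split skewSign (fun A B => Q (z :: A) (listOne B)) l +
      (l.length : ℤ).negOnePow • Q l z := by
  rw [totalSkew, split_skewSign_cons]
  congr 1
  exact split_listOne_cons (fun A => (A.length : ℤ).negOnePow • Q A) z l

/-- The values of the product `P ⋄ Q`. -/
def circFun (P Q : AltOp R W) : List W → Module.End R W :=
  split skewSign fun A B => P (Q.totalSkew A :: B) + P B * Q A

theorem circFun_eq_zero {P Q : AltOp R W} {l : List W}
    (h : ∀ m n, m + n = l.length →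
      (∀ A, A.length = m → P A = 0) ∨ ∀ A, A.length = n → Q A = 0) :
    circFun P Q l = 0 := by
  refine split_eq_zero _ fun A B hl => ?_
  have hlen : A.length + B.length = l.length := by rw [← hl.length_eq, List.length_append]
  have outer : P (Q.totalSkew A :: B) = 0 := by
    have hQ (hA : ∀ C, C.length + 1 = A.length → Q C = 0) : P (Q.totalSkew A :: B) = 0 := by
      rw [totalSkew_eq_zero hA, P.isSkewMultilinear.cons_zero]
    by_cases hA : A.length = 0
    · exact hQ fun C hC => by omega
    · obtain h | h := h (B.length + 1) (A.length - 1) (by omega)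
      · exact h _ rfl
      · exact hQ fun C hC => h C (by omega)
  have inner : P B * Q A = 0 := by
    obtain h | h := h B.length A.length (by omega)
    · rw [h B rfl, zero_mul]
    · rw [h A rfl, mul_zero]
  rw [outer, inner, add_zero]

theorem circFun_mem (P Q : AltOp R W) : circFun P Q ∈ altOps R W := by
  refine ⟨.split (fun B => ?_) fun A => ?_, ?_⟩
  · exact (Q.isSkewMultilinear_totalSkew.map (P.linear_head B).mk').add
      (Q.isSkewMultilinear.map (LinearMap.mulLeft R (P B)))
  · exact (P.isSkewMultilinear.cons _).add
      (P.isSkewMultilinear.map (LinearMap.mulRight R (Q A)))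
  · obtain ⟨m, hm⟩ := P.2.2
    obtain ⟨n, hn⟩ := Q.2.2
    refine ⟨m + n, fun l hl => circFun_eq_zero fun i j hij => ?_⟩
    by_cases hi : m ≤ i
    · exact .inl fun A hA => hm A (by omega)
    · exact .inr fun A hA => hn A (by omega)

variable (R W) in
/-- The product `P ⋄ Q`: the sum of all the ways of inserting `Q` in an argument of `P`. -/
def circ : AltOp R W →ₗ[R] AltOp R W →ₗ[R] AltOp R W :=
  LinearMap.mk₂ R (fun P Q => ⟨circFun P Q, circFun_mem P Q⟩)
    (fun P P' Q => ext fun l => by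
      simp only [add_apply, circFun, ← split_add]
      exact split_congr _ fun A B _ => by rw [add_mul]; abel)
    (fun k P Q => ext fun l => by
      simp only [smul_apply, circFun, ← split_smul]
      exact split_congr _ fun A B _ => by rw [smul_mul_assoc, smul_add])
    (fun P Q Q' => ext fun l => by
      simp only [add_apply, circFun, ← split_add]
      exact split_congr _ fun A B _ => by
        rw [totalSkew_add, (P.linear_head B).map_add, mul_add]
        abel)
    (fun k P Q => ext fun l => by
      simp only [smul_apply, circFun, ← split_smul]
      exact split_congr _ fun A B _ => by
        rw [totalSkew_smul, (P.linear_head B).map_smul, mul_smul_comm, smul_add])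

local notation:72 P:72 " ⋄ " Q:73 => circ _ _ P Q

theorem circ_apply (P Q : AltOp R W) (l : List W) :
    (P ⋄ Q) l = split skewSign (fun A B => P (Q.totalSkew A :: B) + P B * Q A) l :=
  rfl

theorem totalSkew_circ (P Q : AltOp R W) (l : List W) :
    (P ⋄ Q).totalSkew l = split skewSign (fun A B => P.totalSkew (Q.totalSkew A :: B)) l := by
  have apply_listOne (E D : List W) : (P ⋄ Q) E (listOne D) =
      split skewSign (fun A B => P (Q.totalSkew A :: B) (listOne D)) E +
        split skewSign (fun A B => P B (Q A (listOne D))) E := by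
    rw [← split_add]
    exact map_split _ (LinearMap.applyₗ (R := R) (listOne D)) _ E
  have apply_totalSkew (A B : List W) : (B.length : ℤ).negOnePow • P B (Q.totalSkew A) =
      split skewSign (fun C D => (B.length : ℤ).negOnePow • P B (Q C (listOne D))) A := by
    rw [totalSkew, map_split, split_smul]
  rw [totalSkew]
  simp only [apply_listOne, totalSkew_cons, split_add, ← split_assoc, apply_totalSkew]
  congr 1
  refine split_congr _ fun A E _ => ?_
  rw [split_comm _ skewSign_mul_skewSign]
  refine split_congr _ fun D B _ => ?_
  rcases D with _ | ⟨d, _ | ⟨e, D⟩⟩ <;> simp [listOne, crossSign_skewSign]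

/-- The part of `(P ⋄ Q) ⋄ S` in which `Q` and `S` are inserted in different arguments of `P`. -/
def circTwo (P Q S : AltOp R W) (l : List W) : Module.End R W :=
  split skewSign (fun A B => split skewSign (fun C D => (C.length : ℤ).negOnePow •
      (P (S.totalSkew A :: D) * Q C - P (S.totalSkew A :: Q.totalSkew C :: D)) +
    P (Q.totalSkew C :: D) * S A) B) l

theorem circ_circ_apply (P Q S : AltOp R W) (l : List W) :
    (P ⋄ Q ⋄ S) l = (P ⋄ (Q ⋄ S)) l + circTwo P Q S l := by
  have circ_cons (z : W) (B : List W) : (P ⋄ Q) (z :: B) =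
      split skewSign (fun C D => P (Q.totalSkew (z :: C) :: D) + P D * Q (z :: C) +
        (C.length : ℤ).negOnePow • (P (z :: D) * Q C - P (z :: Q.totalSkew C :: D))) B := by
    rw [circ_apply, split_skewSign_cons, ← split_add]
    refine split_congr _ fun C D _ => ?_
    rw [P.isSkewMultilinear.swap_head (Q.totalSkew C), neg_add_eq_sub]
  have circ_mul (A B : List W) : (P ⋄ Q) B * S A =
      split skewSign (fun C D => P (Q.totalSkew C :: D) * S A + P D * Q C * S A) B := by
    simp only [circ_apply, ← add_mul]
    exact map_split _ (LinearMap.mulRight R (S A)) _ B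
  have insert_circ (E D : List W) : P ((Q ⋄ S).totalSkew E :: D) + P D * (Q ⋄ S) E =
      split skewSign (fun A C => P (Q.totalSkew (S.totalSkew A :: C) :: D) +
        P D * (Q (S.totalSkew A :: C) + Q C * S A)) E := by
    rw [totalSkew_circ, split_add]
    exact congrArg₂ (· + ·) (map_split _ (P.linear_head D).mk' _ E)
      (map_split _ (LinearMap.mulLeft R (P D)) _ E)
  rw [circ_apply, circ_apply P, circTwo]
  simp only [circ_cons, circ_mul, insert_circ]
  rw [← split_assoc, ← split_add]
  refine split_congr _ fun A B _ => ?_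
  rw [← split_add, ← split_add]
  refine split_congr _ fun C D _ => ?_
  rw [mul_add, mul_assoc]
  abel

variable (R W) in
/-- The operations of degree `p`, that is the elements of `Hom (∧^p W ⊗ W, W)`. -/
def homogeneous (p : ℤ) : Submodule R (AltOp R W) where
  carrier := {P | ∀ l : List W, (l.length : ℤ) ≠ p → P l = 0}
  zero_mem' _ _ := rfl
  add_mem' hP hQ l hl := by rw [add_apply, hP l hl, hQ l hl, add_zero]
  smul_mem' k P hP l hl := by rw [smul_apply, hP l hl, smul_zero]

variable {p q r : ℤ} {P Q S : AltOp R W}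

theorem eq_zero_or_length_eq (hP : P ∈ homogeneous R W p) (l : List W) :
    P l = 0 ∨ (l.length : ℤ) = p := by
  by_cases h : (l.length : ℤ) = p
  · exact .inr h
  · exact .inl (hP l h)

theorem totalSkew_eq_zero_or_length_eq (hP : P ∈ homogeneous R W p) (l : List W) :
    P.totalSkew l = 0 ∨ (l.length : ℤ) = p + 1 := by
  by_cases h : (l.length : ℤ) = p + 1
  · exact .inr h
  · exact .inl (totalSkew_eq_zero fun A hA => hP A (by omega))

theorem circ_mem (hP : P ∈ homogeneous R W p) (hQ : Q ∈ homogeneous R W q) :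
    P ⋄ Q ∈ homogeneous R W (p + q) := fun l hl =>
  circFun_eq_zero fun m n hmn => by
    by_cases hm : (m : ℤ) = p
    · exact .inr fun A hA => hQ A (by omega)
    · exact .inl fun A hA => hP A (by omega)

theorem circTwo_comm (hQ : Q ∈ homogeneous R W q) (hS : S ∈ homogeneous R W r) (l : List W) :
    circTwo P S Q l = (q * r).negOnePow • circTwo P Q S l := by
  have cons_zero := P.isSkewMultilinear.cons_zero
  rw [circTwo, split_assoc, circTwo, split_assoc, ← split_smul]
  refine split_congr _ fun E D _ => ?_
  rw [split_comm _ skewSign_mul_skewSign, ← split_smul]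
  refine split_congr _ fun A C _ => ?_
  have left : (A.length * C.length + A.length : ℤ).negOnePow • (P (Q.totalSkew C :: D) * S A) =
      (q * r).negOnePow • (P (Q.totalSkew C :: D) * S A) := by
    obtain hA | hA := eq_zero_or_length_eq hS A
    · simp [hA]
    obtain hC | hC := totalSkew_eq_zero_or_length_eq hQ C
    · simp [hC, cons_zero]
    rw [hA, hC, show r * (q + 1) + r = q * r + (r + r) by ring, Int.negOnePow_add _ (r + r),
      Int.negOnePow_even _ ⟨r, rfl⟩, mul_one]
  have right : (A.length * C.length : ℤ).negOnePow • (P (S.totalSkew A :: D) * Q C) =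
      (q * r + C.length : ℤ).negOnePow • (P (S.totalSkew A :: D) * Q C) := by
    obtain hA | hA := totalSkew_eq_zero_or_length_eq hS A
    · simp [hA, cons_zero]
    obtain hC | hC := eq_zero_or_length_eq hQ C
    · simp [hC]
    rw [hA, hC, show (r + 1) * q = q * r + q by ring]
  have both : (A.length * C.length + A.length : ℤ).negOnePow •
        P (Q.totalSkew C :: S.totalSkew A :: D) =
      (q * r + C.length : ℤ).negOnePow • P (S.totalSkew A :: Q.totalSkew C :: D) := by
    rw [P.isSkewMultilinear.swap_head]
    obtain hA | hA := totalSkew_eq_zero_or_length_eq hS A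
    · simp [hA, cons_zero]
    obtain hC | hC := totalSkew_eq_zero_or_length_eq hQ C
    · simp [hC, (P.isSkewMultilinear.cons _).cons_zero]
    rw [hA, hC, show (r + 1) * (q + 1) + (r + 1) = q * r + (q + 1) + (r + r) + 1 by ring,
      Int.negOnePow_succ, Int.negOnePow_add _ (r + r), Int.negOnePow_even _ ⟨r, rfl⟩, mul_one,
      Units.neg_smul, smul_neg, neg_neg]
  simp only [crossSign_skewSign, smul_add, smul_sub, smul_smul, ← Int.negOnePow_add, left, right,
    both]
  abel

theorem circ_circ_sub_comm (hQ : Q ∈ homogeneous R W q) (hS : S ∈ homogeneous R W r) :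
    P ⋄ S ⋄ Q - P ⋄ (S ⋄ Q) = (q * r).negOnePow • (P ⋄ Q ⋄ S - P ⋄ (Q ⋄ S)) := by
  refine ext fun l => ?_
  simp only [sub_apply, units_smul_apply, circ_circ_apply, add_sub_cancel_left, circTwo_comm hQ hS]

variable (R W) in
/-- The projection to the part of odd degree. -/
def oddPart : AltOp R W →ₗ[R] AltOp R W where
  toFun P := ⟨fun l => if Odd l.length then P l else 0,
    { swap l x y l' := by
        have length_eq : (l ++ x :: y :: l').length = (l ++ y :: x :: l').length := by simp
        rw [P.isSkewMultilinear.swap, length_eq]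
        split_ifs <;> simp
      linear l := by
        by_cases h : Odd (l.length + 1)
        · simpa only [List.length_cons, h, if_true] using P.linear_head l
        · simp only [List.length_cons, h, if_false]
          exact ⟨by simp, by simp⟩ },
    P.2.2.imp fun n hn l hl => by simp only [hn l hl, ite_self]⟩
  map_add' P Q := ext fun l => by
    simp only [add_apply]
    split_ifs <;> simp
  map_smul' k P := ext fun l => by
    simp only [smul_apply, RingHom.id_apply]
    split_ifs <;> simp

theorem oddPart_eq_ite (hP : P ∈ homogeneous R W p) : oddPart R W P = if Odd p then P else 0 := by
  refine ext fun l => ?_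
  change (if Odd l.length then P l else 0) = _
  obtain h | rfl := eq_zero_or_length_eq hP l
  · rw [h, ite_self]
    split_ifs <;> simp [h]
  · simp only [Int.odd_coe_nat]
    split_ifs <;> rfl

set_option maxSynthPendingDepth 3 in
variable (R W) in
/-- The Matsushima-Nijenhuis bracket `[P, Q] = P ⋄ Q - (-1)^{pq} Q ⋄ P`, extended to all operations
by bilinearity; see `bracket_eq`. -/
def bracket : AltOp R W →ₗ[R] AltOp R W →ₗ[R] AltOp R W :=
  circ R W - (circ R W).flip + (2 : R) • (circ R W).flip.compl₁₂ (oddPart R W) (oddPart R W)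

theorem bracket_eq (hP : P ∈ homogeneous R W p) (hQ : Q ∈ homogeneous R W q) :
    bracket R W P Q = P ⋄ Q - (p * q).negOnePow • (Q ⋄ P) := by
  change P ⋄ Q - Q ⋄ P + (2 : R) • (oddPart R W Q ⋄ oddPart R W P) = _
  rw [oddPart_eq_ite hP, oddPart_eq_ite hQ]
  by_cases h : Odd p ∧ Odd q
  · rw [if_pos h.1, if_pos h.2, Int.negOnePow_odd _ (Int.odd_mul.2 h), Units.neg_smul, one_smul]
    module
  · rw [Int.negOnePow_even _ (by rwa [← Int.not_odd_iff_even, Int.odd_mul])]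
    obtain h | h := not_and_or.1 h <;> simp [h]

theorem bracket_mem (hP : P ∈ homogeneous R W p) (hQ : Q ∈ homogeneous R W q) :
    bracket R W P Q ∈ homogeneous R W (p + q) := by
  rw [bracket_eq hP hQ]
  exact sub_mem (circ_mem hP hQ) (zsmul_mem (add_comm q p ▸ circ_mem hQ hP) _)

theorem bracket_comm (hP : P ∈ homogeneous R W p) (hQ : Q ∈ homogeneous R W q) :
    bracket R W P Q = -((p * q).negOnePow • bracket R W Q P) := by
  rw [bracket_eq hP hQ, bracket_eq hQ hP, smul_sub, smul_smul, mul_comm q p, Int.units_mul_self,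
    one_smul, neg_sub]

theorem bracket_eq_zero_symm (hP : P ∈ homogeneous R W p) (hQ : Q ∈ homogeneous R W q)
    (h : bracket R W P Q = 0) : bracket R W Q P = 0 := by
  rw [bracket_comm hQ hP, h, smul_zero, neg_zero]

theorem bracket_bracket (hP : P ∈ homogeneous R W p) (hQ : Q ∈ homogeneous R W q)
    (hS : S ∈ homogeneous R W r) :
    bracket R W (bracket R W P Q) S = bracket R W P (bracket R W Q S) +
      (q * r).negOnePow • bracket R W (bracket R W P S) Q := by
  have preLieP := circ_circ_sub_comm (P := P) hQ hS
  have preLieQ := circ_circ_sub_comm (P := Q) hP hS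
  have preLieS := circ_circ_sub_comm (P := S) hP hQ
  rw [bracket_eq (bracket_mem hP hQ) hS, bracket_eq hP (bracket_mem hQ hS),
    bracket_eq (bracket_mem hP hS) hQ, bracket_eq hP hQ, bracket_eq hQ hS, bracket_eq hP hS,
    add_mul, mul_add, add_mul, mul_comm r q]
  simp only [Int.negOnePow_add, Units.smul_def, map_sub, LinearMap.sub_apply, map_zsmul,
    LinearMap.smul_apply] at *
  linear_combination (norm := skip) (-(q * r).negOnePow : ℤ) • preLieP +
    ((p * q).negOnePow * (p * r).negOnePow : ℤ) • preLieQ -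
    ((p * q).negOnePow * (p * r).negOnePow * (q * r).negOnePow : ℤ) • preLieS
  obtain a | a := Int.units_eq_one_or (p * q).negOnePow <;>
    obtain b | b := Int.units_eq_one_or (p * r).negOnePow <;>
    obtain c | c := Int.units_eq_one_or (q * r).negOnePow <;>
    simp only [a, b, c, Units.val_mul, Units.val_one, Units.val_neg] <;> module

end AltOp

end AltOp

/-! ### Sums over unshuffles as sums over splittings -/

section Cuts

/-- The partial sums of the block sizes `b`, that is the positions at which the blocks meet. -/
def cuts (b : List ℕ) : List ℕ := b.scanl (· + ·) 0

/-- The position `p` is the first one of a nonempty block. -/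
def StartsBlock (b : List ℕ) (p : ℕ) : Prop := p < b.sum ∧ p ∈ cuts b

/-- The block sizes that remain after removing the position `p`, the first one of a block. -/
def removeStart : List ℕ → ℕ → List ℕ
  | [], _ => []
  | m :: b, p => if p = 0 ∧ 0 < m then (m - 1) :: b else m :: removeStart b (p - m)

theorem zero_mem_cuts (b : List ℕ) : 0 ∈ cuts b := by
  cases b <;> simp [cuts]

theorem mem_cuts_cons {m : ℕ} {b : List ℕ} {k : ℕ} :
    k ∈ cuts (m :: b) ↔ k = 0 ∨ m ≤ k ∧ k - m ∈ cuts b := by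
  have mem_scanl (b : List ℕ) (a k : ℕ) : k ∈ b.scanl (· + ·) a ↔ a ≤ k ∧ k - a ∈ cuts b := by
    induction b generalizing a k with
    | nil => simp only [cuts, List.scanl_nil, List.mem_singleton]; omega
    | cons m b ih =>
      rw [List.scanl_cons, List.mem_cons, ih,
        show cuts (m :: b) = 0 :: b.scanl (· + ·) m by rw [cuts, List.scanl_cons, zero_add],
        List.mem_cons, ih, ← Nat.sub_sub]
      by_cases h : a = k
      · simp [h]
      · rw [or_iff_right (Ne.symm h)]
        constructor
        · rintro ⟨hk, h⟩
          exact ⟨by omega, .inr ⟨by omega, h⟩⟩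
        · rintro ⟨hk, h' | ⟨hm, h⟩⟩
          · omega
          · exact ⟨by omega, h⟩
  rw [cuts, List.scanl_cons, List.mem_cons, mem_scanl, zero_add]

theorem startsBlock_cons {m : ℕ} {b : List ℕ} {p : ℕ} :
    StartsBlock (m :: b) p ↔ p = 0 ∧ 0 < m ∨ m ≤ p ∧ StartsBlock b (p - m) := by
  simp only [StartsBlock, mem_cuts_cons, List.sum_cons]
  constructor
  · rintro ⟨h, rfl | ⟨hm, hp⟩⟩
    · by_cases hm : 0 < m
      · exact .inl ⟨rfl, hm⟩
      · exact .inr ⟨by omega, by omega, by simpa using zero_mem_cuts b⟩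
    · exact .inr ⟨hm, by omega, hp⟩
  · rintro (⟨rfl, hm⟩ | ⟨hm, h, hp⟩)
    · exact ⟨by omega, .inl rfl⟩
    · exact ⟨by omega, .inr ⟨hm, hp⟩⟩

theorem sum_removeStart {b : List ℕ} {p : ℕ} (h : StartsBlock b p) :
    (removeStart b p).sum + 1 = b.sum := by
  induction b generalizing p with
  | nil => exact absurd h.1 (Nat.not_lt_zero p)
  | cons m b ih =>
    rw [removeStart]
    split_ifs with hp
    · simp only [List.sum_cons]
      omega
    · obtain ⟨-, h⟩ := (startsBlock_cons.1 h).resolve_left hp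
      rw [List.sum_cons, List.sum_cons, ← ih h]
      omega

theorem mem_cuts_removeStart {b : List ℕ} {p : ℕ} (h : StartsBlock b p) (k : ℕ) :
    k ∈ cuts (removeStart b p) ↔ k ≤ p ∧ k ∈ cuts b ∨ p ≤ k ∧ k + 1 ∈ cuts b := by
  induction b generalizing p k with
  | nil => exact absurd h.1 (Nat.not_lt_zero p)
  | cons m b ih =>
    rw [removeStart]
    split_ifs with hp
    · obtain ⟨rfl, hm⟩ := hp
      simp only [mem_cuts_cons, show k - (m - 1) = k + 1 - m by omega, Nat.le_zero, zero_le,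
        true_and, Nat.add_eq_zero_iff, one_ne_zero, and_false, false_or,
        show m - 1 ≤ k ↔ m ≤ k + 1 by omega]
      exact or_congr_left ⟨fun h => ⟨h, .inl h⟩, fun h => h.1⟩
    · obtain ⟨hm, h⟩ := (startsBlock_cons.1 h).resolve_left hp
      simp only [mem_cuts_cons, ih h]
      constructor
      · rintro (rfl | ⟨hk, ⟨hkp, hc⟩ | ⟨hkp, hc⟩⟩)
        · exact .inl ⟨by omega, .inl rfl⟩
        · exact .inl ⟨by omega, .inr ⟨hk, hc⟩⟩
        · exact .inr ⟨by omega, .inr ⟨by omega, by rwa [Nat.sub_add_comm hk]⟩⟩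
      · rintro (⟨hkp, rfl | ⟨hk, hc⟩⟩ | ⟨hkp, h | ⟨hk, hc⟩⟩)
        · exact .inl rfl
        · exact .inr ⟨hk, .inl ⟨by omega, hc⟩⟩
        · omega
        · exact .inr ⟨by omega, .inr ⟨by omega, by rwa [← Nat.sub_add_comm (by omega)]⟩⟩

end Cuts

section InsertPerm

variable {n : ℕ}

/-- The permutation with `p ↦ 0` that acts as `τ` on the other positions and values. -/
def insertPerm (p : Fin (n + 1)) (τ : Equiv.Perm (Fin n)) : Equiv.Perm (Fin (n + 1)) :=
  Equiv.Perm.decomposeFin.symm (0, τ) * p.cycleRange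

theorem insertPerm_self (p : Fin (n + 1)) (τ : Equiv.Perm (Fin n)) : insertPerm p τ p = 0 := by
  simp [insertPerm]

theorem insertPerm_succAbove (p : Fin (n + 1)) (τ : Equiv.Perm (Fin n)) (i : Fin n) :
    insertPerm p τ (p.succAbove i) = (τ i).succ := by
  simp [insertPerm]

theorem insertPerm_bijective (n : ℕ) :
    Function.Bijective fun x : Fin (n + 1) × Equiv.Perm (Fin n) => insertPerm x.1 x.2 := by
  rw [Fintype.bijective_iff_injective_and_card]
  refine ⟨fun ⟨p, τ⟩ ⟨q, υ⟩ h => ?_, by simp [Fintype.card_perm, Nat.factorial_succ]⟩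
  replace h : insertPerm p τ = insertPerm q υ := h
  obtain rfl : p = q := (insertPerm q υ).injective <| by
    rw [insertPerm_self, ← h, insertPerm_self]
  refine Prod.ext rfl (Equiv.ext fun i => Fin.succ_injective _ ?_)
  rw [← insertPerm_succAbove p τ, h, insertPerm_succAbove]

theorem val_succAbove (p : Fin (n + 1)) (i : Fin n) :
    (p.succAbove i : ℕ) = if (i : ℕ) < p then (i : ℕ) else i + 1 := by
  rw [Fin.succAbove]
  split_ifs <;> simp_all [Fin.lt_def]

variable {b : List ℕ} {p : Fin (n + 1)} {τ : Equiv.Perm (Fin n)}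

theorem isUnshuffle_iff {σ : Equiv.Perm (Fin n)} :
    IsUnshuffle b σ ↔
      ∀ s t : Fin n, s < t → (∀ k ∈ cuts b, (s : ℕ) < k → (t : ℕ) < k) → σ s < σ t := by
  simp only [IsUnshuffle, cuts, not_and, not_le]

theorem IsUnshuffle.startsBlock (hb : b.sum = n + 1) (h : IsUnshuffle b (insertPerm p τ)) :
    StartsBlock b p := by
  refine ⟨by rw [hb]; exact p.2, ?_⟩
  by_contra hc
  have hp : (p : ℕ) ≠ 0 := fun h => hc (h ▸ zero_mem_cuts b)
  have lt_zero := isUnshuffle_iff.1 h ⟨p - 1, by omega⟩ p (by rw [Fin.lt_def]; simp only; omega)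
    fun k hk hlt => lt_of_le_of_ne (by simp only at hlt; omega) fun h => hc (h ▸ hk)
  rw [insertPerm_self] at lt_zero
  exact Fin.not_lt_zero _ lt_zero

theorem forall_mem_cuts_removeStart_iff (hp : StartsBlock b p) {i j : Fin n} :
    (∀ k ∈ cuts (removeStart b p), (i : ℕ) < k → (j : ℕ) < k) ↔
      ∀ k ∈ cuts b, (p.succAbove i : ℕ) < k → (p.succAbove j : ℕ) < k := by
  simp only [val_succAbove, mem_cuts_removeStart hp]
  constructor
  · intro h k hk
    by_cases hkp : k ≤ p
    · have := h k (.inl ⟨hkp, hk⟩)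
      split_ifs <;> omega
    · have := h (k - 1) (.inr ⟨by omega, by rwa [Nat.sub_add_cancel (by omega)]⟩)
      split_ifs <;> omega
  · rintro h k (⟨hkp, hk⟩ | ⟨hkp, hk⟩)
    all_goals
      have := h _ hk
      split_ifs at this <;> omega

theorem isUnshuffle_insertPerm (hb : b.sum = n + 1) :
    IsUnshuffle b (insertPerm p τ) ↔ StartsBlock b p ∧ IsUnshuffle (removeStart b p) τ := by
  refine ⟨fun h => ⟨h.startsBlock hb, isUnshuffle_iff.2 fun i j hij hc => ?_⟩, fun ⟨hp, h⟩ =>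
    isUnshuffle_iff.2 fun s t hst hc => ?_⟩
  · have := isUnshuffle_iff.1 h _ _ (Fin.succAbove_lt_succAbove_iff.2 hij)
      ((forall_mem_cuts_removeStart_iff (h.startsBlock hb)).1 hc)
    rwa [insertPerm_succAbove, insertPerm_succAbove, Fin.succ_lt_succ_iff] at this
  · rcases Fin.eq_self_or_eq_succAbove p t with rfl | ⟨j, rfl⟩
    · exact absurd (hc _ hp.2 hst) (lt_irrefl _)
    rcases Fin.eq_self_or_eq_succAbove p s with rfl | ⟨i, rfl⟩
    · rw [insertPerm_self, insertPerm_succAbove]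
      exact Fin.succ_pos _
    · rw [insertPerm_succAbove, insertPerm_succAbove, Fin.succ_lt_succ_iff]
      exact isUnshuffle_iff.1 h i j (Fin.succAbove_lt_succAbove_iff.1 hst)
        ((forall_mem_cuts_removeStart_iff hp).2 hc)

theorem ofFn_comp_insertPerm {α : Type*} (w : Fin (n + 1) → α) (p : Fin (n + 1))
    (τ : Equiv.Perm (Fin n)) :
    List.ofFn (w ∘ insertPerm p τ) = (List.ofFn (Fin.tail w ∘ τ)).insertIdx p (w 0) := by
  refine List.ext_getElem (by simp [List.length_insertIdx, Nat.le_of_lt_succ p.2]) fun i h₁ h₂ => ?_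
  rw [List.length_ofFn] at h₁
  rw [List.getElem_insertIdx, List.getElem_ofFn]
  rcases Fin.eq_self_or_eq_succAbove p ⟨i, h₁⟩ with h | ⟨j, h⟩
  · obtain rfl : i = p := congrArg Fin.val h
    simp [insertPerm_self]
  · have hi : i = if (j : ℕ) < p then (j : ℕ) else j + 1 :=
      (congrArg Fin.val h).trans (val_succAbove p j)
    rw [h, Function.comp_apply, insertPerm_succAbove]
    split_ifs at hi
    · simp_all [Fin.tail]
    · simp_all [Fin.tail, show ¬ (j : ℕ) + 1 < p by omega, show ¬ (j : ℕ) + 1 = p by omega]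

end InsertPerm

section SplitBlocks

variable {α M N : Type*} [AddCommGroup M] [AddCommGroup N] (c : α → α → ℤˣ)

/-- The signed sum of `Φ` over the ways to reorder a list so that the order is preserved within each
of the consecutive blocks of sizes `b`. -/
def splitBlocks : List ℕ → (List α → M) → List α → M
  | [], Φ, l => if l.length = 0 then Φ [] else 0
  | m :: b, Φ, l =>
    split c (fun A B => if A.length = m then splitBlocks b (fun r => Φ (A ++ r)) B else 0) l

theorem map_splitBlocks {F : Type*} [FunLike F M N] [AddMonoidHomClass F M N] (f : F) (b : List ℕ)
    (Φ : List α → M) (l : List α) :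
    f (splitBlocks c b Φ l) = splitBlocks c b (fun r => f (Φ r)) l := by
  induction b generalizing Φ l with
  | nil => simp only [splitBlocks, apply_ite f, map_zero]
  | cons m b ih => simp only [splitBlocks, map_split, apply_ite f, map_zero, ih]

theorem splitBlocks_units_smul (b : List ℕ) (k : ℤˣ) (Φ : List α → M) (l : List α) :
    splitBlocks c b (fun r => k • Φ r) l = k • splitBlocks c b Φ l :=
  (map_splitBlocks c (DistribSMul.toAddMonoidHom M k) b Φ l).symm

theorem splitBlocks_add (b : List ℕ) (Φ Ψ : List α → M) (l : List α) :
    splitBlocks c b (fun r => Φ r + Ψ r) l = splitBlocks c b Φ l + splitBlocks c b Ψ l := by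
  induction b generalizing Φ Ψ l with
  | nil =>
    simp only [splitBlocks]
    split_ifs <;> simp only [add_zero]
  | cons m b ih =>
    simp only [splitBlocks, ih, ← split_add]
    refine split_congr c fun A B _ => ?_
    split_ifs <;> simp only [add_zero]

theorem splitBlocks_nil {b : List ℕ} (hb : b.sum = 0) (Φ : List α → M) :
    splitBlocks c b Φ [] = Φ [] := by
  induction b generalizing Φ with
  | nil => rfl
  | cons m b ih =>
    rw [List.sum_cons] at hb
    simp [splitBlocks, split, show m = 0 by omega, ih (show b.sum = 0 by omega)]

theorem insertIdx_append_add (A r : List α) (p : ℕ) (x : α) :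
    (A ++ r).insertIdx (A.length + p) x = A ++ r.insertIdx p x := by
  induction A with
  | nil => simp
  | cons a A ih =>
    rw [List.length_cons, Nat.add_right_comm, List.cons_append, List.insertIdx_succ_cons, ih,
      List.cons_append]

open Classical in
/-- The first entry of the list goes to the start of one of the blocks. -/
theorem splitBlocks_cons (b : List ℕ) (Φ : List α → M) (x : α) (l : List α) :
    splitBlocks c b Φ (x :: l) = ∑ p ∈ Finset.range b.sum, if StartsBlock b p then
      splitBlocks c (removeStart b p) (fun r => passSign c x (r.take p) • Φ (r.insertIdx p x)) l
      else 0 := by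
  induction b generalizing Φ l with
  | nil => simp [splitBlocks]
  | cons m b ih =>
    rw [List.sum_cons, Finset.sum_range_add]
    refine congrArg₂ (· + ·) ?_ ?_
    · rcases m with _ | m
      · simp [split_zero]
      · rw [Finset.sum_range_succ', Finset.sum_eq_zero, zero_add]
        · simp [startsBlock_cons, removeStart, splitBlocks, passSign]
        · intro k hk
          rw [Finset.mem_range] at hk
          rw [if_neg (by rw [startsBlock_cons]; omega)]
    · have rec_tail (A B : List α) :
          (passSign c x A • if A.length = m then
            splitBlocks c b (fun r => Φ (A ++ r)) (x :: B) else 0) =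
          ∑ p ∈ Finset.range b.sum, if StartsBlock b p then if A.length = m then
            splitBlocks c (removeStart b p) (fun r => passSign c x ((A ++ r).take (m + p)) •
              Φ ((A ++ r).insertIdx (m + p) x)) B else 0 else 0 := by
        split_ifs with hA
        · subst hA
          simp only [ih, Finset.smul_sum, smul_ite, smul_zero, List.take_length_add_append,
            passSign_append, insertIdx_append_add, mul_smul, splitBlocks_units_smul]
        · simp
      simp only [rec_tail, split_sum]
      refine Finset.sum_congr rfl fun p hp => ?_
      rw [Finset.mem_range] at hp
      rw [startsBlock_cons, removeStart, if_neg (by omega : ¬(m + p = 0 ∧ 0 < m)),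
        Nat.add_sub_cancel_left, or_iff_right (by omega), and_iff_right (Nat.le_add_right m p)]
      split_ifs
      · rfl
      · exact split_zero c l

theorem splitBlocks_singleton (m : ℕ) (Φ : List α → M) (l : List α) :
    splitBlocks c [m] Φ l = if l.length = m then Φ l else 0 := by
  simp only [splitBlocks, List.append_nil]
  rw [split_eq_apply_nil c fun A B hB => by
    rw [if_neg (mt List.length_eq_zero_iff.1 hB), ite_self]]
  rfl

theorem splitBlocks_singleton_of_support {m : ℕ} {Φ : List α → M}
    (hΦ : ∀ A, A.length ≠ m → Φ A = 0) (l : List α) : splitBlocks c [m] Φ l = Φ l := by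
  rw [splitBlocks_singleton]
  split_ifs with h
  exacts [rfl, (hΦ l h).symm]

theorem splitBlocks_cons_of_support {m : ℕ} (b : List ℕ) {Φ : List α → List α → M}
    (hΦ : ∀ A r, A.length ≠ m → Φ A r = 0) (l : List α) :
    splitBlocks c (m :: b) (fun r => Φ (r.take m) (r.drop m)) l =
      split c (fun A B => splitBlocks c b (Φ A) B) l := by
  refine split_congr c fun A B _ => ?_
  split_ifs with hA
  · simp only [← hA, List.take_left, List.drop_left]
  · rw [show Φ A = fun _ => 0 from funext fun r => hΦ A r hA]
    exact map_splitBlocks c (0 : M →+ M) b (fun _ => 0) B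

end SplitBlocks

section PermSign

variable {α M : Type*} [AddCommGroup M] (c : α → α → ℤˣ) {n : ℕ}

/-- The sign of the reordering `w ∘ σ` of `w` for the commutation factor `c`. -/
def permSign (w : Fin n → α) (σ : Equiv.Perm (Fin n)) : ℤˣ :=
  ∏ s, ∏ t, if s < t ∧ σ t < σ s then c (w (σ t)) (w (σ s)) else 1

theorem permSign_insertPerm (w : Fin (n + 1) → α) (p : Fin (n + 1)) (τ : Equiv.Perm (Fin n)) :
    permSign c w (insertPerm p τ) =
      passSign c (w 0) ((List.ofFn (Fin.tail w ∘ τ)).take p) * permSign c (Fin.tail w) τ := by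
  have hlt (j : Fin n) : p.succAbove j < p ↔ (j : ℕ) < p := by
    rw [Fin.lt_def, val_succAbove]
    split_ifs <;> omega
  have pass_eq : passSign c (w 0) ((List.ofFn (Fin.tail w ∘ τ)).take p) =
      ∏ j : Fin n, if (j : ℕ) < p then c (w 0) (w (τ j).succ) else 1 := by
    rw [passSign, List.map_take, List.map_ofFn, List.prod_take_ofFn, Finset.prod_filter]
    rfl
  simp only [pass_eq, permSign, Fin.prod_univ_succAbove _ p, insertPerm_self, insertPerm_succAbove,
    Fin.not_lt_zero, and_false, if_false, Finset.prod_const_one, one_mul, lt_irrefl, hlt,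
    Fin.succ_pos, and_true, Finset.prod_mul_distrib, Fin.succ_lt_succ_iff,
    Fin.succAbove_lt_succAbove_iff]
  rfl

theorem sign_eq_permSign (w : Fin n → α) (σ : Equiv.Perm (Fin n)) :
    Equiv.Perm.sign σ = permSign skewSign w σ := by
  rw [Equiv.Perm.sign_eq_prod_prod_Ioi, permSign]
  refine Finset.prod_congr rfl fun s _ => ?_
  rw [← Finset.filter_lt_eq_Ioi, Finset.prod_filter]
  refine Finset.prod_congr rfl fun t _ => ?_
  by_cases hst : s < t
  · rcases lt_or_gt_of_ne (σ.injective.ne hst.ne) with h | h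
    · simp [hst, h, h.not_gt]
    · simp [hst, h, h.not_gt, skewSign]
  · simp [hst]

theorem koszulSign_eq_permSign (d : Fin n → ℤ) (σ : Equiv.Perm (Fin n)) :
    koszulSign d σ = permSign (fun a b => -(a * b).negOnePow) d σ := by
  rw [koszulSign, sign_eq_permSign d, permSign, permSign, ← Finset.prod_mul_distrib]
  refine Finset.prod_congr rfl fun s _ => ?_
  rw [← Finset.prod_mul_distrib]
  refine Finset.prod_congr rfl fun t _ => ?_
  split_ifs
  · rw [skewSign, mul_comm (d (σ s)), neg_one_mul]
  · rw [mul_one]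

theorem sum_unshuffles {b : List ℕ} (hb : b.sum = n) (w : Fin n → α) (Φ : List α → M) :
    ∑ σ ∈ unshuffles b n, permSign c w σ • Φ (List.ofFn (w ∘ σ)) =
      splitBlocks c b Φ (List.ofFn w) := by
  classical
  induction n generalizing b Φ with
  | zero =>
    have : unshuffles b 0 = Finset.univ :=
      Finset.filter_true_of_mem fun σ _ s => s.elim0
    rw [this, Fintype.sum_unique, List.ofFn_zero, List.ofFn_zero, splitBlocks_nil c hb]
    exact one_smul _ _
  | succ n ih =>
    rw [List.ofFn_succ, splitBlocks_cons, unshuffles, Finset.sum_filter,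
      ← (insertPerm_bijective n).sum_comp, Fintype.sum_prod_type, hb, ← Fin.sum_univ_eq_sum_range
        (fun p => if StartsBlock b p then splitBlocks c (removeStart b p)
          (fun r => passSign c (w 0) (r.take p) • Φ (r.insertIdx p (w 0))) _ else 0)]
    refine Finset.sum_congr rfl fun p _ => ?_
    simp only [isUnshuffle_insertPerm hb]
    split_ifs with hp
    · rw [show List.ofFn (fun i : Fin n => w i.succ) = List.ofFn (Fin.tail w) from rfl,
        ← ih (by have := sum_removeStart hp; omega), unshuffles, Finset.sum_filter]
      refine Finset.sum_congr rfl fun τ _ => ?_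
      simp only [hp, true_and]
      split_ifs
      · rw [ofFn_comp_insertPerm, permSign_insertPerm, mul_comm, mul_smul]
      · rfl
    · simp [hp]

theorem sum_unshuffles_pair {i : ℕ} (hi : i ≤ n) (w : Fin n → α) (Φ : List α → List α → M) :
    ∑ σ ∈ unshuffles [i, n - i] n, permSign c w σ •
        Φ ((List.ofFn (w ∘ σ)).take i) ((List.ofFn (w ∘ σ)).drop i) =
      split c (fun A B => if A.length = i then Φ A B else 0) (List.ofFn w) := by
  rw [sum_unshuffles c (by simp [hi]) w fun l => Φ (l.take i) (l.drop i), splitBlocks]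
  refine split_congr c fun A B hAB => ?_
  have hlength := hAB.length_eq
  rw [List.length_append, List.length_ofFn] at hlength
  split_ifs with hA
  · subst hA
    rw [splitBlocks_singleton, if_pos (by omega), List.take_left, List.drop_left]
  · rfl

theorem apply_passSign {f : List α → M} {x : α} {L : List α}
    (hf : ∀ l x y l', (l ++ x :: y :: l').Perm L →
      f (l ++ y :: x :: l') = c x y • f (l ++ x :: y :: l')) (l A B : List α)
    (h : (l ++ x :: (A ++ B)).Perm L) :
    f (l ++ (A ++ x :: B)) = passSign c x A • f (l ++ x :: (A ++ B)) := by
  induction A generalizing l with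
  | nil => simp [passSign]
  | cons a A ih =>
    have swap : (l ++ a :: x :: (A ++ B)).Perm L :=
      ((List.Perm.swap x a (A ++ B)).append_left l).trans h
    have := ih (l ++ [a]) (by simpa using swap)
    simp only [List.append_assoc, List.singleton_append] at this
    rw [List.cons_append, this, List.cons_append, hf l x a (A ++ B) h, smul_smul, mul_comm]
    simp [passSign]

theorem apply_ofFn_comp_perm {f : List α → M} {w : Fin n → α}
    (hf : ∀ l x y l', (l ++ x :: y :: l').Perm (List.ofFn w) →
      f (l ++ y :: x :: l') = c x y • f (l ++ x :: y :: l')) (σ : Equiv.Perm (Fin n)) :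
    f (List.ofFn (w ∘ σ)) = permSign c w σ • f (List.ofFn w) := by
  induction n generalizing f with
  | zero => simp [permSign]
  | succ n ih =>
    obtain ⟨⟨p, τ⟩, rfl⟩ := (insertPerm_bijective n).2 σ
    have perm : (w 0 :: List.ofFn (Fin.tail w ∘ τ)).Perm (List.ofFn w) := by
      rw [List.ofFn_succ]
      exact (τ.ofFn_comp_perm _).cons _
    generalize hL : List.ofFn (Fin.tail w ∘ τ) = L at perm
    have insert_eq : L.insertIdx p (w 0) = L.take p ++ w 0 :: L.drop p := by
      have hp : (L.take p).length = p := by simp [← hL, Nat.le_of_lt_succ p.2]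
      have := insertIdx_append_add (L.take p) (L.drop p) 0 (w 0)
      rwa [hp, List.take_append_drop, List.insertIdx_zero] at this
    have pass := apply_passSign c hf [] (L.take p) (L.drop p)
      (by rwa [List.nil_append, List.take_append_drop])
    rw [ofFn_comp_insertPerm, permSign_insertPerm, hL, insert_eq, mul_smul]
    rw [List.nil_append, List.nil_append, List.take_append_drop] at pass
    rw [pass, ← hL, List.ofFn_succ]
    refine congrArg _ (ih (f := fun l => f (w 0 :: l)) (fun l x y l' h => ?_) τ)
    exact hf (w 0 :: l) x y l' (by rw [List.ofFn_succ]; exact h.cons _)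

theorem ofFn_block (x : Fin n → α) (k m : ℕ) (h : k + m ≤ n) :
    List.ofFn (block x k m h) = ((List.ofFn x).drop k).take m := by
  refine List.ext_getElem (by simp; omega) fun i h₁ h₂ => ?_
  simp [block]

theorem ofFn_comp_cast {m : ℕ} (h : m = n) (x : Fin n → α) :
    List.ofFn (x ∘ Fin.cast h) = List.ofFn x := by
  subst h; rfl

end PermSign

section UnshuffleSign

variable {α M : Type*} [AddCommGroup M] {n : ℕ}

theorem listOne_ofFn [AddCommGroup α] (x : Fin n → α) (k : ℕ) (h : k < n) :
    x ⟨k, h⟩ = listOne (((List.ofFn x).drop k).take 1) := by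
  rw [← ofFn_block x k 1 h, List.ofFn_succ, List.ofFn_zero]
  rfl

theorem sum_unshuffles_sign {b : List ℕ} (hb : b.sum = n) (x : Fin n → α) (Φ : List α → M) :
    ∑ σ ∈ unshuffles b n, Equiv.Perm.sign σ • Φ (List.ofFn (x ∘ σ)) =
      splitBlocks skewSign b Φ (List.ofFn x) := by
  simp only [sign_eq_permSign x, sum_unshuffles skewSign hb]

end UnshuffleSign

theorem AltOp.splitBlocks_totalSkew {R W M : Type*} [CommRing R] [AddCommGroup W] [Module R W]
    [AddCommGroup M] {Q : AltOp R W} {q : ℕ} (hQ : Q ∈ homogeneous R W q) (b : List ℕ)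
    {Φ : W → List W → M} (hΦ : ∀ w w' r, Φ (w + w') r = Φ w r + Φ w' r) (l : List W) :
    splitBlocks skewSign (q :: 1 :: b)
        (fun r => Φ (Q (r.take q) (listOne ((r.drop q).take 1))) ((r.drop q).drop 1)) l =
      split skewSign (fun A B => splitBlocks skewSign b (Φ (Q.totalSkew A)) B) l := by
  let φ (B : List W) : W →+ M := AddMonoidHom.mk' (fun w => splitBlocks skewSign b (Φ w) B)
    fun w w' => by rw [← splitBlocks_add]; exact congrArg (splitBlocks _ b · B) (funext (hΦ w w'))
  have zero_left (r : List W) : Φ 0 r = 0 := by simpa using hΦ 0 0 r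
  rw [splitBlocks_cons_of_support _ (Φ := fun A r => Φ (Q A (listOne (r.take 1))) (r.drop 1))
    _ fun A r hA => by rw [hQ A (by simpa using hA), LinearMap.zero_apply, zero_left]]
  have one_block (A : List W) := splitBlocks_cons_of_support (m := 1) skewSign b
    (Φ := fun C => Φ (Q A (listOne C)))
    fun C r hC => by rw [listOne_of_length_ne_one hC, map_zero, zero_left]
  simp only [one_block]
  rw [split_assoc]
  exact split_congr _ fun A B _ => (map_split _ (φ B) _ A).symm

section Represents

variable {W : Type*} [AddCommGroup W] [Module ℂ W] {p q : ℕ}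

/-- The function `P` on lists of skew arguments agrees with the operation `F` on lists of the length
given by the arity of `F`. -/
def Represents (P : AltOp ℂ W) (F : Operation W p) : Prop :=
  ∀ x y, F x y = P (List.ofFn x) y

variable {P Q : AltOp ℂ W} {F : Operation W p} {G : Operation W q}

open AltOp

theorem diamondSkew_eq_split (hP : P ∈ homogeneous ℂ W p) (hQ : Q ∈ homogeneous ℂ W q)
    (hF : Represents P F) (hG : Represents Q G) (x : Fin (p + q) → W) (y : W) :
    diamondSkew F G x y =
      split skewSign (fun A B => P (Q.totalSkew A :: B) y) (List.ofFn x) := by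
  rcases p with _ | p
  · refine (split_eq_zero _ fun A B _ => ?_).symm
    rw [hP _ (by simp; omega), LinearMap.zero_apply]
  let Φ (w : W) (r : List W) : W := P (w :: r) y
  have Φ_add (w w' : W) (r : List W) : Φ (w + w') r = Φ w r + Φ w' r := by
    simp only [Φ, (P.linear_head r).map_add, LinearMap.add_apply]
  have key := sum_unshuffles_sign (b := [q, 1, p]) (by simp; omega) x
    fun l => Φ (Q (l.take q) (listOne ((l.drop q).take 1))) ((l.drop q).drop 1)
  rw [splitBlocks_totalSkew hQ _ Φ_add] at key
  have singleton (w : W) (B : List W) : splitBlocks skewSign [p] (Φ w) B = Φ w B :=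
    splitBlocks_singleton_of_support _ (fun D hD => by
      simp only [Φ, hP (w :: D) (by simpa using hD), LinearMap.zero_apply]) B
  simp only [singleton] at key
  rw [← key]
  refine Finset.sum_congr rfl fun σ _ => ?_
  rw [hF, hG, List.ofFn_cons]
  simp only [Φ, ← listOne_ofFn _ _ (show q < p + 1 + q by omega), ofFn_block, List.drop_drop,
    List.drop_zero, List.take_of_length_le (show
      ((List.ofFn (x ∘ σ)).drop (q + 1)).length ≤ p by simp; omega), Function.comp_apply]

theorem diamondLast_eq_split (hP : P ∈ homogeneous ℂ W p) (hQ : Q ∈ homogeneous ℂ W q)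
    (hF : Represents P F) (hG : Represents Q G) (x : Fin (p + q) → W) (y : W) :
    diamondLast F G x y = split skewSign (fun A B => P A (Q B y)) (List.ofFn x) := by
  have key := sum_unshuffles_sign (b := [p, q]) (by simp) x
    fun l => P (l.take p) (Q (l.drop p) y)
  rw [splitBlocks_cons_of_support (Φ := fun A r => P A (Q r y)) _ _ fun A r hA => by
    rw [hP A (by simpa using hA), LinearMap.zero_apply]] at key
  have singleton (A B : List W) :
      splitBlocks skewSign [q] (fun r => P A (Q r y)) B = P A (Q B y) :=
    splitBlocks_singleton_of_support _ (fun C hC => by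
      rw [hQ C (by simpa using hC), LinearMap.zero_apply, map_zero]) B
  simp only [singleton] at key
  rw [← key]
  refine Finset.sum_congr rfl fun σ _ => ?_
  rw [hF, hG]
  simp only [ofFn_block, List.drop_zero, List.take_of_length_le (show
      ((List.ofFn (x ∘ σ)).drop p).length ≤ q by simp)]

theorem represents_diamond (hP : P ∈ homogeneous ℂ W p) (hQ : Q ∈ homogeneous ℂ W q)
    (hF : Represents P F) (hG : Represents Q G) :
    Represents (circ ℂ W P Q) (diamond F G) := by
  intro x y
  have apply_circ : circ ℂ W P Q (List.ofFn x) y =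
      split skewSign (fun A B => P (Q.totalSkew A :: B) y + P B (Q A y)) (List.ofFn x) :=
    map_split _ (LinearMap.applyₗ (R := ℂ) y) _ _
  rw [apply_circ, split_add, diamond, diamondSkew_eq_split hP hQ hF hG,
    diamondLast_eq_split hP hQ hF hG, split_comm _ skewSign_mul_skewSign fun A B => P A (Q B y),
    ← split_smul]
  refine congrArg _ (split_congr _ fun A B _ => ?_)
  obtain hA | hA := eq_zero_or_length_eq hQ A
  · simp [hA]
  obtain hB | hB := eq_zero_or_length_eq hP B
  · simp [hB]
  rw [crossSign_skewSign, hA, hB, mul_comm (q : ℤ), ← Nat.cast_mul]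
  rw [Units.smul_def, Int.coe_negOnePow_natCast, smul_smul, ← mul_pow, neg_one_mul, neg_neg,
    one_pow, one_smul]

theorem represents_mnBracket (hP : P ∈ homogeneous ℂ W p) (hQ : Q ∈ homogeneous ℂ W q)
    (hF : Represents P F) (hG : Represents Q G) :
    Represents (bracket ℂ W P Q) (mnBracket F G) := by
  intro x y
  rw [mnBracket, represents_diamond hP hQ hF hG, represents_diamond hQ hP hG hF, ofFn_comp_cast,
    bracket_eq hP hQ, AltOp.sub_apply, LinearMap.sub_apply, units_smul_apply,
    LinearMap.smul_apply, Units.smul_def, ← Nat.cast_mul,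
    Int.coe_negOnePow_natCast]

end Represents

/-! ### Graded Lie algebras and iterated brackets -/

section GradedLie

variable {R L : Type*} [CommRing R] [AddCommGroup L] [Module R L]

/-- The bilinear map `b` makes `L` a graded Lie algebra, up to the condition that the
subspaces `𝒢 p` form a direct sum decomposition of `L`. -/
structure IsGradedLieBracket (𝒢 : ℤ → Submodule R L) (b : L →ₗ[R] L →ₗ[R] L) : Prop where
  mem : ∀ {p q x y}, x ∈ 𝒢 p → y ∈ 𝒢 q → b x y ∈ 𝒢 (p + q)
  skew : ∀ {p q x y}, x ∈ 𝒢 p → y ∈ 𝒢 q → b x y = -((p * q).negOnePow • b y x)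
  jacobi : ∀ {p q r x y z}, x ∈ 𝒢 p → y ∈ 𝒢 q → z ∈ 𝒢 r →
    b (b x y) z = b x (b y z) + (q * r).negOnePow • b (b x z) y

/-- The Koszul commutation factor of elements paired with their degrees. -/
def gradedSign {α : Type*} (x y : ℤ × α) : ℤˣ := (x.1 * y.1).negOnePow

/-- The total degree of a list of elements paired with their degrees. -/
def totalDegree {α : Type*} (l : List (ℤ × α)) : ℤ := (l.map Prod.fst).sum

theorem totalDegree_cons {α : Type*} (x : ℤ × α) (l : List (ℤ × α)) :
    totalDegree (x :: l) = x.1 + totalDegree l := by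
  simp [totalDegree]

theorem totalDegree_append_of_perm {α : Type*} {l A B : List (ℤ × α)} (h : (A ++ B).Perm l) :
    totalDegree A + totalDegree B = totalDegree l := by
  rw [totalDegree, totalDegree, ← List.sum_append, ← List.map_append]
  exact (h.map _).sum_eq

theorem gradedSign_mul_gradedSign {α : Type*} (x y : ℤ × α) :
    gradedSign x y * gradedSign y x = 1 := by
  rw [gradedSign, gradedSign, mul_comm y.1, Int.units_mul_self]

theorem passSign_gradedSign {α : Type*} (x : ℤ × α) (A : List (ℤ × α)) :
    passSign gradedSign x A = (x.1 * totalDegree A).negOnePow := by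
  induction A with
  | nil => simp [passSign, totalDegree]
  | cons y A ih =>
    rw [totalDegree_cons, mul_add, Int.negOnePow_add, ← ih]
    simp [passSign, gradedSign]

theorem crossSign_gradedSign {α : Type*} (A B : List (ℤ × α)) :
    crossSign gradedSign A B = (totalDegree A * totalDegree B).negOnePow := by
  induction A with
  | nil => simp [crossSign, totalDegree]
  | cons x A ih =>
    rw [totalDegree_cons, add_mul, Int.negOnePow_add, ← ih, ← passSign_gradedSign]
    simp [crossSign]

/-- The linear map `z ↦ [⋯[[z, x₁], x₂], ⋯, xₙ]` for the list of the `xᵢ`, which are paired with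
their degrees. -/
def iterBracket (b : L →ₗ[R] L →ₗ[R] L) : List (ℤ × L) → Module.End R L
  | [] => LinearMap.id
  | x :: l => iterBracket b l ∘ₗ b.flip x.2

theorem iterBracket_cons (b : L →ₗ[R] L →ₗ[R] L) (x : ℤ × L) (l : List (ℤ × L)) (z : L) :
    iterBracket b (x :: l) z = iterBracket b l (b z x.2) :=
  rfl

theorem iterBracket_append (b : L →ₗ[R] L →ₗ[R] L) (l l' : List (ℤ × L)) (z : L) :
    iterBracket b (l ++ l') z = iterBracket b l' (iterBracket b l z) := by
  induction l generalizing z with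
  | nil => rfl
  | cons x _ ih => exact ih (b z x.2)

variable {𝒢 : ℤ → Submodule R L} {b : L →ₗ[R] L →ₗ[R] L}

namespace IsGradedLieBracket

variable (hb : IsGradedLieBracket 𝒢 b) {l : List (ℤ × L)} {p q : ℤ} {z z' : L}
include hb

theorem iterBracket_mem (hz : z ∈ 𝒢 p) (hl : ∀ x ∈ l, x.2 ∈ 𝒢 x.1) :
    iterBracket b l z ∈ 𝒢 (p + totalDegree l) := by
  induction l generalizing p z with
  | nil => simpa [iterBracket, totalDegree] using hz
  | cons x l ih =>
    rw [totalDegree_cons, ← add_assoc]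
    exact ih (hb.mem hz (hl x List.mem_cons_self)) fun y hy => hl y (List.mem_cons_of_mem x hy)

/-- Every entry of the list acts as a derivation. -/
theorem iterBracket_bracket (hz : z ∈ 𝒢 p) (hz' : z' ∈ 𝒢 q) (hl : ∀ x ∈ l, x.2 ∈ 𝒢 x.1) :
    iterBracket b l (b z z') = split gradedSign (fun A B =>
      (q * totalDegree A).negOnePow • b (iterBracket b A z) (iterBracket b B z')) l := by
  induction l generalizing p q z z' with
  | nil => simp [iterBracket, split, totalDegree]
  | cons x l ih =>
    have hx := hl x List.mem_cons_self
    replace hl y (hy : y ∈ l) := hl y (List.mem_cons_of_mem x hy)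
    rw [iterBracket_cons, hb.jacobi hz hz' hx, map_add, Units.smul_def, map_zsmul, ← Units.smul_def,
      ih hz (hb.mem hz' hx) hl,
      ih (hb.mem hz hx) hz' hl, ← split_smul, add_comm, split]
    congr 1 <;> refine split_congr _ fun A B _ => ?_
    · rw [smul_smul, ← Int.negOnePow_add, totalDegree_cons, mul_add]
      rfl
    · rw [passSign_gradedSign, smul_smul, ← Int.negOnePow_add, add_mul, add_comm]
      rfl

end IsGradedLieBracket

end GradedLie

section Voronov

open Finset.HasAntidiagonal (antidiagonal mem_antidiagonal)

variable {R L : Type*} [CommRing R] [AddCommGroup L] [Module R L]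

/-- The data of Voronov's higher derived brackets: an abelian subalgebra `N` of a graded Lie algebra
and a Maurer-Cartan element `∑ₖ T k`, given by its components, such that the iterated bracket of
`T k` with `k` homogeneous elements of `N` is in `N`. -/
structure IsVoronovData (𝒢 : ℤ → Submodule R L) (b : L →ₗ[R] L →ₗ[R] L) (N : Submodule R L)
    (T : ℕ → L) : Prop where
  isGradedLieBracket : IsGradedLieBracket 𝒢 b
  abelian : ∀ {x y}, x ∈ N → y ∈ N → b x y = 0
  mem_one : ∀ k, T k ∈ 𝒢 1
  zero : T 0 = 0
  sum_bracket : ∀ n, ∑ k ∈ antidiagonal n, b (T k.1) (T k.2) = 0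
  closed : ∀ {l : List (ℤ × L)}, (∀ x ∈ l, x.2 ∈ N ⊓ 𝒢 x.1) → iterBracket b l (T l.length) ∈ N

namespace IsVoronovData

variable {𝒢 : ℤ → Submodule R L} {b : L →ₗ[R] L →ₗ[R] L} {N : Submodule R L} {T : ℕ → L}
  (hT : IsVoronovData 𝒢 b N T) {l A B : List (ℤ × L)} {p q : ℤ} {u z : L}
include hT

theorem iterBracket_eq_zero (hl : ∀ x ∈ l, x.2 ∈ N ⊓ 𝒢 x.1) {k : ℕ} (hk : k < l.length) :
    iterBracket b l (T k) = 0 := by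
  obtain ⟨l', A, y, rfl, rfl⟩ : ∃ l' A y, l = A ++ y :: l' ∧ A.length = k :=
    ⟨_, _, _, by rw [← List.drop_eq_getElem_cons hk, List.take_append_drop], by simp; omega⟩
  simp only [List.forall_mem_append, List.forall_mem_cons] at hl
  rw [iterBracket_append, iterBracket_cons, hT.abelian (hT.closed hl.1) hl.2.1.1, map_zero]

theorem iterBracket_swap (hz : z ∈ 𝒢 p) (hl : ∀ x ∈ l, x.2 ∈ 𝒢 x.1) {x y : ℤ × L}
    (hx : x.2 ∈ N ⊓ 𝒢 x.1) (hy : y.2 ∈ N ⊓ 𝒢 y.1) (l' : List (ℤ × L)) :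
    iterBracket b (l ++ y :: x :: l') z = gradedSign x y • iterBracket b (l ++ x :: y :: l') z := by
  simp only [iterBracket_append, iterBracket_cons]
  rw [hT.isGradedLieBracket.jacobi (hT.isGradedLieBracket.iterBracket_mem hz hl) hy.2 hx.2,
    hT.abelian hy.1 hx.1, map_zero, zero_add, Units.smul_def, map_zsmul, ← Units.smul_def,
    mul_comm, gradedSign]

theorem iterBracket_bracket_of_mem (hu : u ∈ N ⊓ 𝒢 p) (hz : z ∈ 𝒢 q)
    (hl : ∀ x ∈ l, x.2 ∈ N ⊓ 𝒢 x.1) : iterBracket b l (b u z) = b u (iterBracket b l z) := by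
  induction l generalizing q z with
  | nil => rfl
  | cons x l ih =>
    obtain ⟨hxN, hx⟩ := hl x List.mem_cons_self
    rw [iterBracket_cons, hT.isGradedLieBracket.jacobi hu.2 hz hx, hT.abelian hu.1 hxN,
      map_zero, LinearMap.zero_apply, smul_zero, add_zero,
      ih (hT.isGradedLieBracket.mem hz hx) fun y hy => hl y (List.mem_cons_of_mem x hy)]
    rfl

/-- The right hand side is a summand of the `n`-th Jacobi expression, the left hand side one of the
expansion of an iterated bracket of `b (T i) (T j)`. -/
theorem iterBracket_bracket (hA : ∀ x ∈ A, x.2 ∈ N ⊓ 𝒢 x.1) (hB : ∀ x ∈ B, x.2 ∈ N ⊓ 𝒢 x.1)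
    (j : ℕ) : iterBracket b B (b (T j) (iterBracket b A (T A.length))) =
      (totalDegree A).negOnePow • b (iterBracket b A (T A.length)) (iterBracket b B (T j)) := by
  have hb := hT.isGradedLieBracket
  have hu : iterBracket b A (T A.length) ∈ N ⊓ 𝒢 (1 + totalDegree A) :=
    ⟨hT.closed hA, hb.iterBracket_mem (hT.mem_one _) fun x hx => (hA x hx).2⟩
  rw [hb.skew (hT.mem_one j) hu.2, one_mul, add_comm, Int.negOnePow_succ, Units.neg_smul, neg_neg,
    Units.smul_def, map_zsmul, hT.iterBracket_bracket_of_mem hu (hT.mem_one j) hB, Units.smul_def]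

variable (b T) in
omit hT in
/-- The sum of `± [⋯[[T j, [⋯[T i, x₁], ⋯, xᵢ]], xᵢ₊₁], ⋯, xₙ]` over the unshuffles. -/
def jacobiTerm (l : List (ℤ × L)) (i j : ℕ) : L :=
  split gradedSign
    (fun A B => if A.length = i then iterBracket b B (b (T j) (iterBracket b A (T i))) else 0) l

theorem jacobiTerm_zero_left (l : List (ℤ × L)) (j : ℕ) : jacobiTerm b T l 0 j = 0 := by
  simp only [jacobiTerm, hT.zero, map_zero, ite_self, split_zero]

theorem jacobiTerm_zero_right (l : List (ℤ × L)) (i : ℕ) : jacobiTerm b T l i 0 = 0 := by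
  simp only [jacobiTerm, hT.zero, map_zero, LinearMap.zero_apply, ite_self, split_zero]

theorem jacobiTerm_eq (hl : ∀ x ∈ l, x.2 ∈ N ⊓ 𝒢 x.1) (i j : ℕ) :
    jacobiTerm b T l i j = split gradedSign (fun A B => if A.length = i then
      (totalDegree A).negOnePow • b (iterBracket b A (T i)) (iterBracket b B (T j)) else 0) l := by
  refine split_congr _ fun A B hAB => ?_
  obtain ⟨hA, hB⟩ := List.forall_mem_append.1 fun x hx => hl x (hAB.mem_iff.1 hx)
  split_ifs with h
  · subst h
    exact hT.iterBracket_bracket hA hB j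
  · rfl

theorem jacobiTerm_swap_eq (hl : ∀ x ∈ l, x.2 ∈ N ⊓ 𝒢 x.1) (i j : ℕ) :
    jacobiTerm b T l j i = split gradedSign (fun A B => if B.length = j then
      (totalDegree A).negOnePow • b (iterBracket b A (T i)) (iterBracket b B (T j)) else 0) l := by
  have hb := hT.isGradedLieBracket
  have iter_mem (A : List (ℤ × L)) (k : ℕ) (hA : ∀ x ∈ A, x.2 ∈ N ⊓ 𝒢 x.1) :
      iterBracket b A (T k) ∈ 𝒢 (1 + totalDegree A) :=
    hb.iterBracket_mem (hT.mem_one k) fun x hx => (hA x hx).2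
  rw [hT.jacobiTerm_eq hl, split_comm _ gradedSign_mul_gradedSign]
  refine split_congr _ fun A B hAB => ?_
  obtain ⟨hA, hB⟩ := List.forall_mem_append.1 fun x hx => hl x (hAB.mem_iff.1 hx)
  split_ifs
  · rw [hb.skew (iter_mem B j hB) (iter_mem A i hA), crossSign_gradedSign, ← Units.neg_smul,
      ← Int.negOnePow_succ, smul_smul, smul_smul, ← Int.negOnePow_add, ← Int.negOnePow_add]
    congr 1
    exact (Int.negOnePow_eq_iff _ _).2 ⟨totalDegree A * totalDegree B + totalDegree B + 1, by ring⟩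
  · exact smul_zero _

theorem iterBracket_bracket_eq_jacobiTerm_add (hl : ∀ x ∈ l, x.2 ∈ N ⊓ 𝒢 x.1) {i j : ℕ}
    (hij : i + j = l.length + 1) :
    iterBracket b l (b (T i) (T j)) = jacobiTerm b T l i j + jacobiTerm b T l j i := by
  rw [hT.isGradedLieBracket.iterBracket_bracket (hT.mem_one i) (hT.mem_one j)
    fun x hx => (hl x hx).2, hT.jacobiTerm_eq hl, hT.jacobiTerm_swap_eq hl, ← split_add]
  refine split_congr _ fun A B hAB => ?_
  obtain ⟨hA, hB⟩ := List.forall_mem_append.1 fun x hx => hl x (hAB.mem_iff.1 hx)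
  have hlength : A.length + B.length = l.length := by rw [← List.length_append, hAB.length_eq]
  rw [one_mul]
  obtain hAi | hAi : i < A.length ∨ A.length ≤ i := lt_or_ge _ _
  · rw [hT.iterBracket_eq_zero hA hAi, map_zero, LinearMap.zero_apply,
      smul_zero, if_neg hAi.ne', if_neg (by omega), add_zero]
  obtain hBj | hBj : j < B.length ∨ B.length ≤ j := lt_or_ge _ _
  · rw [hT.iterBracket_eq_zero hB hBj, map_zero, smul_zero,
      if_neg (by omega), if_neg hBj.ne', add_zero]
  obtain ⟨hAi', hBj'⟩ | ⟨hAi', hBj'⟩ : A.length = i ∧ B.length ≠ j ∨ A.length ≠ i ∧ B.length = j :=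
    by omega
  · rw [if_pos hAi', if_neg hBj', add_zero]
  · rw [if_neg hAi', if_pos hBj', zero_add]

theorem sum_jacobiTerm [Invertible (2 : R)] (hl : ∀ x ∈ l, x.2 ∈ N ⊓ 𝒢 x.1) :
    ∑ k ∈ antidiagonal (l.length + 1), jacobiTerm b T l k.1 k.2 = 0 := by
  have two_mul : (2 : R) • ∑ k ∈ antidiagonal (l.length + 1), jacobiTerm b T l k.1 k.2 =
      0 := by
    rw [two_smul]
    nth_rewrite 2 [← Finset.Nat.sum_antidiagonal_swap]
    rw [← Finset.sum_add_distrib, ← map_zero (iterBracket b l),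
      ← hT.sum_bracket (l.length + 1), map_sum]
    refine Finset.sum_congr rfl fun k hk => ?_
    rw [hT.iterBracket_bracket_eq_jacobiTerm_add hl (mem_antidiagonal.1 hk)]
    rfl
  rw [← invOf_smul_smul (2 : R) (Finset.sum _ _), two_mul, smul_zero]

end IsVoronovData

end Voronov

/-! ### The L-infinity algebra of the higher derived brackets -/

section Decalage

variable {α M : Type*} [AddCommGroup M]

/-- The graded-skew commutation factor of elements of degrees `a + 1, b + 1`, paired with the
shifted degrees `a, b`. -/
def shiftedSign (x y : ℤ × α) : ℤˣ := -((x.1 + 1) * (y.1 + 1)).negOnePow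

/-- The sign of the décalage isomorphism, which shifts all the degrees by one. -/
def decalageSign : List (ℤ × α) → ℤˣ
  | [] => 1
  | x :: l => (l.length * x.1).negOnePow * decalageSign l

theorem passSign_shiftedSign (x : ℤ × α) (A : List (ℤ × α)) : passSign shiftedSign x A =
    (x.1 * totalDegree A + A.length * x.1 + totalDegree A).negOnePow := by
  induction A with
  | nil => simp [passSign, totalDegree]
  | cons y A ih =>
    change shiftedSign x y * passSign shiftedSign x A = _
    rw [ih, shiftedSign, ← Int.negOnePow_succ, ← Int.negOnePow_add, totalDegree_cons,
      List.length_cons, Int.negOnePow_eq_iff]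
    exact ⟨1, by push_cast; ring⟩

theorem decalageSign_swap (l : List (ℤ × α)) (x y : ℤ × α) (l' : List (ℤ × α)) :
    decalageSign (l ++ y :: x :: l') =
      (x.1 + y.1).negOnePow * decalageSign (l ++ x :: y :: l') := by
  induction l with
  | nil =>
    simp only [List.nil_append, decalageSign, ← mul_assoc, ← Int.negOnePow_add, List.length_cons]
    congr 1
    exact (Int.negOnePow_eq_iff _ _).2 ⟨-x.1, by push_cast; ring⟩
  | cons z l ih =>
    simp only [List.cons_append, decalageSign, ih, List.length_append, List.length_cons]
    exact mul_left_comm _ _ _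

theorem split_shiftedSign (Φ : List (ℤ × α) → List (ℤ × α) → M) (l : List (ℤ × α)) :
    split shiftedSign Φ l = decalageSign l • split gradedSign (fun A B =>
      (decalageSign A * decalageSign B * (B.length * totalDegree A).negOnePow) • Φ A B) l := by
  induction l generalizing Φ with
  | nil => simp [split, decalageSign, totalDegree]
  | cons x l ih =>
    simp only [split, ih, ← split_smul, ← split_add]
    refine split_congr _ fun A B hAB => ?_
    have hlength : (l.length : ℤ) = A.length + B.length := by
      rw [← hAB.length_eq, List.length_append, Nat.cast_add]
    have hA : (B.length * totalDegree A).negOnePow = (l.length * x.1).negOnePow *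
        (A.length * x.1).negOnePow * (B.length * (x.1 + totalDegree A)).negOnePow := by
      rw [← Int.negOnePow_add, ← Int.negOnePow_add, hlength, Int.negOnePow_eq_iff]
      exact ⟨-(A.length + B.length) * x.1, by ring⟩
    have hB : (B.length * totalDegree A).negOnePow *
        (x.1 * totalDegree A + A.length * x.1 + totalDegree A).negOnePow =
        (l.length * x.1).negOnePow * (x.1 * totalDegree A).negOnePow *
          (B.length * x.1).negOnePow * ((B.length + 1) * totalDegree A).negOnePow := by
      simp only [← Int.negOnePow_add, hlength]
      exact (Int.negOnePow_eq_iff _ _).2 ⟨-B.length * x.1, by ring⟩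
    simp only [smul_add, smul_smul, passSign_shiftedSign, passSign_gradedSign, decalageSign,
      totalDegree_cons, List.length_cons, Nat.cast_succ]
    congr 2
    · rw [hA]
      ac_rfl
    · rw [mul_assoc, mul_assoc, hB]
      ac_rfl

theorem permSign_shiftedSign {k : ℕ} (d : Fin k → ℤ) (x : Fin k → α) (σ : Equiv.Perm (Fin k)) :
    permSign shiftedSign (fun i => (d i - 1, x i)) σ = koszulSign d σ := by
  simp [koszulSign_eq_permSign, permSign, shiftedSign]

end Decalage

section DerivedBrackets

variable {E L : Type*} [AddCommGroup E] [Module ℂ E] [AddCommGroup L] [Module ℂ L]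

/-- The linear map which is the multiplication by `(-1)^{n-1}` on the elements of degree `n`. -/
noncomputable def shiftedParity {𝒜 : ℤ → Submodule ℂ E} (h𝒜 : DirectSum.IsInternal 𝒜) :
    Module.End ℂ E :=
  DirectSum.toModule ℂ ℤ E (fun n => (n - 1).negOnePow • (𝒜 n).subtype) ∘ₗ
    (LinearEquiv.ofBijective (DirectSum.coeLinearMap 𝒜) h𝒜).symm.toLinearMap

theorem shiftedParity_apply {𝒜 : ℤ → Submodule ℂ E} (h𝒜 : DirectSum.IsInternal 𝒜) {n : ℤ} {x : E}
    (hx : x ∈ 𝒜 n) : shiftedParity h𝒜 x = (n - 1).negOnePow • x := by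
  have symm_apply : (LinearEquiv.ofBijective (DirectSum.coeLinearMap 𝒜) h𝒜).symm x =
      DirectSum.lof ℂ ℤ (fun n => 𝒜 n) n ⟨x, hx⟩ := by
    rw [LinearEquiv.symm_apply_eq]
    exact (DirectSum.coeLinearMap_lof (A := 𝒜) n ⟨x, hx⟩).symm
  rw [shiftedParity, LinearMap.comp_apply, LinearEquiv.coe_coe, symm_apply,
    DirectSum.toModule_lof]
  rfl

/-- The multilinear map `(x₁, …, xₖ) ↦ [⋯[[z, ± x₁], ± x₂], ⋯, ± xₖ]`, where `± xᵢ = s^{k-i} xᵢ`. -/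
noncomputable def multiBracket (b : L →ₗ[ℂ] L →ₗ[ℂ] L) (ι : E →ₗ[ℂ] L) (s : Module.End ℂ E) :
    (k : ℕ) → L →ₗ[ℂ] MultilinearMap ℂ (fun _ : Fin k => E) L
  | 0 => (MultilinearMap.constLinearEquivOfIsEmpty ℂ ℂ _ L).toLinearMap
  | k + 1 => (multilinearCurryLeftEquiv ℂ (fun _ : Fin (k + 1) => E) L).symm.toLinearMap ∘ₗ
      (multiBracket b ι s k).compRight ℂ ∘ₗ b.compl₂ (ι ∘ₗ s ^ k)

theorem multiBracket_succ (b : L →ₗ[ℂ] L →ₗ[ℂ] L) (ι : E →ₗ[ℂ] L) (s : Module.End ℂ E) (k : ℕ)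
    (z : L) (x : Fin (k + 1) → E) : multiBracket b ι s (k + 1) z x =
      multiBracket b ι s k (b z (ι ((s ^ k) (x 0)))) (Fin.tail x) :=
  rfl

variable {b : L →ₗ[ℂ] L →ₗ[ℂ] L} {ι : E →ₗ[ℂ] L} {𝒜 : ℤ → Submodule ℂ E}

/-- The images under `ι` of elements of degrees `d i`, paired with the shifted degrees. -/
def shiftedList (ι : E →ₗ[ℂ] L) {k : ℕ} (d : Fin k → ℤ) (x : Fin k → E) : List (ℤ × L) :=
  List.ofFn fun i => (d i - 1, ι (x i))

theorem length_shiftedList {k : ℕ} (d : Fin k → ℤ) (x : Fin k → E) :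
    (shiftedList ι d x).length = k :=
  List.length_ofFn

theorem shiftedList_cons {k : ℕ} (d : Fin (k + 1) → ℤ) (x : Fin (k + 1) → E) :
    shiftedList ι d x = (d 0 - 1, ι (x 0)) :: shiftedList ι (Fin.tail d) (Fin.tail x) :=
  List.ofFn_succ

theorem totalDegree_shiftedList {k : ℕ} (d : Fin k → ℤ) (x : Fin k → E) :
    totalDegree (shiftedList ι d x) = ∑ i, d i - k := by
  simp [shiftedList, totalDegree, List.map_ofFn, List.sum_ofFn]

theorem multiBracket_of_mem (h𝒜 : DirectSum.IsInternal 𝒜) {k : ℕ} {d : Fin k → ℤ} {x : Fin k → E}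
    (hx : ∀ i, x i ∈ 𝒜 (d i)) (z : L) : multiBracket b ι (shiftedParity h𝒜) k z x =
      decalageSign (shiftedList ι d x) • iterBracket b (shiftedList ι d x) z := by
  induction k generalizing z with
  | zero => exact (one_smul _ _).symm
  | succ k ih =>
    have pow_apply (n : ℕ) : (shiftedParity h𝒜 ^ n) (x 0) = (n * (d 0 - 1)).negOnePow • x 0 := by
      induction n with
      | zero => simp
      | succ n ih =>
        rw [pow_succ', Module.End.mul_apply, ih, Units.smul_def, map_zsmul, ← Units.smul_def,
          shiftedParity_apply h𝒜 (hx 0), smul_smul, ← Int.negOnePow_add, Nat.cast_succ, add_mul,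
          one_mul]
    rw [multiBracket_succ, pow_apply, ih (d := Fin.tail d) (x := Fin.tail x) fun i => hx i.succ,
      shiftedList_cons, iterBracket_cons, decalageSign, length_shiftedList,
      Units.smul_def (Int.negOnePow _), map_zsmul, map_zsmul, map_zsmul, ← Units.smul_def,
      smul_smul, mul_comm]

variable {𝒢 : ℤ → Submodule ℂ L} {T : ℕ → L} (h𝒜 : DirectSum.IsInternal 𝒜)
  (hι : Function.Injective ι) (hmem : ∀ {n x}, x ∈ 𝒜 n ↔ ι x ∈ 𝒢 (n - 1))
  (hT : IsVoronovData 𝒢 b (LinearMap.range ι) T)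

variable (b T) in
/-- The higher derived bracket `(x₁, …, xₖ) ↦ ι⁻¹ [⋯[[T k, ± ι x₁], ± ι x₂], ⋯, ± ι xₖ]`; the signs
are those of the décalage isomorphism, and `ι⁻¹` is any linear left inverse of `ι`. -/
noncomputable def derivedBracket (k : ℕ) : MultilinearMap ℂ (fun _ : Fin k => E) E :=
  (ι.exists_leftInverse_of_injective (LinearMap.ker_eq_bot.2 hι)).choose.compMultilinearMap
    (multiBracket b ι (shiftedParity h𝒜) k (T k))

include hmem in
theorem mem_shiftedList {k : ℕ} {d : Fin k → ℤ} {x : Fin k → E} (hx : ∀ i, x i ∈ 𝒜 (d i)) :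
    ∀ y ∈ shiftedList ι d x, y.2 ∈ LinearMap.range ι ⊓ 𝒢 y.1 := by
  rw [shiftedList, List.forall_mem_ofFn_iff]
  exact fun i => ⟨LinearMap.mem_range_self ι _, hmem.1 (hx i)⟩

include hmem hT in
theorem map_derivedBracket_of_mem {k : ℕ} {d : Fin k → ℤ} {x : Fin k → E}
    (hx : ∀ i, x i ∈ 𝒜 (d i)) : ι (derivedBracket b T h𝒜 hι k x) =
      decalageSign (shiftedList ι d x) • iterBracket b (shiftedList ι d x) (T k) := by
  have iterBracket_mem := hT.closed (mem_shiftedList hmem hx)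
  rw [length_shiftedList] at iterBracket_mem
  obtain ⟨y, hy⟩ := iterBracket_mem
  have left_inverse := ι.exists_leftInverse_of_injective (LinearMap.ker_eq_bot.2 hι)
  rw [derivedBracket, LinearMap.compMultilinearMap_apply, multiBracket_of_mem h𝒜 hx, ← hy,
    Units.smul_def, ← map_zsmul]
  exact congrArg ι (LinearMap.congr_fun left_inverse.choose_spec _)

include hmem hT in
theorem derivedBracket_mem {k : ℕ} {d : Fin k → ℤ} {x : Fin k → E} (hx : ∀ i, x i ∈ 𝒜 (d i)) :
    derivedBracket b T h𝒜 hι k x ∈ 𝒜 ((∑ i, d i) + (2 - (k : ℤ))) := by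
  rw [hmem, map_derivedBracket_of_mem h𝒜 hι hmem hT hx, Units.smul_def]
  refine zsmul_mem ?_ _
  have := hT.isGradedLieBracket.iterBracket_mem (hT.mem_one k)
    fun y hy => (mem_shiftedList hmem hx y hy).2
  convert this using 2
  rw [totalDegree_shiftedList]
  ring

include hmem hT in
theorem derivedBracket_comp_perm {k : ℕ} {d : Fin k → ℤ} {x : Fin k → E}
    (hx : ∀ i, x i ∈ 𝒜 (d i)) (σ : Equiv.Perm (Fin k)) :
    derivedBracket b T h𝒜 hι k (x ∘ σ) = koszulSign d σ • derivedBracket b T h𝒜 hι k x := by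
  refine hι ?_
  rw [Units.smul_def, map_zsmul, ← Units.smul_def, map_derivedBracket_of_mem h𝒜 hι hmem hT hx,
    map_derivedBracket_of_mem h𝒜 hι hmem hT (d := d ∘ σ) (x := x ∘ σ) fun i => hx (σ i),
    ← permSign_shiftedSign d (ι ∘ x)]
  refine apply_ofFn_comp_perm (f := fun l => decalageSign l • iterBracket b l (T k)) shiftedSign
    (w := fun i => (d i - 1, ι (x i))) (fun l y z l' hl => ?_) σ
  have hmem' u (hu : u ∈ l ++ y :: z :: l') := mem_shiftedList hmem hx u (hl.mem_iff.1 hu)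
  simp only [List.forall_mem_append, List.forall_mem_cons] at hmem'
  rw [hT.iterBracket_swap (hT.mem_one k) (fun u hu => (hmem'.1 u hu).2) hmem'.2.1 hmem'.2.2.1,
    decalageSign_swap, smul_smul, smul_smul, mul_right_comm]
  congr 2
  rw [gradedSign, shiftedSign, ← Int.negOnePow_succ, ← Int.negOnePow_add, Int.negOnePow_eq_iff]
  exact ⟨-1, by ring⟩

include hmem hT in
theorem map_derivedBracket_cons_derivedBracket {i m : ℕ} {d : Fin i → ℤ} {e : Fin m → ℤ}
    {x : Fin i → E} {y : Fin m → E} (hx : ∀ j, x j ∈ 𝒜 (d j)) (hy : ∀ j, y j ∈ 𝒜 (e j)) :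
    ι (derivedBracket b T h𝒜 hι (m + 1) (Fin.cons (derivedBracket b T h𝒜 hι i x) y)) =
      ((m : ℤ).negOnePow * (decalageSign (shiftedList ι d x) * decalageSign (shiftedList ι e y) *
        (m * totalDegree (shiftedList ι d x)).negOnePow)) • iterBracket b (shiftedList ι e y)
          (b (T (m + 1)) (iterBracket b (shiftedList ι d x) (T i))) := by
  have hcons (j : Fin (m + 1)) : (Fin.cons (derivedBracket b T h𝒜 hι i x) y : Fin (m + 1) → E) j ∈
      𝒜 ((Fin.cons (∑ i, d i + (2 - i)) e : Fin (m + 1) → ℤ) j) := by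
    cases j using Fin.cases with
    | zero => exact derivedBracket_mem h𝒜 hι hmem hT hx
    | succ j => exact hy j
  rw [map_derivedBracket_of_mem h𝒜 hι hmem hT hcons, shiftedList_cons, Fin.tail_cons, Fin.tail_cons,
    Fin.cons_zero, Fin.cons_zero, map_derivedBracket_of_mem h𝒜 hι hmem hT hx, iterBracket_cons,
    decalageSign, length_shiftedList, Units.smul_def (decalageSign (shiftedList ι d x)), map_zsmul,
    map_zsmul, ← Units.smul_def, ← Units.smul_def, smul_smul, totalDegree_shiftedList]
  congr 1
  have degree_eq : (m : ℤ) * (∑ i, d i + (2 - i) - 1) = m + m * (∑ i, d i - i) := by ring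
  rw [degree_eq, Int.negOnePow_add]
  ac_rfl

include hmem hT in
theorem sum_unshuffles_derivedBracket {n : ℕ} {d : Fin n → ℤ} {x : Fin n → E}
    (hx : ∀ i, x i ∈ 𝒜 (d i)) {i : ℕ} (hi : i ≤ n) :
    ι (∑ σ ∈ unshuffles [i, n - i] n, koszulSign d σ •
        derivedBracket b T h𝒜 hι (n - i + 1) (Fin.cons
          (derivedBracket b T h𝒜 hι i (block (x ∘ σ) 0 i (by omega)))
          (block (x ∘ σ) i (n - i) (by omega)))) =
      ((n - i : ℕ) : ℤ).negOnePow • decalageSign (shiftedList ι d x) •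
        IsVoronovData.jacobiTerm b T (shiftedList ι d x) i (n - i + 1) := by
  let Φ (A B : List (ℤ × L)) : L := ((B.length : ℤ).negOnePow * (decalageSign A * decalageSign B *
    (B.length * totalDegree A).negOnePow)) • iterBracket b B (b (T (n - i + 1))
      (iterBracket b A (T i)))
  have summand_eq (σ : Equiv.Perm (Fin n)) :
      ι (derivedBracket b T h𝒜 hι (n - i + 1) (Fin.cons
        (derivedBracket b T h𝒜 hι i (block (x ∘ σ) 0 i (by omega)))
        (block (x ∘ σ) i (n - i) (by omega)))) =
      Φ ((List.ofFn ((fun j => (d j - 1, ι (x j))) ∘ σ)).take i)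
        ((List.ofFn ((fun j => (d j - 1, ι (x j))) ∘ σ)).drop i) := by
    have hA := ofFn_block ((fun j => (d j - 1, ι (x j))) ∘ σ) 0 i (by omega)
    have hB := ofFn_block ((fun j => (d j - 1, ι (x j))) ∘ σ) i (n - i) (by omega)
    rw [List.drop_zero] at hA
    rw [List.take_of_length_le (by simp)] at hB
    rw [map_derivedBracket_cons_derivedBracket h𝒜 hι hmem hT
      (d := block (d ∘ σ) 0 i (by omega)) (e := block (d ∘ σ) i (n - i) (by omega))
      (x := block (x ∘ σ) 0 i (by omega)) (y := block (x ∘ σ) i (n - i) (by omega))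
      (fun j => hx _) fun j => hx _]
    simp only [Φ, ← hA, ← hB, List.length_ofFn]
    rfl
  simp only [map_sum, Units.smul_def, map_zsmul, summand_eq]
  simp only [← Units.smul_def, ← permSign_shiftedSign d (fun j => ι (x j))]
  rw [sum_unshuffles_pair shiftedSign hi, ← shiftedList, split_shiftedSign, smul_comm]
  refine congrArg _ ((split_congr _ fun A B hAB => ?_).trans (split_smul _ _ _ _))
  have hlength := hAB.length_eq
  rw [List.length_append, length_shiftedList] at hlength
  split_ifs with hA
  · rw [smul_smul, mul_left_comm, Int.units_mul_self, mul_one, ← hlength, hA,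
      Nat.add_sub_cancel_left]
  · rw [smul_zero, smul_zero]

include hmem hT in
theorem sum_derivedBracket_derivedBracket {n : ℕ} {d : Fin n → ℤ} {x : Fin n → E}
    (hx : ∀ i, x i ∈ 𝒜 (d i)) :
    ∑ i : Fin (n + 1), (if (i : ℕ) = 0 then 0 else
      ((-1 : ℤ) ^ (i : ℕ)) • ∑ σ ∈ unshuffles [(i : ℕ), n - i] n, koszulSign d σ •
        derivedBracket b T h𝒜 hι (n - i + 1) (Fin.cons
          (derivedBracket b T h𝒜 hι i (block (x ∘ σ) 0 i (by omega)))
          (block (x ∘ σ) i (n - i) (by omega)))) = 0 := by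
  have sum_eq_zero := hT.sum_jacobiTerm (mem_shiftedList hmem hx)
  rw [length_shiftedList, Finset.Nat.sum_antidiagonal_eq_sum_range_succ
      (IsVoronovData.jacobiTerm b T (shiftedList ι d x)), Finset.sum_range_succ, Nat.sub_self,
    hT.jacobiTerm_zero_right, add_zero, Finset.sum_range] at sum_eq_zero
  refine hι ?_
  rw [map_zero, map_sum,
    ← smul_zero (A := L) ((n : ℤ).negOnePow • decalageSign (shiftedList ι d x)), ← sum_eq_zero,
    Finset.smul_sum]
  refine Finset.sum_congr rfl fun i _ => ?_
  obtain ⟨i, hi⟩ := i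
  rw [Nat.lt_succ_iff] at hi
  simp only
  split_ifs with h
  · rw [map_zero, h, hT.jacobiTerm_zero_left, smul_zero]
  · have sign_eq : (i : ℤ).negOnePow * ((n - i : ℕ) : ℤ).negOnePow = (n : ℤ).negOnePow := by
      rw [← Int.negOnePow_add, Nat.cast_sub hi, add_sub_cancel]
    rw [map_zsmul, sum_unshuffles_derivedBracket h𝒜 hι hmem hT hx hi, ← Int.coe_negOnePow_natCast,
      ← Units.smul_def, smul_smul, sign_eq, smul_assoc, Nat.sub_add_comm hi]

/-- Voronov's L-infinity algebra of higher derived brackets. -/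
noncomputable def derivedLInfty : LInftyStructure 𝒜 where
  isInternal := h𝒜
  l := derivedBracket b T h𝒜 hι
  degree _ _ _ _ := derivedBracket_mem h𝒜 hι hmem hT
  skew _ _ _ _ := derivedBracket_comp_perm h𝒜 hι hmem hT
  jacobi _ _ _ _ := sum_derivedBracket_derivedBracket h𝒜 hι hmem hT

variable {h𝒜 hι} {hmem} {hT} in
theorem map_l_of_eq_derivedLInfty {A : LInftyStructure 𝒜} (hA : A = derivedLInfty h𝒜 hι hmem hT)
    {k : ℕ} {d : Fin k → ℤ} {x : Fin k → E} (hx : ∀ i, x i ∈ 𝒜 (d i)) :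
    ι (A.l k x) = decalageSign (shiftedList ι d x) • iterBracket b (shiftedList ι d x) (T k) := by
  subst hA
  exact map_derivedBracket_of_mem h𝒜 hι hmem hT hx

theorem derivedLInfty_l_eq_zero {k : ℕ} (hk : T k = 0) : (derivedLInfty h𝒜 hι hmem hT).l k = 0 := by
  refine MultilinearMap.ext fun x => ?_
  change derivedBracket b T h𝒜 hι k x = 0
  rw [derivedBracket, hk, map_zero, LinearMap.compMultilinearMap_apply, zero_apply, map_zero]

end DerivedBrackets

/-! ### Operations of a graded vector space -/

section Weights

variable {R W : Type*} [CommRing R] [AddCommGroup W] [Module R W]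

namespace AltOp

/-- The operations that raise the total degree of homogeneous arguments by `w`, for a space `W`
which is graded by the subspaces `𝒲 n`. -/
def weightSpace (𝒲 : ℤ → Submodule R W) (w : ℤ) : Submodule R (AltOp R W) where
  carrier := {P | ∀ l : List (ℤ × W), (∀ x ∈ l, x.2 ∈ 𝒲 x.1) → ∀ d, ∀ y ∈ 𝒲 d,
    P (l.map Prod.snd) y ∈ 𝒲 (totalDegree l + d + w)}
  zero_mem' _ _ _ _ _ := zero_mem _
  add_mem' hP hQ l hl d y hy := add_mem (hP l hl d y hy) (hQ l hl d y hy)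
  smul_mem' k _ hP l hl d y hy := (𝒲 _).smul_mem k (hP l hl d y hy)

variable {𝒲 : ℤ → Submodule R W} {v w : ℤ} {P Q : AltOp R W}

theorem totalSkew_mem_of_mem_weightSpace (hQ : Q ∈ weightSpace 𝒲 w) {l : List (ℤ × W)}
    (hl : ∀ x ∈ l, x.2 ∈ 𝒲 x.1) : Q.totalSkew (l.map Prod.snd) ∈ 𝒲 (totalDegree l + w) := by
  rw [totalSkew, split_map]
  refine split_mem _ fun A B hAB => ?_
  obtain ⟨hA, hB⟩ := List.forall_mem_append.1 fun x hx => hl x (hAB.mem_iff.1 hx)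
  by_cases hlength : B.length = 1
  · obtain ⟨b, rfl⟩ := List.length_eq_one_iff.1 hlength
    rw [← totalDegree_append_of_perm hAB]
    have degree_eq : totalDegree [b] = b.1 := by simp [totalDegree]
    rw [degree_eq]
    exact hQ A hA b.1 b.2 (hB b List.mem_cons_self)
  · rw [listOne_of_length_ne_one (by simpa using hlength), map_zero]
    exact zero_mem _

theorem circ_mem_weightSpace (hP : P ∈ weightSpace 𝒲 v) (hQ : Q ∈ weightSpace 𝒲 w) :
    circ R W P Q ∈ weightSpace 𝒲 (v + w) := by
  intro l hl d y hy
  have apply_circ : circ R W P Q (l.map Prod.snd) y = split skewSign (fun A B =>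
      P (Q.totalSkew A :: B) y + P B (Q A y)) (l.map Prod.snd) :=
    map_split _ (LinearMap.applyₗ (R := R) y) _ _
  rw [apply_circ, split_map]
  refine split_mem _ fun A B hAB => ?_
  obtain ⟨hA, hB⟩ := List.forall_mem_append.1 fun x hx => hl x (hAB.mem_iff.1 hx)
  have degree_eq := totalDegree_append_of_perm hAB
  refine add_mem ?_ ?_
  · have insert_mem := hP ((totalDegree A + w, Q.totalSkew (A.map Prod.snd)) :: B)
      (List.forall_mem_cons.2 ⟨totalSkew_mem_of_mem_weightSpace hQ hA, hB⟩) d y hy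
    rw [totalDegree_cons, List.map_cons] at insert_mem
    convert insert_mem using 2
    rw [← degree_eq]
    ring
  · convert hP B hB _ _ (hQ A hA d y hy) using 2
    rw [← degree_eq]
    ring

theorem oddPart_mem_weightSpace (hP : P ∈ weightSpace 𝒲 w) : oddPart R W P ∈ weightSpace 𝒲 w := by
  intro l hl d y hy
  change (if Odd (l.map Prod.snd).length then P (l.map Prod.snd) else 0) y ∈ _
  split_ifs
  · exact hP l hl d y hy
  · exact zero_mem _

theorem bracket_mem_weightSpace (hP : P ∈ weightSpace 𝒲 v) (hQ : Q ∈ weightSpace 𝒲 w) :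
    bracket R W P Q ∈ weightSpace 𝒲 (v + w) :=
  add_mem (sub_mem (circ_mem_weightSpace hP hQ) (add_comm w v ▸ circ_mem_weightSpace hQ hP))
    ((weightSpace 𝒲 _).smul_mem _ (add_comm w v ▸
      circ_mem_weightSpace (oddPart_mem_weightSpace hQ) (oddPart_mem_weightSpace hP)))

theorem iterBracket_mem_weightSpace {l : List (ℤ × AltOp R W)} (hl : ∀ x ∈ l, x.2 ∈ weightSpace 𝒲 w)
    (hP : P ∈ weightSpace 𝒲 v) :
    iterBracket (bracket R W) l P ∈ weightSpace 𝒲 (v + l.length * w) := by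
  induction l generalizing v P with
  | nil => simpa [iterBracket] using hP
  | cons x l ih =>
    rw [List.forall_mem_cons] at hl
    rw [iterBracket_cons, List.length_cons, Nat.cast_succ, add_mul, one_mul, add_comm (_ * w),
      ← add_assoc]
    exact ih hl.2 (bracket_mem_weightSpace hP hl.1)

end AltOp

end Weights

section ProdGrading

variable {R M₁ M₂ : Type*} [CommRing R] [AddCommGroup M₁] [Module R M₁] [AddCommGroup M₂]
  [Module R M₂]

theorem IsSkewMultilinear.eq_zero_of_span_eq_top {W M : Type*} [AddCommGroup W] [Module R W]
    [AddCommGroup M] [Module R M] {f : List W → M} (hf : IsSkewMultilinear R f) {s : Set W}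
    (hs : Submodule.span R s = ⊤) (h : ∀ l, (∀ x ∈ l, x ∈ s) → f l = 0) (l : List W) : f l = 0 := by
  induction l generalizing f with
  | nil => exact h [] (List.forall_mem_nil _)
  | cons x l ih =>
    have head_eq_zero : (hf.linear l).mk' = 0 := LinearMap.ext_on hs fun y hy =>
      ih (hf.cons y) fun l' hl' => h (y :: l') (List.forall_mem_cons.2 ⟨hy, hl'⟩)
    exact LinearMap.congr_fun head_eq_zero x

variable (R M₁ M₂) in
/-- The grading of `M₁ × M₂` in which `M₁` has degree `1` and `M₂` has degree `0`. -/
def prodGrading (n : ℤ) : Submodule R (M₁ × M₂) where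
  carrier := {x | (n ≠ 1 → x.1 = 0) ∧ (n ≠ 0 → x.2 = 0)}
  zero_mem' := ⟨fun _ => rfl, fun _ => rfl⟩
  add_mem' hx hy := ⟨fun hn => by rw [Prod.fst_add, hx.1 hn, hy.1 hn, add_zero],
    fun hn => by rw [Prod.snd_add, hx.2 hn, hy.2 hn, add_zero]⟩
  smul_mem' k x hx := ⟨fun hn => by rw [Prod.smul_fst, hx.1 hn, smul_zero],
    fun hn => by rw [Prod.smul_snd, hx.2 hn, smul_zero]⟩

theorem eq_zero_of_mem_prodGrading {n : ℤ} (hn : 1 < n) {x : M₁ × M₂}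
    (hx : x ∈ prodGrading R M₁ M₂ n) : x = 0 :=
  Prod.ext (hx.1 (by omega)) (hx.2 (by omega))

namespace AltOp

variable {w : ℤ} {P : AltOp R (M₁ × M₂)}

/-- The reason is that nothing has degree `2` or above, so that an operation of positive weight
vanishes as soon as one of its arguments has degree `1`. -/
theorem eq_zero_of_mem_weightSpace (hw : 0 < w) (hP : P ∈ weightSpace (prodGrading R M₁ M₂) w)
    (h : ∀ (l : List M₂) (y : M₂), P (l.map fun x => (0, x)) (0, y) = 0) : P = 0 := by
  classical
  set s : Set (M₁ × M₂) := LinearMap.range (LinearMap.inl R M₁ M₂) ∪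
    LinearMap.range (LinearMap.inr R M₁ M₂)
  have span_eq_top : Submodule.span R s = ⊤ := by
    rw [Submodule.span_union, Submodule.span_eq, Submodule.span_eq, LinearMap.sup_range_inl_inr]
  let degree (x : M₁ × M₂) : ℤ := if x.1 = 0 then 0 else 1
  have mem_degree {x : M₁ × M₂} (hx : x ∈ s) : x ∈ prodGrading R M₁ M₂ (degree x) := by
    rcases hx with ⟨a, rfl⟩ | ⟨a, rfl⟩ <;> simp [degree, prodGrading]
  have degree_nonneg (x : M₁ × M₂) : 0 ≤ degree x := by
    simp only [degree]
    split_ifs <;> norm_num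
  refine ext fun l => P.isSkewMultilinear.eq_zero_of_span_eq_top span_eq_top (fun l hl => ?_) l
  refine LinearMap.ext_on span_eq_top fun y hy => ?_
  by_cases hzero : ∀ x ∈ y :: l, x.1 = 0
  · rw [List.forall_mem_cons] at hzero
    have l_eq : l = (l.map Prod.snd).map fun x => (0, x) := by
      rw [List.map_map]
      exact (List.map_id l).symm.trans (List.map_congr_left fun x hx => Prod.ext (hzero.2 x hx) rfl)
    rw [l_eq, show y = (0, y.2) from Prod.ext hzero.1 rfl]
    exact h _ _
  · push Not at hzero
    obtain ⟨x, hx, hx₀⟩ := hzero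
    have one_le : 1 ≤ ((y :: l).map degree).sum := by
      rw [show (1 : ℤ) = degree x from (if_neg hx₀).symm]
      exact List.single_le_sum (List.forall_mem_map.2 fun x _ => degree_nonneg x) _
        (List.mem_map_of_mem hx)
    have apply_mem := hP (l.map fun x => (degree x, x))
      (List.forall_mem_map.2 fun x hx => mem_degree (hl x hx)) (degree y) y (mem_degree hy)
    simp only [List.map_map, Function.comp_def, List.map_id', totalDegree] at apply_mem
    rw [List.map_cons, List.sum_cons] at one_le
    exact eq_zero_of_mem_prodGrading (by lia) apply_mem

set_option maxSynthPendingDepth 3 in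
theorem eq_of_mem_weightSpace {Q : AltOp R (M₁ × M₂)} (hw : 0 < w)
    (hP : P ∈ weightSpace (prodGrading R M₁ M₂) w) (hQ : Q ∈ weightSpace (prodGrading R M₁ M₂) w)
    (h : ∀ (l : List M₂) (y : M₂),
      P (l.map fun x => (0, x)) (0, y) = Q (l.map fun x => (0, x)) (0, y)) : P = Q :=
  sub_eq_zero.1 (eq_zero_of_mem_weightSpace hw (sub_mem hP hQ) fun l y => by
    rw [sub_apply, LinearMap.sub_apply, h, sub_self])

end AltOp

end ProdGrading

/-! ### The semidirect product -/

section Bilinear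

variable {R W : Type*} [CommRing R] [AddCommGroup W] [Module R W]

/-- A bilinear map as an operation of degree `1`. -/
def AltOp.ofBilin (B : W →ₗ[R] W →ₗ[R] W) : AltOp R W :=
  ⟨fun l => B (listOne l), isSkewMultilinear_listOne.map B, 2, fun l hl => by
    simp only [listOne_of_length_ne_one (show l.length ≠ 1 by omega), map_zero]⟩

namespace AltOp

theorem ofBilin_singleton (B : W →ₗ[R] W →ₗ[R] W) (x : W) : ofBilin B [x] = B x := rfl

theorem ofBilin_mem_homogeneous (B : W →ₗ[R] W →ₗ[R] W) : ofBilin B ∈ homogeneous R W 1 :=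
  fun l hl => by
    change B (listOne l) = 0
    rw [listOne_of_length_ne_one (by simpa using hl), map_zero]

theorem ofBilin_mem_weightSpace {𝒲 : ℤ → Submodule R W} {w : ℤ} {B : W →ₗ[R] W →ₗ[R] W}
    (hB : ∀ {c d x y}, x ∈ 𝒲 c → y ∈ 𝒲 d → B x y ∈ 𝒲 (c + d + w)) :
    ofBilin B ∈ weightSpace 𝒲 w := by
  rintro l hl d y hy
  by_cases hlength : l.length = 1
  · obtain ⟨x, rfl⟩ := List.length_eq_one_iff.1 hlength
    simpa [totalDegree, ofBilin_singleton] using hB (hl x List.mem_cons_self) hy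
  · rw [ofBilin_mem_homogeneous B _ (by simpa using hlength)]
    exact zero_mem _

theorem circ_ofBilin_pair (B C : W →ₗ[R] W →ₗ[R] W) (x y z : W) :
    circ R W (ofBilin B) (ofBilin C) [x, y] z =
      B (C x y - C y x) z + B y (C x z) - B x (C y z) := by
  simp [circ_apply, split, passSign, skewSign, totalSkew, ofBilin, listOne]
  abel

theorem bracket_ofBilin_eq_zero {B C : W →ₗ[R] W →ₗ[R] W}
    (h : ∀ x y z, B (C x y - C y x) z + B y (C x z) - B x (C y z) +
      (C (B x y - B y x) z + C y (B x z) - C x (B y z)) = 0) :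
    bracket R W (ofBilin B) (ofBilin C) = 0 := by
  have mem_homogeneous := bracket_mem (ofBilin_mem_homogeneous B) (ofBilin_mem_homogeneous C)
  refine ext fun l => ?_
  by_cases hlength : l.length = 2
  · obtain ⟨x, y, rfl⟩ := List.length_eq_two.1 hlength
    refine LinearMap.ext fun z => ?_
    rw [bracket_eq (ofBilin_mem_homogeneous B) (ofBilin_mem_homogeneous C), mul_one,
      Int.negOnePow_one, Units.neg_smul, one_smul, sub_neg_eq_add, add_apply, LinearMap.add_apply,
      circ_ofBilin_pair, circ_ofBilin_pair]
    exact h x y z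
  · exact mem_homogeneous l (by omega)

end AltOp

end Bilinear

section Semidirect

variable {g V : Type*} [LeftPreLieRing g] [LeftPreLieAlgebra ℂ g] [AddCommGroup V] [Module ℂ V]

/-- The product `μ + L + R` of the semidirect product `g ⊕ V`, as a bilinear map. -/
def PreLieRep.product (ρ : PreLieRep g V) : g × V →ₗ[ℂ] g × V →ₗ[ℂ] g × V :=
  LinearMap.mk₂ ℂ (fun x y => (x.1 * y.1, ρ.L x.1 y.2 + ρ.R y.1 x.2))
    (fun x x' y => by ext <;> simp [add_mul]; abel)
    (fun c x y => by ext <;> simp [smul_mul_assoc])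
    (fun x y y' => by ext <;> simp [mul_add]; abel)
    (fun c x y => by ext <;> simp [mul_smul_comm])

theorem PreLieRep.product_apply (ρ : PreLieRep g V) (x y : g × V) :
    ρ.product x y = (x.1 * y.1, ρ.L x.1 y.2 + ρ.R y.1 x.2) := rfl

/-- A bilinear map `g × g → V`, as a product on `g ⊕ V`. -/
def weightProduct (H : g →ₗ[ℂ] g →ₗ[ℂ] V) : g × V →ₗ[ℂ] g × V →ₗ[ℂ] g × V :=
  (H.compl₁₂ (LinearMap.fst ℂ g V) (LinearMap.fst ℂ g V)).compr₂ (LinearMap.inr ℂ g V)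

theorem weightProduct_apply (H : g →ₗ[ℂ] g →ₗ[ℂ] V) (x y : g × V) :
    weightProduct H x y = (0, H x.1 y.1) := rfl

namespace AltOp

theorem bracket_product_product (ρ : PreLieRep g V) :
    bracket ℂ (g × V) (ofBilin ρ.product) (ofBilin ρ.product) = 0 := by
  refine bracket_ofBilin_eq_zero fun x y z => ?_
  suffices ρ.product (ρ.product x y - ρ.product y x) z + ρ.product y (ρ.product x z) -
      ρ.product x (ρ.product y z) = 0 by rw [this, add_zero]
  ext
  · have assoc_symm := LeftPreLieRing.assoc_symm' x.1 y.1 z.1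
    simp only [associator] at assoc_symm
    simp only [PreLieRep.product_apply, Prod.fst_add, Prod.fst_sub, Prod.fst_zero, sub_mul]
    linear_combination (norm := abel) assoc_symm
  · have left_left := ρ.left_left x.1 y.1 z.2
    have left_right_x := ρ.left_right x.1 z.1 y.2
    have left_right_y := ρ.left_right y.1 z.1 x.2
    simp only [PreLieRep.product_apply, Prod.snd_add, Prod.snd_sub, Prod.snd_zero, map_sub,
      map_add, LinearMap.sub_apply]
    linear_combination (norm := module) left_right_y - left_left - left_right_x

theorem bracket_product_weightProduct {ρ : PreLieRep g V} {H : g →ₗ[ℂ] g →ₗ[ℂ] V}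
    (hH : ρ.IsTwoCocycle H) :
    bracket ℂ (g × V) (ofBilin ρ.product) (ofBilin (weightProduct H)) = 0 := by
  refine bracket_ofBilin_eq_zero fun x y z => ?_
  ext
  · simp [PreLieRep.product_apply, weightProduct_apply]
  · have cocycle := hH x.1 y.1 z.1
    simp only [PreLieRep.product_apply, weightProduct_apply, Prod.snd_add, Prod.snd_sub,
      Prod.snd_zero, map_sub, map_zero, LinearMap.sub_apply, LinearMap.zero_apply, zero_add,
      add_zero] at cocycle ⊢
    linear_combination (norm := module) -cocycle

theorem bracket_weightProduct_weightProduct (H : g →ₗ[ℂ] g →ₗ[ℂ] V) :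
    bracket ℂ (g × V) (ofBilin (weightProduct H)) (ofBilin (weightProduct H)) = 0 :=
  bracket_ofBilin_eq_zero fun x y z => by ext <;> simp [weightProduct_apply]

theorem product_mem_weightSpace (ρ : PreLieRep g V) :
    ofBilin ρ.product ∈ weightSpace (prodGrading ℂ g V) (-1) := by
  refine ofBilin_mem_weightSpace fun {c d x y} hx hy => ⟨fun h => ?_, fun h => ?_⟩
  · obtain hc | hd : c ≠ 1 ∨ d ≠ 1 := by omega
    · simp [PreLieRep.product_apply, hx.1 hc]
    · simp [PreLieRep.product_apply, hy.1 hd]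
  · have left : ρ.L x.1 y.2 = 0 := by
      obtain hc | hd : c ≠ 1 ∨ d ≠ 0 := by omega
      · rw [hx.1 hc, map_zero, LinearMap.zero_apply]
      · rw [hy.2 hd, map_zero]
    have right : ρ.R y.1 x.2 = 0 := by
      obtain hc | hd : c ≠ 0 ∨ d ≠ 1 := by omega
      · rw [hx.2 hc, map_zero]
      · rw [hy.1 hd, map_zero, LinearMap.zero_apply]
    rw [PreLieRep.product_apply, left, right, add_zero]

theorem weightProduct_mem_weightSpace (H : g →ₗ[ℂ] g →ₗ[ℂ] V) :
    ofBilin (weightProduct H) ∈ weightSpace (prodGrading ℂ g V) (-2) := by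
  refine ofBilin_mem_weightSpace fun {c d x y} hx hy => ⟨fun _ => rfl, fun h => ?_⟩
  obtain hc | hd : c ≠ 1 ∨ d ≠ 1 := by omega
  · simp [weightProduct_apply, hx.1 hc]
  · simp [weightProduct_apply, hy.1 hd]

end AltOp

end Semidirect

/-! ### Cochains as operations -/

section AlternatingFamilies

variable {R W W' M : Type*} [CommRing R] [AddCommGroup W] [Module R W] [AddCommGroup W']
  [Module R W'] [AddCommGroup M] [Module R M]

theorem get_cons_eq_vecCons {α : Type*} (x : α) (l : List α) :
    (x :: l).get = Matrix.vecCons x l.get :=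
  funext (Fin.cases rfl fun _ => rfl)

theorem isSkewMultilinear_apply_get (F : ∀ m, W [⋀^Fin m]→ₗ[R] M) :
    IsSkewMultilinear R fun l : List W => F l.length l.get where
  swap l x y l' := by
    induction l generalizing F with
    | nil =>
      have get_swap : (x :: y :: l').get ∘ Equiv.swap 0 1 = (y :: x :: l').get := by
        funext i
        refine Fin.cases rfl (fun i => Fin.cases rfl (fun i => ?_) i) i
        rw [Function.comp_apply, Equiv.swap_apply_of_ne_of_ne (by simp) (by simp [Fin.ext_iff])]
        rfl
      have map_swap := (F (l'.length + 2)).map_swap (x :: y :: l').get (i := 0) (j := 1) (by simp)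
      rw [get_swap] at map_swap
      exact (neg_eq_iff_eq_neg.2 map_swap).symm
    | cons z l ih =>
      simp only [List.cons_append, get_cons_eq_vecCons z]
      exact ih fun m => (F (m + 1)).curryLeft z
  linear l :=
    { map_add x y := by
        simp only [get_cons_eq_vecCons]
        exact (F (l.length + 1)).map_vecCons_add l.get x y
      map_smul k x := by
        simp only [get_cons_eq_vecCons]
        exact (F (l.length + 1)).map_vecCons_smul l.get k x }

theorem apply_get_ofFn (F : ∀ m, W [⋀^Fin m]→ₗ[R] M) {m : ℕ} (v : Fin m → W) :
    F (List.ofFn v).length (List.ofFn v).get = F m v := by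
  have apply_cast {n : ℕ} (h : n = m) : F n (v ∘ Fin.cast h) = F m v := by
    subst h
    rfl
  rw [← apply_cast List.length_ofFn]
  congr 1
  funext i
  simp only [List.get_ofFn]
  rfl

theorem ofFn_update {α : Type*} {m : ℕ} (v : Fin m → α) (i : Fin m) (x : α) :
    List.ofFn (Function.update v i x) =
      (List.ofFn v).take i ++ x :: (List.ofFn v).drop (i + 1) := by
  have set_eq := List.set_eq_take_append_cons_drop (l := List.ofFn v) (i := i) (a := x)
  rw [if_pos (by simp)] at set_eq
  rw [← set_eq]
  refine List.ext_getElem (by simp) fun k _ _ => ?_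
  simp [List.getElem_set, Function.update_apply, Fin.ext_iff, eq_comm]

namespace IsSkewMultilinear

variable {f : List W → M} (hf : IsSkewMultilinear R f)
include hf

theorem compLinearMap (φ : W' →ₗ[R] W) : IsSkewMultilinear R fun l => f (l.map φ) where
  swap l x y l' := by
    rw [List.map_append, List.map_cons, List.map_cons, hf.swap, List.map_append, List.map_cons,
      List.map_cons]
  linear l := ((hf.linear (l.map φ)).mk' ∘ₗ φ).isLinear

/-- The restriction of a skew multilinear function to the lists of length `m`. -/
def alternatingMap [Invertible (2 : R)] (m : ℕ) : W [⋀^Fin m]→ₗ[R] M where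
  toFun v := f (List.ofFn v)
  map_update_add' {inst} v i x y := by
    obtain rfl : inst = instDecidableEqFin m := Subsingleton.elim _ _
    simp only [ofFn_update, (hf.linear_append _ _).map_add]
  map_update_smul' {inst} v i k x := by
    obtain rfl : inst = instDecidableEqFin m := Subsingleton.elim _ _
    simp only [ofFn_update, (hf.linear_append _ _).map_smul]
  map_eq_zero_of_eq' v i j hv hij := by
    have comp_swap : v ∘ Equiv.swap i j = v := by
      rw [Equiv.comp_swap_eq_update, hv, Function.update_eq_self, ← hv, Function.update_eq_self]
    have eq_neg := apply_ofFn_comp_perm (c := skewSign) (w := v) (f := f)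
      (fun l x y l' _ => by rw [hf.swap, skewSign, Units.neg_smul, one_smul]) (Equiv.swap i j)
    rw [comp_swap, ← sign_eq_permSign, Equiv.Perm.sign_swap hij, Units.neg_smul, one_smul] at eq_neg
    rw [← invOf_smul_smul (2 : R) (f _), two_smul, eq_neg_iff_add_eq_zero.1 eq_neg, smul_zero]

end IsSkewMultilinear

end AlternatingFamilies

section Cochains

variable {g V : Type*} [LeftPreLieRing g] [LeftPreLieAlgebra ℂ g] [AddCommGroup V] [Module ℂ V]

variable (g V) in
/-- The extension by zero of linear maps `V → g` to endomorphisms of `g ⊕ V`. -/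
def extendByZero : (V →ₗ[ℂ] g) →ₗ[ℂ] Module.End ℂ (g × V) :=
  (LinearMap.inl ℂ g V).compRight ℂ ∘ₗ LinearMap.lcomp ℂ g (LinearMap.snd ℂ g V)

theorem isSkewMultilinear_cochain (x : CochainSpace g V) :
    IsSkewMultilinear ℂ fun l : List V => x l.length l.get :=
  isSkewMultilinear_apply_get fun m => x m

theorem exists_forall_cochain_eq_zero (x : CochainSpace g V) : ∃ n, ∀ m, n ≤ m → x m = 0 := by
  obtain ⟨n, hn⟩ := (DFinsupp.finite_support x).bddAbove
  exact ⟨n + 1, fun m hm => by_contra fun hx => (hn hx).not_gt hm⟩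

variable (g V) in
/-- The extension by zero of cochains to operations on `g ⊕ V`. -/
noncomputable def toAltOp : CochainSpace g V →ₗ[ℂ] AltOp ℂ (g × V) where
  toFun x := ⟨fun l => extendByZero g V (x (l.map Prod.snd).length (l.map Prod.snd).get),
    ((isSkewMultilinear_cochain x).map (extendByZero g V)).compLinearMap (LinearMap.snd ℂ g V), by
      obtain ⟨n, hn⟩ := exists_forall_cochain_eq_zero x
      refine ⟨n, fun l hl => ?_⟩
      beta_reduce
      rw [hn _ (by simpa using hl), AlternatingMap.zero_apply, map_zero]⟩
  map_add' x y := AltOp.ext fun l => map_add (extendByZero g V) _ _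
  map_smul' k x := AltOp.ext fun l => map_smul (extendByZero g V) k _

theorem toAltOp_apply (x : CochainSpace g V) (l : List (g × V)) (y : g × V) : toAltOp g V x l y =
    (x (l.map Prod.snd).length (l.map Prod.snd).get y.2, 0) :=
  rfl

theorem toAltOp_ofFn (x : CochainSpace g V) {m : ℕ} (w : Fin m → g × V) (y : g × V) :
    toAltOp g V x (List.ofFn w) y = (x m (fun i => (w i).2) y.2, 0) := by
  rw [toAltOp_apply, List.map_ofFn]
  exact congrArg (fun φ : V →ₗ[ℂ] g => (φ y.2, (0 : V))) (apply_get_ofFn (fun m => x m) _)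

theorem toAltOp_injective : Function.Injective (toAltOp g V) := by
  refine (injective_iff_map_eq_zero _).2 fun x hx => DFinsupp.ext fun m => ?_
  ext v u
  have apply_eq := toAltOp_ofFn x (fun i => ((0 : g), v i)) (0, u)
  rw [hx] at apply_eq
  exact congrArg Prod.fst apply_eq.symm

theorem mem_cochainGrading_iff {n : ℤ} {x : CochainSpace g V} :
    x ∈ cochainGrading g V n ↔ toAltOp g V x ∈ AltOp.homogeneous ℂ (g × V) (n - 1) := by
  refine ⟨fun hx l hl => ?_, fun hx m hm => ?_⟩
  · change extendByZero g V (x _ _) = 0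
    rw [hx _ (by rw [List.length_map]; omega), AlternatingMap.zero_apply, map_zero]
  · ext v u
    have apply_eq := toAltOp_ofFn x (fun i => ((0 : g), v i)) (0, u)
    rw [hx _ (by rw [List.length_ofFn]; omega)] at apply_eq
    exact congrArg Prod.fst apply_eq.symm

theorem toAltOp_mem_weightSpace (x : CochainSpace g V) :
    toAltOp g V x ∈ AltOp.weightSpace (prodGrading ℂ g V) 1 := by
  refine fun l hl d y hy => ⟨fun hdegree => ?_, fun _ => rfl⟩
  rw [toAltOp_apply]
  by_cases hd : d = 0
  · obtain ⟨z, hz, hz₀⟩ : ∃ z ∈ l, z.1 ≠ 0 := by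
      by_contra! h
      refine hdegree ?_
      rw [totalDegree, List.sum_eq_zero (List.forall_mem_map.2 h), hd, zero_add, zero_add]
    obtain ⟨i, hi⟩ := List.get_of_mem (List.mem_map_of_mem (f := Prod.snd)
      (List.mem_map_of_mem (f := Prod.snd) hz))
    rw [(x _).map_coord_zero i (hi.trans ((hl z hz).2 hz₀)), LinearMap.zero_apply]
  · rw [hy.2 hd, map_zero]

theorem exists_cochain_apply_eq_fst (P : AltOp ℂ (g × V)) : ∃ x : CochainSpace g V,
    ∀ (l : List V) (y : V), x l.length l.get y = (P (l.map fun x => (0, x)) (0, y)).1 := by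
  let φ : Module.End ℂ (g × V) →ₗ[ℂ] V →ₗ[ℂ] g := (LinearMap.fst ℂ g V).compRight ℂ ∘ₗ
    LinearMap.lcomp ℂ (g × V) (LinearMap.inr ℂ g V)
  have hφ := (P.isSkewMultilinear.map φ).compLinearMap (LinearMap.inr ℂ g V)
  obtain ⟨n, hn⟩ := P.2.2
  refine ⟨DirectSum.mk (Cochain g V) (Finset.range n) fun m => hφ.alternatingMap m, fun l y => ?_⟩
  by_cases hl : l.length ∈ Finset.range n
  · rw [DirectSum.mk_apply_of_mem hl]
    change φ (P ((List.ofFn l.get).map _)) y = _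
    rw [List.ofFn_get]
    rfl
  · rw [DirectSum.mk_apply_of_notMem hl, hn _ (by simpa using hl)]
    rfl

theorem range_toAltOp :
    LinearMap.range (toAltOp g V) = AltOp.weightSpace (prodGrading ℂ g V) 1 := by
  refine le_antisymm (by rintro _ ⟨x, rfl⟩; exact toAltOp_mem_weightSpace x) fun P hP => ?_
  obtain ⟨x, hx⟩ := exists_cochain_apply_eq_fst P
  refine ⟨x, AltOp.eq_of_mem_weightSpace one_pos (toAltOp_mem_weightSpace x) hP fun l y => ?_⟩
  have snd_eq_zero := (hP (l.map fun x => (0, (0, x))) (by simp [prodGrading]) 0 (0, y)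
    (by simp [prodGrading])).2 (by simp [totalDegree, Function.comp_def])
  rw [List.map_map] at snd_eq_zero
  rw [toAltOp_apply, List.map_map]
  refine Prod.ext ?_ snd_eq_zero.symm
  simp only [hx, Function.comp_def, List.map_id']

theorem toSpace_mem_cochainGrading {m : ℕ} (P : Cochain g V m) :
    P.toSpace ∈ cochainGrading g V (m + 1) :=
  fun n hn => DirectSum.of_eq_of_ne _ _ _ (by omega)

theorem coeAddMonoidHom_cochainGrading_apply (x : ⨁ d, cochainGrading g V d) (m : ℕ) :
    DirectSum.coeAddMonoidHom (cochainGrading g V) x m = (x (m + 1) : CochainSpace g V) m := by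
  induction x using DirectSum.induction_on with
  | zero => simp only [map_zero, DirectSum.zero_apply, ZeroMemClass.coe_zero]
  | of d y =>
    rw [DirectSum.coeAddMonoidHom_of]
    by_cases h : (m : ℤ) + 1 = d
    · subst h
      rw [DirectSum.of_eq_same]
    · rw [DirectSum.of_eq_of_ne _ _ _ h, y.2 m h]
      rfl
  | add x y hx hy => simp only [map_add, DirectSum.add_apply, hx, hy, Submodule.coe_add]

theorem isInternal_cochainGrading : DirectSum.IsInternal (cochainGrading g V) := by
  refine ⟨fun x y h => DFinsupp.ext fun d => Subtype.ext (DFinsupp.ext fun m => ?_), fun x => ?_⟩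
  · by_cases hd : (m : ℤ) + 1 = d
    · subst hd
      rw [← coeAddMonoidHom_cochainGrading_apply, h, coeAddMonoidHom_cochainGrading_apply]
    · rw [(x d).2 m hd, (y d).2 m hd]
  · induction x using DirectSum.induction_on with
    | zero => exact ⟨0, map_zero _⟩
    | of m P =>
      exact ⟨DirectSum.of (fun d => cochainGrading g V d) (m + 1)
        ⟨P.toSpace, toSpace_mem_cochainGrading P⟩, DirectSum.coeAddMonoidHom_of _ _ _⟩
    | add x y hx hy =>
      obtain ⟨⟨x', rfl⟩, ⟨y', rfl⟩⟩ := And.intro hx hy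
      exact ⟨x' + y', map_add _ _ _⟩

end Cochains

/-! ### The Voronov data of a cocycle -/

section ReynoldsData

variable {g V : Type*} [LeftPreLieRing g] [LeftPreLieAlgebra ℂ g] [AddCommGroup V] [Module ℂ V]

open AltOp Finset.HasAntidiagonal

theorem AltOp.eq_zero_of_one_lt_weight {R M₁ M₂ : Type*} [CommRing R] [AddCommGroup M₁]
    [Module R M₁] [AddCommGroup M₂] [Module R M₂] {w : ℤ} {P : AltOp R (M₁ × M₂)} (hw : 1 < w)
    (hP : P ∈ weightSpace (prodGrading R M₁ M₂) w) : P = 0 := by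
  refine eq_zero_of_mem_weightSpace (by omega) hP fun l y => ?_
  have apply_mem := hP (l.map fun x => (0, (0, x))) (by simp [prodGrading]) 0 (0, y)
    (by simp [prodGrading])
  rw [List.map_map] at apply_mem
  exact eq_zero_of_mem_prodGrading (by simpa [totalDegree, Function.comp_def] using hw) apply_mem

/-- The Maurer-Cartan element `(μ + L + R) + H` of the graded Lie algebra of operations on `g ⊕ V`,
with each component at the number of cochains it is bracketed with. -/
def PreLieRep.twist (ρ : PreLieRep g V) (H : g →ₗ[ℂ] g →ₗ[ℂ] V) : ℕ → AltOp ℂ (g × V)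
  | 2 => ofBilin ρ.product
  | 3 => ofBilin (weightProduct H)
  | _ => 0

theorem PreLieRep.twist_eq_zero (ρ : PreLieRep g V) (H : g →ₗ[ℂ] g →ₗ[ℂ] V) :
    ∀ {k : ℕ}, 4 ≤ k → ρ.twist H k = 0
  | _ + 4, _ => rfl

theorem bracket_eq_zero_of_mem_range_toAltOp {P Q : AltOp ℂ (g × V)}
    (hP : P ∈ LinearMap.range (toAltOp g V)) (hQ : Q ∈ LinearMap.range (toAltOp g V)) :
    bracket ℂ (g × V) P Q = 0 := by
  rw [range_toAltOp] at hP hQ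
  exact eq_zero_of_one_lt_weight one_lt_two (bracket_mem_weightSpace hP hQ)

variable (ρ : PreLieRep g V) {H : g →ₗ[ℂ] g →ₗ[ℂ] V}

theorem PreLieRep.twist_mem_homogeneous (H : g →ₗ[ℂ] g →ₗ[ℂ] V) (k : ℕ) :
    ρ.twist H k ∈ homogeneous ℂ (g × V) 1 := by
  unfold PreLieRep.twist
  split
  · exact ofBilin_mem_homogeneous _
  · exact ofBilin_mem_homogeneous _
  · exact zero_mem _

theorem PreLieRep.sum_bracket_twist (hH : ρ.IsTwoCocycle H) (n : ℕ) :
    ∑ k ∈ antidiagonal n, bracket ℂ (g × V) (ρ.twist H k.1) (ρ.twist H k.2) = 0 := by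
  refine Finset.sum_eq_zero fun k _ => ?_
  have product_product := bracket_product_product ρ
  have product_weight := bracket_product_weightProduct hH
  have weight_product := bracket_eq_zero_symm (ofBilin_mem_homogeneous ρ.product)
    (ofBilin_mem_homogeneous (weightProduct H)) product_weight
  have weight_weight := bracket_weightProduct_weightProduct H
  have zero_left (P : AltOp ℂ (g × V)) : bracket ℂ (g × V) 0 P = 0 := LinearMap.map_zero₂ _ _
  have zero_right (P : AltOp ℂ (g × V)) : bracket ℂ (g × V) P 0 = 0 := map_zero _
  unfold PreLieRep.twist
  split <;> split <;> simp only [product_product, product_weight, weight_product, weight_weight,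
    zero_left, zero_right]

theorem PreLieRep.iterBracket_twist_mem {l : List (ℤ × AltOp ℂ (g × V))}
    (hl : ∀ x ∈ l, x.2 ∈ LinearMap.range (toAltOp g V)) :
    iterBracket (bracket ℂ (g × V)) l (ρ.twist H l.length) ∈ LinearMap.range (toAltOp g V) := by
  rw [range_toAltOp] at hl ⊢
  by_cases h₂ : l.length = 2
  · have mem_weightSpace := iterBracket_mem_weightSpace hl (product_mem_weightSpace ρ)
    rw [h₂] at mem_weightSpace ⊢
    exact mem_weightSpace
  by_cases h₃ : l.length = 3
  · have mem_weightSpace := iterBracket_mem_weightSpace hl (weightProduct_mem_weightSpace H)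
    rw [h₃] at mem_weightSpace ⊢
    exact mem_weightSpace
  · rw [PreLieRep.twist.eq_3 _ _ _ h₂ h₃, map_zero]
    exact zero_mem _

theorem PreLieRep.isVoronovData_twist (hH : ρ.IsTwoCocycle H) :
    IsVoronovData (homogeneous ℂ (g × V)) (bracket ℂ (g × V)) (LinearMap.range (toAltOp g V))
      (ρ.twist H) where
  isGradedLieBracket := ⟨bracket_mem, bracket_comm, bracket_bracket⟩
  abelian := bracket_eq_zero_of_mem_range_toAltOp
  mem_one := ρ.twist_mem_homogeneous H
  zero := rfl
  sum_bracket := ρ.sum_bracket_twist hH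
  closed hl := ρ.iterBracket_twist_mem fun x hx => (hl x hx).1

end ReynoldsData

/-! ### Two operations inserted in a bilinear map -/

section Pairing

variable {R W : Type*} [CommRing R] [AddCommGroup W] [Module R W]

namespace AltOp

/-- The operation obtained by inserting `Q` in the first and `S` in the last argument of the
bilinear map `B`. -/
def pairing (B : W →ₗ[R] W →ₗ[R] W) (Q S : AltOp R W) : AltOp R W :=
  ⟨split skewSign fun A C => B (Q.totalSkew A) * S C,
    .split (fun C => Q.isSkewMultilinear_totalSkew.map (LinearMap.mulRight R (S C) ∘ₗ B))
      fun A => S.isSkewMultilinear.map (LinearMap.mulLeft R (B (Q.totalSkew A))), by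
    obtain ⟨m, hm⟩ := Q.2.2
    obtain ⟨n, hn⟩ := S.2.2
    refine ⟨m + n + 1, fun l hl => split_eq_zero _ fun A C hAC => ?_⟩
    have length_eq : A.length + C.length = l.length := by
      rw [← hAC.length_eq, List.length_append]
    by_cases hA : m + 1 ≤ A.length
    · rw [totalSkew_eq_zero fun D hD => hm D (by omega), map_zero, zero_mul]
    · rw [hn C (by omega), mul_zero]⟩

variable {B : W →ₗ[R] W →ₗ[R] W} {P Q S : AltOp R W}

theorem pairing_apply (l : List W) :
    pairing B Q S l = split skewSign (fun A C => B (Q.totalSkew A) * S C) l :=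
  rfl

theorem totalSkew_pairing (l : List W) : (pairing B Q S).totalSkew l =
    split skewSign (fun A C => B (Q.totalSkew A) (S.totalSkew C)) l := by
  have apply_listOne (E D : List W) : pairing B Q S E (listOne D) =
      split skewSign (fun A C => B (Q.totalSkew A) (S C (listOne D))) E :=
    map_split _ (LinearMap.applyₗ (R := R) (listOne D)) _ E
  rw [totalSkew]
  simp only [apply_listOne]
  rw [← split_assoc]
  exact split_congr _ fun A C _ => (map_split _ (B (Q.totalSkew A)) _ C).symm

theorem ofBilin_cons_cons (B : W →ₗ[R] W →ₗ[R] W) (x y : W) (l : List W) :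
    ofBilin B (x :: y :: l) = 0 :=
  map_zero B

theorem circ_circ_ofBilin {q r : ℤ} (hQ : Q ∈ homogeneous R W q) (hS : S ∈ homogeneous R W r) :
    circ R W (circ R W (ofBilin B) Q) S = circ R W (ofBilin B) (circ R W Q S) +
      q.negOnePow • pairing B S Q + ((q + 1) * r).negOnePow • pairing B Q S := by
  refine ext fun l => ?_
  rw [circ_circ_apply, add_assoc]
  refine congrArg _ ?_
  have circTwo_eq (A C : List W) :
      split skewSign (fun C D => (C.length : ℤ).negOnePow •
          (ofBilin B (S.totalSkew A :: D) * Q C -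
            ofBilin B (S.totalSkew A :: Q.totalSkew C :: D)) +
        ofBilin B (Q.totalSkew C :: D) * S A) C =
      (C.length : ℤ).negOnePow • (B (S.totalSkew A) * Q C) + B (Q.totalSkew C) * S A := by
    rw [split_eq_apply_nil, ofBilin_cons_cons, sub_zero, ofBilin_singleton, ofBilin_singleton]
    rintro C (_ | ⟨d, D⟩) hD
    · exact absurd rfl hD
    · simp only [ofBilin_cons_cons, zero_mul, sub_zero, smul_zero, add_zero]
  rw [circTwo]
  simp only [circTwo_eq]
  rw [split_add, add_apply, units_smul_apply, units_smul_apply, pairing_apply, pairing_apply,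
    ← split_smul, split_comm _ skewSign_mul_skewSign fun A C => B (Q.totalSkew C) * S A,
    ← split_smul]
  congr 1 <;> refine split_congr _ fun A C _ => ?_
  · obtain hC | hC := eq_zero_or_length_eq hQ C
    · simp only [hC, mul_zero, smul_zero]
    · rw [hC]
  · obtain hA | hA := totalSkew_eq_zero_or_length_eq hQ A
    · simp only [hA, map_zero, zero_mul, smul_zero]
    obtain hC | hC := eq_zero_or_length_eq hS C
    · simp only [hC, mul_zero, smul_zero]
    rw [crossSign_skewSign, hA, hC]

end AltOp

end Pairing

section Null

variable {R W : Type*} [CommRing R] [AddCommGroup W] [Module R W]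

namespace AltOp

local notation:72 P:72 " ⋄ " Q:73 => circ _ _ P Q

variable {𝒞 : Submodule R (AltOp R W)} {t p q r : ℤ} {P Q S T : AltOp R W}

theorem circ_circ_of_mem (h𝒞 : ∀ P ∈ 𝒞, ∀ Q ∈ 𝒞, P ⋄ Q = 0 ∧ ∀ X, P ⋄ (Q ⋄ X) = 0)
    (hP : P ∈ 𝒞) (hQ : Q ∈ 𝒞) (hQ' : Q ∈ homogeneous R W q) (hT : T ∈ homogeneous R W t) :
    P ⋄ T ⋄ Q = P ⋄ (T ⋄ Q) := by
  have preLie := circ_circ_sub_comm (P := P) hQ' hT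
  rwa [(h𝒞 P hP Q hQ).1, (h𝒞 P hP Q hQ).2, LinearMap.map_zero₂, sub_zero, smul_zero,
    sub_eq_zero] at preLie

theorem bracket_bracket_of_mem (h𝒞 : ∀ P ∈ 𝒞, ∀ Q ∈ 𝒞, P ⋄ Q = 0 ∧ ∀ X, P ⋄ (Q ⋄ X) = 0)
    (hP : P ∈ 𝒞) (hQ : Q ∈ 𝒞) (hP' : P ∈ homogeneous R W p) (hQ' : Q ∈ homogeneous R W q)
    (hT : T ∈ homogeneous R W t) :
    bracket R W (bracket R W T P) Q = T ⋄ P ⋄ Q - (t * p).negOnePow • (P ⋄ (T ⋄ Q)) -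
      ((t + p) * q).negOnePow • (Q ⋄ (T ⋄ P)) := by
  rw [bracket_eq (bracket_mem hT hP') hQ', bracket_eq hT hP']
  simp only [Units.smul_def, map_sub, LinearMap.sub_apply, map_zsmul, LinearMap.smul_apply]
  rw [circ_circ_of_mem h𝒞 hP hQ hQ' hT, (h𝒞 Q hQ P hP).2, smul_zero, sub_zero]

theorem bracket_bracket_bracket_of_mem
    (h𝒞 : ∀ P ∈ 𝒞, ∀ Q ∈ 𝒞, P ⋄ Q = 0 ∧ ∀ X, P ⋄ (Q ⋄ X) = 0)
    (hP : P ∈ 𝒞) (hQ : Q ∈ 𝒞) (hS : S ∈ 𝒞) (hP' : P ∈ homogeneous R W p)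
    (hQ' : Q ∈ homogeneous R W q) (hS' : S ∈ homogeneous R W r) (hT : T ∈ homogeneous R W t)
    (hzero : T ⋄ P ⋄ Q ⋄ S = 0) :
    bracket R W (bracket R W (bracket R W T P) Q) S =
      -((t * p).negOnePow • (P ⋄ (T ⋄ Q ⋄ S)) + ((t + p) * q).negOnePow • (Q ⋄ (T ⋄ P ⋄ S)) +
        ((t + p + q) * r).negOnePow • (S ⋄ (T ⋄ P ⋄ Q))) := by
  rw [bracket_eq (bracket_mem (bracket_mem hT hP') hQ') hS',
    bracket_bracket_of_mem h𝒞 hP hQ hP' hQ' hT]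
  simp only [Units.smul_def, map_sub, LinearMap.sub_apply, map_zsmul, LinearMap.smul_apply]
  rw [circ_circ_of_mem h𝒞 hP hS hS' (circ_mem hT hQ'),
    circ_circ_of_mem h𝒞 hQ hS hS' (circ_mem hT hP'), (h𝒞 S hS P hP).2, (h𝒞 S hS Q hQ).2, hzero]
  simp only [smul_zero, sub_zero]
  abel

theorem circ_circ_circ_ofBilin (h𝒞 : ∀ P ∈ 𝒞, ∀ Q ∈ 𝒞, P ⋄ Q = 0 ∧ ∀ X, P ⋄ (Q ⋄ X) = 0)
    (hQ : Q ∈ 𝒞) (hS : S ∈ 𝒞) (hQ' : Q ∈ homogeneous R W q) (hS' : S ∈ homogeneous R W r)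
    (B : W →ₗ[R] W →ₗ[R] W) : P ⋄ (ofBilin B ⋄ Q ⋄ S) =
      q.negOnePow • (P ⋄ pairing B S Q) + ((q + 1) * r).negOnePow • (P ⋄ pairing B Q S) := by
  rw [circ_circ_ofBilin hQ' hS', (h𝒞 Q hQ S hS).1, map_zero, zero_add]
  simp only [Units.smul_def, map_add, map_zsmul]

/-- The operations with values in `N`. -/
def valuedIn (N : Submodule R W) : Submodule R (AltOp R W) where
  carrier := {P | ∀ l y, P l y ∈ N}
  zero_mem' _ _ := zero_mem _
  add_mem' hP hQ l y := add_mem (hP l y) (hQ l y)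
  smul_mem' k _ hP l y := N.smul_mem k (hP l y)

theorem circ_mem_valuedIn {N : Submodule R W} (hP : P ∈ valuedIn N) (Q : AltOp R W) :
    P ⋄ Q ∈ valuedIn N := fun l y => by
  have apply_circ : (P ⋄ Q) l y = split skewSign (fun A B => P (Q.totalSkew A :: B) y +
      P B (Q A y)) l := map_split _ (LinearMap.applyₗ (R := R) y) _ _
  rw [apply_circ]
  exact split_mem _ fun A B _ => add_mem (hP _ _) (hP _ _)

theorem totalSkew_mem_of_mem_valuedIn {N : Submodule R W} (hP : P ∈ valuedIn N) (l : List W) :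
    P.totalSkew l ∈ N :=
  split_mem _ fun _ _ _ => hP _ _

end AltOp

end Null

section CochainProducts

variable {g V : Type*} [LeftPreLieRing g] [LeftPreLieAlgebra ℂ g] [AddCommGroup V] [Module ℂ V]

open AltOp

theorem toAltOp_mem_valuedIn (x : CochainSpace g V) :
    toAltOp g V x ∈ valuedIn (LinearMap.ker (LinearMap.snd ℂ g V)) :=
  fun _ _ => rfl

theorem circ_toAltOp_eq_zero (x : CochainSpace g V) {X : AltOp ℂ (g × V)}
    (hX : X ∈ valuedIn (LinearMap.ker (LinearMap.snd ℂ g V))) :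
    circ ℂ (g × V) (toAltOp g V x) X = 0 := by
  refine AltOp.ext fun l => split_eq_zero _ fun A B _ => LinearMap.ext fun y => ?_
  have skew_eq : (X.totalSkew A).2 = 0 := totalSkew_mem_of_mem_valuedIn hX A
  have last_eq : (X A y).2 = 0 := hX A y
  rw [LinearMap.add_apply, Module.End.mul_apply, toAltOp_apply, toAltOp_apply, last_eq, map_zero,
    List.map_cons, skew_eq, (isSkewMultilinear_cochain x).cons_zero]
  exact add_zero _

theorem circ_eq_zero_of_mem_range_toAltOp : ∀ P ∈ LinearMap.range (toAltOp g V),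
    ∀ Q ∈ LinearMap.range (toAltOp g V), circ ℂ (g × V) P Q = 0 ∧
      ∀ X, circ ℂ (g × V) P (circ ℂ (g × V) Q X) = 0 := by
  rintro _ ⟨x, rfl⟩ _ ⟨y, rfl⟩
  exact ⟨circ_toAltOp_eq_zero x (toAltOp_mem_valuedIn y),
    fun X => circ_toAltOp_eq_zero x (circ_mem_valuedIn (toAltOp_mem_valuedIn y) X)⟩

theorem ofBilin_weightProduct_mem_valuedIn (H : g →ₗ[ℂ] g →ₗ[ℂ] V) :
    ofBilin (weightProduct H) ∈ valuedIn (LinearMap.ker (LinearMap.fst ℂ g V)) :=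
  fun _ _ => rfl

theorem circ_circ_circ_weightProduct_eq_zero (H : g →ₗ[ℂ] g →ₗ[ℂ] V) (x y z : CochainSpace g V) :
    circ ℂ (g × V) (circ ℂ (g × V) (circ ℂ (g × V) (ofBilin (weightProduct H)) (toAltOp g V x))
      (toAltOp g V y)) (toAltOp g V z) = 0 := by
  have mem_weightSpace := circ_mem_weightSpace (circ_mem_weightSpace (circ_mem_weightSpace
    (weightProduct_mem_weightSpace H) (toAltOp_mem_weightSpace x)) (toAltOp_mem_weightSpace y))
    (toAltOp_mem_weightSpace z)
  have mem_valuedIn := circ_mem_valuedIn (circ_mem_valuedIn (circ_mem_valuedIn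
    (ofBilin_weightProduct_mem_valuedIn H) (toAltOp g V x)) (toAltOp g V y)) (toAltOp g V z)
  norm_num only [← range_toAltOp] at mem_weightSpace
  obtain ⟨w, hw⟩ := mem_weightSpace
  rw [← hw] at mem_valuedIn ⊢
  exact AltOp.ext fun l => LinearMap.ext fun v => Prod.ext (mem_valuedIn l v) rfl

end CochainProducts

/-! ### The explicit brackets -/

section PairingBlocks

variable {R W : Type*} [CommRing R] [AddCommGroup W] [Module R W] {p q r : ℕ}
  {P Q S : AltOp R W}

namespace AltOp

theorem splitBlocks_totalSkew_pairing (hP : P ∈ homogeneous R W (p + 1))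
    (hQ : Q ∈ homogeneous R W q) (hS : S ∈ homogeneous R W r) (B : W →ₗ[R] W →ₗ[R] W) (y : W)
    (l : List W) :
    splitBlocks skewSign [q, 1, r, 1, p] (fun l => P (B (Q (l.take q) (listOne ((l.drop q).take 1)))
        (S (((l.drop q).drop 1).take r) (listOne ((((l.drop q).drop 1).drop r).take 1))) ::
          (((l.drop q).drop 1).drop r).drop 1) y) l =
      split skewSign (fun A D => P ((pairing B Q S).totalSkew A :: D) y) l := by
  let φ (D : List W) : W →ₗ[R] W := LinearMap.applyₗ y ∘ₗ (P.linear_head D).mk'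
  have last_block (w : W) (D : List W) :
      splitBlocks skewSign [p] (fun D => P (w :: D) y) D = P (w :: D) y :=
    splitBlocks_singleton_of_support _ (fun D hD => by
      rw [hP (w :: D) (by simpa using hD), LinearMap.zero_apply]) D
  refine (splitBlocks_totalSkew hQ [r, 1, p] (Φ := fun w l => P (B w (S (l.take r)
    (listOne ((l.drop r).take 1))) :: (l.drop r).drop 1) y)
    (fun w w' l => map_add (φ _ ∘ₗ B.flip _) w w') l).trans ?_
  have second_block (A l : List W) := splitBlocks_totalSkew hS [p]
    (Φ := fun w D => P (B (Q.totalSkew A) w :: D) y)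
    (fun w w' D => map_add (φ D ∘ₗ B (Q.totalSkew A)) w w') l
  simp only [second_block, last_block]
  rw [split_assoc]
  refine split_congr _ fun A D _ => ?_
  rw [totalSkew_pairing]
  exact (map_split _ (φ D) _ A).symm

theorem splitBlocks_pairing (hP : P ∈ homogeneous R W p)
    (hQ : Q ∈ homogeneous R W q) (hS : S ∈ homogeneous R W r) (B : W →ₗ[R] W →ₗ[R] W) (y : W)
    (l : List W) :
    splitBlocks skewSign [p, q, 1, r] (fun l => P (l.take p)
        (B (Q ((l.drop p).take q) (listOne (((l.drop p).drop q).take 1)))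
          (S (((l.drop p).drop q).drop 1) y))) l =
      split skewSign (fun A D => P A (pairing B Q S D y)) l := by
  have last_block (A D : List W) (w : W) :
      splitBlocks skewSign [r] (fun D => P A (B w (S D y))) D = P A (B w (S D y)) :=
    splitBlocks_singleton_of_support _ (fun D hD => by
      rw [hS D (by simpa using hD), LinearMap.zero_apply, map_zero, map_zero]) D
  rw [splitBlocks_cons_of_support (Φ := fun A l => P A (B (Q (l.take q)
    (listOne ((l.drop q).take 1))) (S ((l.drop q).drop 1) y))) _ _ fun A l hA => by
      rw [hP A (by simpa using hA), LinearMap.zero_apply]]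
  refine split_congr _ fun A D _ => ?_
  refine (splitBlocks_totalSkew hQ [r] (Φ := fun w l => P A (B w (S l y)))
    (fun w w' l => map_add (P A ∘ₗ B.flip _) w w') D).trans ?_
  simp only [last_block]
  exact (map_split _ (P A ∘ₗ LinearMap.applyₗ (R := R) y)
    (fun E F => B (Q.totalSkew E) * S F) D).symm

end AltOp

end PairingBlocks

section Insert

variable {g V : Type*} [LeftPreLieRing g] [LeftPreLieAlgebra ℂ g] [AddCommGroup V] [Module ℂ V]
variable {a b c : ℕ}

open AltOp

theorem represents_toAltOp (P : Cochain g V a) : Represents (toAltOp g V P.toSpace) P.lift := by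
  intro x y
  rw [toAltOp_ofFn, Cochain.toSpace, DirectSum.lof_eq_of, DirectSum.of_eq_same]
  rfl

theorem toAltOp_toSpace_mem_homogeneous (P : Cochain g V a) :
    toAltOp g V P.toSpace ∈ homogeneous ℂ (g × V) a := by
  simpa using mem_cochainGrading_iff.1 (toSpace_mem_cochainGrading P)

theorem insertSkew_eq_split (H : g →ₗ[ℂ] g →ₗ[ℂ] V) (P : Cochain g V a) (Q : Cochain g V b)
    (S : Cochain g V c) (x : Fin (a + b + c + 1) → g × V) (y : g × V) :
    (insertSkew H P Q S (fun i => (x i).2) y.2, 0) =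
      split skewSign (fun A D => toAltOp g V P.toSpace ((pairing (weightProduct H)
        (toAltOp g V Q.toSpace) (toAltOp g V S.toSpace)).totalSkew A :: D) y) (List.ofFn x) := by
  have hP := toAltOp_toSpace_mem_homogeneous P
  rcases a with _ | a
  · refine (split_eq_zero _ fun A B _ => ?_).symm
    rw [hP _ (by simp; omega), LinearMap.zero_apply]
  rw [← splitBlocks_totalSkew_pairing (p := a) (mod_cast hP) (toAltOp_toSpace_mem_homogeneous Q)
    (toAltOp_toSpace_mem_homogeneous S), ← sum_unshuffles_sign (by simp; omega), insertSkew]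
  refine (map_sum (LinearMap.inl ℂ g V) _ _).trans (Finset.sum_congr rfl fun σ _ => ?_)
  have lift_eq : LinearMap.inl ℂ g V (P (Fin.cons
        (H (Q (block ((fun i => (x i).2) ∘ σ) 0 b (by omega)) (x (σ ⟨b, by omega⟩)).2)
          (S (block ((fun i => (x i).2) ∘ σ) (b + 1) c (by omega))
            (x (σ ⟨b + 1 + c, by omega⟩)).2))
        (block ((fun i => (x i).2) ∘ σ) (b + 1 + c + 1) a (by omega))) y.2) =
      P.lift (Fin.cons (weightProduct H (Q.lift (block (x ∘ σ) 0 b (by omega))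
          ((x ∘ σ) ⟨b, by omega⟩))
        (S.lift (block (x ∘ σ) (b + 1) c (by omega)) ((x ∘ σ) ⟨b + 1 + c, by omega⟩)))
        (block (x ∘ σ) (b + 1 + c + 1) a (by omega))) y :=
    congrArg (fun u : Fin (a + 1) → V => ((P u y.2, 0) : g × V))
      (funext (Fin.cases rfl fun _ => rfl))
  rw [Units.smul_def, map_zsmul, Units.smul_def, lift_eq, represents_toAltOp, represents_toAltOp,
    represents_toAltOp, List.ofFn_cons]
  simp only [listOne_ofFn (x ∘ σ), ofFn_block, List.drop_drop, List.drop_zero,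
    List.take_of_length_le (show
      ((List.ofFn (x ∘ σ)).drop (b + 1 + c + 1)).length ≤ a by simp; omega)]

theorem insertLast_eq_split (H : g →ₗ[ℂ] g →ₗ[ℂ] V) (P : Cochain g V a) (Q : Cochain g V b)
    (S : Cochain g V c) (x : Fin (a + b + c + 1) → g × V) (y : g × V) :
    (insertLast H P Q S (fun i => (x i).2) y.2, 0) =
      split skewSign (fun A D => toAltOp g V P.toSpace A (pairing (weightProduct H)
        (toAltOp g V Q.toSpace) (toAltOp g V S.toSpace) D y)) (List.ofFn x) := by
  rw [← splitBlocks_pairing (toAltOp_toSpace_mem_homogeneous P) (toAltOp_toSpace_mem_homogeneous Q)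
    (toAltOp_toSpace_mem_homogeneous S), ← sum_unshuffles_sign (by simp; omega), insertLast]
  refine (map_sum (LinearMap.inl ℂ g V) _ _).trans (Finset.sum_congr rfl fun σ _ => ?_)
  have lift_eq : LinearMap.inl ℂ g V (P (block ((fun i => (x i).2) ∘ σ) 0 a (by omega))
        (H (Q (block ((fun i => (x i).2) ∘ σ) a b (by omega)) (x (σ ⟨a + b, by omega⟩)).2)
          (S (block ((fun i => (x i).2) ∘ σ) (a + b + 1) c (by omega)) y.2))) =
      P.lift (block (x ∘ σ) 0 a (by omega)) (weightProduct H
        (Q.lift (block (x ∘ σ) a b (by omega)) ((x ∘ σ) ⟨a + b, by omega⟩))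
        (S.lift (block (x ∘ σ) (a + b + 1) c (by omega)) y)) := rfl
  rw [Units.smul_def, map_zsmul, Units.smul_def, lift_eq, represents_toAltOp, represents_toAltOp,
    represents_toAltOp]
  simp only [listOne_ofFn (x ∘ σ), ofFn_block, List.drop_drop, List.drop_zero,
    List.take_of_length_le (show ((List.ofFn (x ∘ σ)).drop (a + b + 1)).length ≤ c by simp)]

theorem circ_pairing_apply_ofFn (H : g →ₗ[ℂ] g →ₗ[ℂ] V) (P : Cochain g V a) (Q : Cochain g V b)
    (S : Cochain g V c) (x : Fin (a + b + c + 1) → g × V) (y : g × V) :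
    circ ℂ (g × V) (toAltOp g V P.toSpace) (pairing (weightProduct H) (toAltOp g V Q.toSpace)
        (toAltOp g V S.toSpace)) (List.ofFn x) y =
      (insertSkew H P Q S (fun i => (x i).2) y.2 +
        (a * (b + c + 1) : ℤ).negOnePow • insertLast H P Q S (fun i => (x i).2) y.2, 0) := by
  have hP := toAltOp_toSpace_mem_homogeneous P
  have pair_eq (u v : g) (e : ℤˣ) : (u + e • v, (0 : V)) = (u, 0) + e • (v, 0) := by
    rw [Prod.smul_mk, smul_zero, Prod.mk_add_mk, add_zero]
  rw [pair_eq, insertSkew_eq_split, insertLast_eq_split, split_comm _ skewSign_mul_skewSign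
    fun A D => toAltOp g V P.toSpace A _, ← split_smul, ← split_add]
  refine (map_split _ (LinearMap.applyₗ (R := ℂ) y) _ _).trans (split_congr _ fun A D hAD => ?_)
  rw [LinearMap.applyₗ_apply_apply, LinearMap.add_apply, Module.End.mul_apply]
  refine congrArg _ ?_
  obtain hD | hD := eq_zero_or_length_eq hP D
  · rw [hD, LinearMap.zero_apply, smul_zero, smul_zero]
  have length_A : A.length = (b + c + 1 : ℤ) := by
    have := hAD.length_eq
    simp only [List.length_ofFn, List.length_append] at this
    omega
  rw [crossSign_skewSign, hD, length_A, smul_smul, mul_comm (a : ℤ), ← Int.negOnePow_add,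
    Int.negOnePow_even _ ⟨_, rfl⟩, one_smul]

end Insert

section ReynoldsLInfty

variable {g V : Type*} [LeftPreLieRing g] [LeftPreLieAlgebra ℂ g] [AddCommGroup V] [Module ℂ V]
variable {H : g →ₗ[ℂ] g →ₗ[ℂ] V} {a b c : ℕ}

open AltOp

namespace PreLieRep

variable (ρ : PreLieRep g V) (hH : ρ.IsTwoCocycle H)

/-- The L-infinity algebra controlling the relative cocycle weighted Reynolds operators, as the
higher derived brackets of the product of `g ⊕ V` and of the cocycle. -/
noncomputable def reynoldsLInfty : LInftyStructure (E := CochainSpace g V) (cochainGrading g V) :=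
  derivedLInfty (L := AltOp ℂ (g × V)) (T := ρ.twist H) isInternal_cochainGrading
    toAltOp_injective mem_cochainGrading_iff (ρ.isVoronovData_twist hH)

theorem reynoldsLInfty_l_eq_zero {k : ℕ} (hk : ρ.twist H k = 0) :
    (ρ.reynoldsLInfty hH).l k = 0 :=
  derivedLInfty_l_eq_zero _ _ _ _ hk

theorem toAltOp_reynoldsLInfty_of_mem {k : ℕ} {d : Fin k → ℤ} {x : Fin k → CochainSpace g V}
    (hx : ∀ i, x i ∈ cochainGrading g V (d i)) : toAltOp g V ((ρ.reynoldsLInfty hH).l k x) =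
      decalageSign (shiftedList (L := AltOp ℂ (g × V)) (toAltOp g V) d x) •
        iterBracket (bracket ℂ (g × V)) (shiftedList (toAltOp g V) d x) (ρ.twist H k) :=
  map_l_of_eq_derivedLInfty (A := ρ.reynoldsLInfty hH) rfl hx

theorem toAltOp_reynoldsLInfty_two (P : Cochain g V a) (Q : Cochain g V b) :
    toAltOp g V ((ρ.reynoldsLInfty hH).l 2 ![P.toSpace, Q.toSpace]) =
      (a : ℤ).negOnePow • bracket ℂ (g × V) (bracket ℂ (g × V) (ofBilin ρ.product)
        (toAltOp g V P.toSpace)) (toAltOp g V Q.toSpace) := by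
  have hx (i : Fin 2) : ![P.toSpace, Q.toSpace] i ∈
      cochainGrading g V (![(a : ℤ) + 1, b + 1] i) := by
    fin_cases i
    exacts [toSpace_mem_cochainGrading P, toSpace_mem_cochainGrading Q]
  rw [ρ.toAltOp_reynoldsLInfty_of_mem hH hx]
  simp [shiftedList, decalageSign, iterBracket, twist]

theorem toAltOp_reynoldsLInfty_three (P : Cochain g V a) (Q : Cochain g V b) (S : Cochain g V c) :
    toAltOp g V ((ρ.reynoldsLInfty hH).l 3 ![P.toSpace, Q.toSpace, S.toSpace]) =
      (b : ℤ).negOnePow • bracket ℂ (g × V) (bracket ℂ (g × V) (bracket ℂ (g × V)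
        (ofBilin (weightProduct H)) (toAltOp g V P.toSpace)) (toAltOp g V Q.toSpace))
          (toAltOp g V S.toSpace) := by
  have hx (i : Fin 3) : ![P.toSpace, Q.toSpace, S.toSpace] i ∈
      cochainGrading g V (![(a : ℤ) + 1, b + 1, c + 1] i) := by
    fin_cases i
    exacts [toSpace_mem_cochainGrading P, toSpace_mem_cochainGrading Q,
      toSpace_mem_cochainGrading S]
  rw [ρ.toAltOp_reynoldsLInfty_of_mem hH hx]
  simp [shiftedList, decalageSign, iterBracket, twist]

theorem lift_reynoldsLInfty_two (P : Cochain g V a) (Q : Cochain g V b) :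
    Cochain.lift (((ρ.reynoldsLInfty hH).l 2 ![P.toSpace, Q.toSpace]) (1 + a + b)) =
      (-1 : ℤ) ^ a • mnBracket (mnBracket ρ.semidirect P.lift) Q.lift := by
  have product_mem := ofBilin_mem_homogeneous (R := ℂ) ρ.product
  have hP := toAltOp_toSpace_mem_homogeneous P
  have represents := represents_mnBracket (p := 1 + a) (by
    exact_mod_cast bracket_mem product_mem hP) (toAltOp_toSpace_mem_homogeneous Q)
    (represents_mnBracket (p := 1) (F := ρ.semidirect) product_mem hP (fun _ _ => rfl)
      (represents_toAltOp P)) (represents_toAltOp Q)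
  funext x y
  rw [Cochain.lift, ← toAltOp_ofFn, toAltOp_reynoldsLInfty_two, ← Int.coe_negOnePow_natCast,
    units_smul_apply, Pi.smul_apply, Pi.smul_apply, represents x y]
  rfl

end PreLieRep

end ReynoldsLInfty

section Ternary

variable {g V : Type*} [LeftPreLieRing g] [LeftPreLieAlgebra ℂ g] [AddCommGroup V] [Module ℂ V]
variable {a b c : ℕ}

open AltOp

local notation:72 P:72 " ⋄ " Q:73 => circ _ _ P Q

theorem circ_circ_circ_weightProduct (H : g →ₗ[ℂ] g →ₗ[ℂ] V) (P : Cochain g V a)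
    (Q : Cochain g V b) (S : Cochain g V c) :
    toAltOp g V P.toSpace ⋄ (ofBilin (weightProduct H) ⋄ toAltOp g V Q.toSpace ⋄
        toAltOp g V S.toSpace) =
      (b : ℤ).negOnePow • (toAltOp g V P.toSpace ⋄
        pairing (weightProduct H) (toAltOp g V S.toSpace) (toAltOp g V Q.toSpace)) +
      ((b + 1) * c : ℤ).negOnePow • (toAltOp g V P.toSpace ⋄
        pairing (weightProduct H) (toAltOp g V Q.toSpace) (toAltOp g V S.toSpace)) :=
  circ_circ_circ_ofBilin circ_eq_zero_of_mem_range_toAltOp ⟨_, rfl⟩ ⟨_, rfl⟩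
    (toAltOp_toSpace_mem_homogeneous Q) (toAltOp_toSpace_mem_homogeneous S) _

theorem bracket_bracket_bracket_weightProduct (H : g →ₗ[ℂ] g →ₗ[ℂ] V) (P : Cochain g V a)
    (Q : Cochain g V b) (S : Cochain g V c) :
    bracket ℂ (g × V) (bracket ℂ (g × V) (bracket ℂ (g × V) (ofBilin (weightProduct H))
        (toAltOp g V P.toSpace)) (toAltOp g V Q.toSpace)) (toAltOp g V S.toSpace) =
      -((1 * a : ℤ).negOnePow • (toAltOp g V P.toSpace ⋄ (ofBilin (weightProduct H) ⋄
          toAltOp g V Q.toSpace ⋄ toAltOp g V S.toSpace)) +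
        ((1 + a) * b : ℤ).negOnePow • (toAltOp g V Q.toSpace ⋄ (ofBilin (weightProduct H) ⋄
          toAltOp g V P.toSpace ⋄ toAltOp g V S.toSpace)) +
        ((1 + a + b) * c : ℤ).negOnePow • (toAltOp g V S.toSpace ⋄ (ofBilin (weightProduct H) ⋄
          toAltOp g V P.toSpace ⋄ toAltOp g V Q.toSpace))) :=
  bracket_bracket_bracket_of_mem circ_eq_zero_of_mem_range_toAltOp ⟨_, rfl⟩ ⟨_, rfl⟩ ⟨_, rfl⟩
    (toAltOp_toSpace_mem_homogeneous P) (toAltOp_toSpace_mem_homogeneous Q)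
    (toAltOp_toSpace_mem_homogeneous S) (ofBilin_mem_homogeneous _)
    (circ_circ_circ_weightProduct_eq_zero H _ _ _)

theorem ternaryBracket_eq (H : g →ₗ[ℂ] g →ₗ[ℂ] V) (P : Cochain g V a) (Q : Cochain g V b)
    (S : Cochain g V c) (u : Fin (a + b + c + 1) → V) (v : V) :
    ternaryBracket H P Q S u v = -((b : ℤ).negOnePow •
      ((1 * a : ℤ).negOnePow •
        ((b : ℤ).negOnePow • (insertSkew H P S Q (u ∘ Fin.cast (by omega)) v +
            (a * (c + b + 1) : ℤ).negOnePow • insertLast H P S Q (u ∘ Fin.cast (by omega)) v) +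
          ((b + 1) * c : ℤ).negOnePow • (insertSkew H P Q S u v +
            (a * (b + c + 1) : ℤ).negOnePow • insertLast H P Q S u v)) +
      ((1 + a) * b : ℤ).negOnePow •
        ((a : ℤ).negOnePow • (insertSkew H Q S P (u ∘ Fin.cast (by omega)) v +
            (b * (c + a + 1) : ℤ).negOnePow • insertLast H Q S P (u ∘ Fin.cast (by omega)) v) +
          ((a + 1) * c : ℤ).negOnePow • (insertSkew H Q P S (u ∘ Fin.cast (by omega)) v +
            (b * (a + c + 1) : ℤ).negOnePow • insertLast H Q P S (u ∘ Fin.cast (by omega)) v)) +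
      ((1 + a + b) * c : ℤ).negOnePow •
        ((a : ℤ).negOnePow • (insertSkew H S Q P (u ∘ Fin.cast (by omega)) v +
            (c * (b + a + 1) : ℤ).negOnePow • insertLast H S Q P (u ∘ Fin.cast (by omega)) v) +
          ((a + 1) * b : ℤ).negOnePow • (insertSkew H S P Q (u ∘ Fin.cast (by omega)) v +
            (c * (a + b + 1) : ℤ).negOnePow •
              insertLast H S P Q (u ∘ Fin.cast (by omega)) v)))) := by
  norm_cast
  simp only [ternaryBracket, Units.smul_def, Int.coe_negOnePow_natCast]
  obtain ha | ha := neg_one_pow_eq_or ℤ a <;> obtain hb | hb := neg_one_pow_eq_or ℤ b <;>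
    obtain hc | hc := neg_one_pow_eq_or ℤ c <;>
    simp only [pow_add, pow_mul, ha, hb, hc, one_pow, pow_one, mul_neg, one_mul, mul_one,
      neg_neg, neg_smul, one_smul] <;> abel

theorem fst_bracket_bracket_bracket_weightProduct_apply (H : g →ₗ[ℂ] g →ₗ[ℂ] V) (P : Cochain g V a)
    (Q : Cochain g V b) (S : Cochain g V c) (x : Fin (a + b + c + 1) → g × V) (y : g × V) :
    (((b : ℤ).negOnePow • bracket ℂ (g × V) (bracket ℂ (g × V) (bracket ℂ (g × V)
        (ofBilin (weightProduct H)) (toAltOp g V P.toSpace)) (toAltOp g V Q.toSpace))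
        (toAltOp g V S.toSpace)) (List.ofFn x) y).1 =
      ternaryBracket H P Q S (fun i => (x i).2) y.2 := by
  let φ : AltOp ℂ (g × V) →ₗ[ℂ] g := LinearMap.fst ℂ g V ∘ₗ LinearMap.applyₗ (R := ℂ) y ∘ₗ
    LinearMap.proj (List.ofFn x) ∘ₗ Submodule.subtype _
  have hPQS := congrArg Prod.fst (circ_pairing_apply_ofFn H P Q S x y)
  have hPSQ := congrArg Prod.fst (circ_pairing_apply_ofFn H P S Q (x ∘ Fin.cast (by omega)) y)
  have hQPS := congrArg Prod.fst (circ_pairing_apply_ofFn H Q P S (x ∘ Fin.cast (by omega)) y)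
  have hQSP := congrArg Prod.fst (circ_pairing_apply_ofFn H Q S P (x ∘ Fin.cast (by omega)) y)
  have hSPQ := congrArg Prod.fst (circ_pairing_apply_ofFn H S P Q (x ∘ Fin.cast (by omega)) y)
  have hSQP := congrArg Prod.fst (circ_pairing_apply_ofFn H S Q P (x ∘ Fin.cast (by omega)) y)
  rw [ofFn_comp_cast] at hPSQ hQPS hQSP hSPQ hSQP
  rw [bracket_bracket_bracket_weightProduct, ternaryBracket_eq]
  have φ_apply (X : AltOp ℂ (g × V)) : (X (List.ofFn x) y).1 = φ X := rfl
  simp only [φ_apply] at hPQS hPSQ hQPS hQSP hSPQ hSQP ⊢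
  have φ_smul (ε : ℤˣ) (X : AltOp ℂ (g × V)) : φ (ε • X) = ε • φ X := rfl
  have φ_neg (X : AltOp ℂ (g × V)) : φ (-X) = -φ X := rfl
  simp only [circ_circ_circ_weightProduct, φ_smul, φ_neg, φ.map_add, hPQS, hPSQ,
    hQPS, hQSP, hSPQ, hSQP, smul_neg, Function.comp_def]

end Ternary

section MaurerCartan

theorem LInftyStructure.isMaurerCartan_iff {E : Type*} [AddCommGroup E] [Module ℂ E]
    {𝒜 : ℤ → Submodule ℂ E} (A : LInftyStructure 𝒜) (h₁ : A.l 1 = 0)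
    (h₄ : ∀ k, 4 ≤ k → A.l k = 0) (α : E) : A.IsMaurerCartan α ↔
      α ∈ 𝒜 1 ∧ (2 : ℂ)⁻¹ • A.l 2 ![α, α] + (6 : ℂ)⁻¹ • A.l 3 ![α, α, α] = 0 := by
  have sum_three : ∑ k ∈ Finset.Icc 1 3, ((Nat.factorial k : ℂ)⁻¹) • A.l k (fun _ => α) =
      (2 : ℂ)⁻¹ • A.l 2 ![α, α] + (6 : ℂ)⁻¹ • A.l 3 ![α, α, α] := by
    have pair_eq : ![α, α] = fun _ => α := List.ofFn_inj.1 rfl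
    have triple_eq : ![α, α, α] = fun _ => α := List.ofFn_inj.1 rfl
    rw [triple_eq, pair_eq, show Finset.Icc 1 3 = {1, 2, 3} from rfl]
    simp [h₁, Nat.factorial]
  have l_eq_zero (k : ℕ) (hk : 3 < k) : A.l k (fun _ => α) = 0 := by rw [h₄ k hk]; rfl
  refine and_congr_right fun _ => ⟨?_, fun h => ⟨3, l_eq_zero, sum_three.trans h⟩⟩
  rintro ⟨N, hN, h⟩
  rw [← sum_three, ← h,
    Finset.sum_subset (Finset.Icc_subset_Icc_right (le_max_left 3 N)) fun k _ hk => ?_,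
    Finset.sum_subset (Finset.Icc_subset_Icc_right (le_max_right 3 N)) fun k _ hk => ?_]
  · rw [hN k (by simp_all), smul_zero]
  · rw [l_eq_zero k (by simp_all), smul_zero]

variable {g V : Type*} [LeftPreLieRing g] [LeftPreLieAlgebra ℂ g] [AddCommGroup V] [Module ℂ V]

theorem unshuffles_one (b : List ℕ) : unshuffles b 1 = {1} := by
  ext σ
  simp [unshuffles, IsUnshuffle, Subsingleton.elim σ 1]

theorem ternaryBracket_constOfIsEmpty (H : g →ₗ[ℂ] g →ₗ[ℂ] V) (K : V →ₗ[ℂ] g) (u : Fin 1 → V)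
    (v : V) :
    ternaryBracket H (.constOfIsEmpty ℂ V (Fin 0) K) (.constOfIsEmpty ℂ V (Fin 0) K)
        (.constOfIsEmpty ℂ V (Fin 0) K) u v =
      (-6 : ℂ) • K (H (K (u 0)) (K v)) := by
  simp [ternaryBracket, insertSkew, insertLast, unshuffles_one]
  module

theorem mnBracket_one_zero {W : Type*} [AddCommGroup W] (P : Operation W 1) (Q : Operation W 0)
    (x : Fin 1 → W) (y : W) :
    mnBracket P Q x y = P ![Q ![] (x 0)] y + P x (Q ![] y) - Q ![] (P x y) := by
  have block_one : block x 0 1 (by omega) = x := funext fun i => congrArg x (Subsingleton.elim _ _)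
  have cons_empty (z : W) (w : Fin 0 → W) : (Fin.cons z w : Fin 1 → W) = ![z] := by
    rw [Subsingleton.elim w ![]]; rfl
  simp [mnBracket, diamond, diamondSkew, diamondLast, unshuffles_one, block_one, cons_empty,
    Matrix.empty_eq]

theorem mnBracket_mnBracket_semidirect_constOfIsEmpty (ρ : PreLieRep g V) (K : V →ₗ[ℂ] g)
    (u : Fin 1 → V) (v : V) :
    (mnBracket (mnBracket ρ.semidirect (Cochain.lift (.constOfIsEmpty ℂ V (Fin 0) K)))
        (Cochain.lift (.constOfIsEmpty ℂ V (Fin 0) K)) (fun i => (0, u i)) (0, v)).1 =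
      (2 : ℂ) • (K (u 0) * K v - K (ρ.L (K (u 0)) v + ρ.R (K v) (u 0))) := by
  have inner (x : Fin 1 → g × V) (y : g × V) := mnBracket_one_zero ρ.semidirect
    (Cochain.lift (.constOfIsEmpty ℂ V (Fin 0) K)) x y
  refine (congrArg Prod.fst (mnBracket_one_zero _ _ _ _)).trans ?_
  simp [inner, PreLieRep.semidirect, Cochain.lift]
  module

theorem eq_zero_iff_of_mem_cochainGrading {m : ℕ} {z : CochainSpace g V}
    (hz : z ∈ cochainGrading g V (m + 1)) : z = 0 ↔ z m = 0 := by
  refine ⟨fun h => by rw [h]; rfl, fun h => DFinsupp.ext fun k => ?_⟩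
  obtain rfl | hk := eq_or_ne k m
  · exact h
  · exact hz k (by omega)

namespace PreLieRep

variable {H : g →ₗ[ℂ] g →ₗ[ℂ] V} (ρ : PreLieRep g V) (hH : ρ.IsTwoCocycle H)

theorem reynoldsLInfty_three_apply {a b c : ℕ} (P : Cochain g V a) (Q : Cochain g V b)
    (S : Cochain g V c) (u : Fin (a + b + c + 1) → V) (v : V) :
    ((ρ.reynoldsLInfty hH).l 3 ![P.toSpace, Q.toSpace, S.toSpace]) (a + b + c + 1) u v =
      ternaryBracket H P Q S u v := by
  have := congrArg Prod.fst (toAltOp_ofFn ((ρ.reynoldsLInfty hH).l 3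
    ![P.toSpace, Q.toSpace, S.toSpace]) (fun i => ((0 : g), u i)) (0, v))
  rw [toAltOp_reynoldsLInfty_three, fst_bracket_bracket_bracket_weightProduct_apply] at this
  exact this.symm

theorem reynoldsLInfty_two_linearCochain_apply (K : V →ₗ[ℂ] g) (u : Fin 1 → V) (v : V) :
    ((ρ.reynoldsLInfty hH).l 2 ![linearCochain K, linearCochain K]) 1 u v =
      (2 : ℂ) • (K (u 0) * K v - K (ρ.L (K (u 0)) v + ρ.R (K v) (u 0))) := by
  have := congrArg (fun F => (F (fun i => ((0 : g), u i)) (0, v)).1) (ρ.lift_reynoldsLInfty_two hH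
    (.constOfIsEmpty ℂ V (Fin 0) K) (.constOfIsEmpty ℂ V (Fin 0) K))
  rw [pow_zero, one_smul] at this
  exact this.trans (mnBracket_mnBracket_semidirect_constOfIsEmpty ρ K u v)

theorem reynoldsLInfty_three_linearCochain_apply (K : V →ₗ[ℂ] g) (u : Fin 1 → V) (v : V) :
    ((ρ.reynoldsLInfty hH).l 3 ![linearCochain K, linearCochain K, linearCochain K]) 1 u v =
      (-6 : ℂ) • K (H (K (u 0)) (K v)) := by
  rw [← ternaryBracket_constOfIsEmpty]
  exact ρ.reynoldsLInfty_three_apply hH (a := 0) (b := 0) (c := 0) _ _ _ u v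

theorem maurerCartan_linearCochain_apply (K : V →ₗ[ℂ] g) (u : Fin 1 → V) (v : V) :
    ((2 : ℂ)⁻¹ • (ρ.reynoldsLInfty hH).l 2 ![linearCochain K, linearCochain K] +
        (6 : ℂ)⁻¹ • (ρ.reynoldsLInfty hH).l 3
          ![linearCochain K, linearCochain K, linearCochain K]) 1 u v =
      K (u 0) * K v - K (ρ.L (K (u 0)) v + ρ.R (K v) (u 0) + H (K (u 0)) (K v)) := by
  simp only [DirectSum.add_apply, DirectSum.smul_apply, AlternatingMap.add_apply,
    AlternatingMap.smul_apply, LinearMap.add_apply, LinearMap.smul_apply,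
    reynoldsLInfty_two_linearCochain_apply, reynoldsLInfty_three_linearCochain_apply, map_add]
  module

theorem isReynolds_iff_isMaurerCartan (K : V →ₗ[ℂ] g) :
    ρ.IsReynolds H K ↔ (ρ.reynoldsLInfty hH).IsMaurerCartan (linearCochain K) := by
  have hK : linearCochain K ∈ cochainGrading g V 1 := toSpace_mem_cochainGrading _
  have maurerCartan_apply := ρ.maurerCartan_linearCochain_apply hH K
  rw [LInftyStructure.isMaurerCartan_iff _ (ρ.reynoldsLInfty_l_eq_zero hH rfl)
    (fun k hk => ρ.reynoldsLInfty_l_eq_zero hH (ρ.twist_eq_zero H hk)), and_iff_right hK]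
  generalize ρ.reynoldsLInfty hH = A at *
  have h₂ := A.degree 2 (by simp) (fun _ => 1) ![linearCochain K, linearCochain K]
    (by simp [Fin.forall_fin_two, hK])
  have h₃ := A.degree 3 (by simp) (fun _ => 1)
    ![linearCochain K, linearCochain K, linearCochain K] (by simp [Fin.forall_fin_succ, hK])
  rw [eq_zero_iff_of_mem_cochainGrading (m := 1)
    (add_mem (Submodule.smul_mem _ _ h₂) (Submodule.smul_mem _ _ h₃))]
  refine ⟨fun h => ?_, fun h u v => ?_⟩
  · ext u v
    rw [maurerCartan_apply, h (u 0) v, sub_self]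
    rfl
  · refine sub_eq_zero.1 ((maurerCartan_apply (fun _ => u) v).symm.trans ?_)
    rw [h]
    rfl

end PreLieRep

end MaurerCartan

/-- The graded space `⨁ₙ Hom (∧^{n-1} V ⊗ V, g)` carries an L-infinity algebra structure with
`l 1 = 0`, with `l 2` the derived bracket `(-1)^{p-1} [[μ + L + R, P], Q]` (here `p = a + 1`), with
`l 3` the ternary bracket given by `H`, and with `l k = 0` for `k ≥ 4`; a linear map `K : V → g` is
a relative cocycle weighted Reynolds operator iff it is a Maurer-Cartan element. -/
theorem mainTheorem1 (g V : Type*) [LeftPreLieRing g] [LeftPreLieAlgebra ℂ g]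
    [AddCommGroup V] [Module ℂ V] (ρ : PreLieRep g V) (H : g →ₗ[ℂ] g →ₗ[ℂ] V)
    (hH : ρ.IsTwoCocycle H) :
    ∃ A : LInftyStructure (cochainGrading g V),
      A.l 1 = 0 ∧
      (∀ (a b : ℕ) (P : Cochain g V a) (Q : Cochain g V b),
        Cochain.lift ((A.l 2 ![P.toSpace, Q.toSpace]) (1 + a + b)) =
          ((-1 : ℤ) ^ a) • mnBracket (mnBracket ρ.semidirect P.lift) Q.lift) ∧
      (∀ (a b c : ℕ) (P : Cochain g V a) (Q : Cochain g V b) (R : Cochain g V c)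
          (u : Fin (a + b + c + 1) → V) (v : V),
        (A.l 3 ![P.toSpace, Q.toSpace, R.toSpace]) (a + b + c + 1) u v =
          ternaryBracket H P Q R u v) ∧
      (∀ k : ℕ, 4 ≤ k → A.l k = 0) ∧
      (∀ K : V →ₗ[ℂ] g, ρ.IsReynolds H K ↔ A.IsMaurerCartan (linearCochain K)) := by
  refine ⟨ρ.reynoldsLInfty hH, ρ.reynoldsLInfty_l_eq_zero hH rfl,
    fun _ _ => ρ.lift_reynoldsLInfty_two hH, fun _ _ _ => ρ.reynoldsLInfty_three_apply hH,
    fun k hk => ρ.reynoldsLInfty_l_eq_zero hH (ρ.twist_eq_zero H hk),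
    ρ.isReynolds_iff_isMaurerCartan hH⟩
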